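/- **PR evaluation soundness framed by set theory.** Let $T$ be a first-order theory in the language of membership that proves all axioms of Zermelo set theory (extensionality, pairing, union, power set, infinity, separation), e.g. $T=\mathrm{ZF}$. *The theory* $PR$ has the objects $1,\ \mathbb N,\ A\times B$ and the maps generated by $0:1\to\mathbb N$, $s:\mathbb N\to\mathbb N$, identities, composition, terminal maps, projections, induced maps $(f,g)$, and iteration $f:A\to A\ \mapsto\ f^{\S}:A\times\mathbb N\to A$. Its equality is generated by: equality is an equivalence relation compatible with composition and with $(f,g)$; the category axioms; uniqueness of maps to $1$; $\ell(f,g)=f$, $r(f,g)=g$, $(\ell h,rh)=h$, $(f,g)h=(fh,gh)$; $f^{\S}(\mathrm{id},0)=\mathrm{id}$, $f^{\S}(A\times s)=f\,f^{\S}$; and Freyd's rule: $h(\mathrm{id},0)=f$ and $h(A\times s)=g\,h$ imply $h=g^{\S}(f\times\mathbb N)$. *The theory* $PR\mathbb X$. The universal set $\mathbb X$ consists of all numerals $\nu n$ $(n\in\mathbb N)$ and all nested pairs $\langle x;y\rangle$ of such; $\bot$ is a waste symbol, and $\mathbb X\cup\{\bot\}$ is coded in $\mathbb N$. $PR\mathbb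 X$ consists of the maps $\mathbb X\cup\{\bot\}\to\mathbb X\cup\{\bot\}$ generated from zero ($\nu0\mapsto\nu0$), successor ($\nu n\mapsto\nu(n+1)$), identity, terminal map ($x\mapsto\nu 0$), diagonal, and the two projections (on pairs) by composition $g\circ f$, induced map $x\mapsto\langle fx;gx\rangle$, product map $\langle x;y\rangle\mapsto\langle fx;gy\rangle$, and iteration $f^{\dot\S}:\langle x;\nu n\rangle\mapsto f^n(x)$; in all other cases, and whenever $\bot$ occurs as argument or component, the value is $\bot$. Each such map is given by a $PR$ map $\mathbb N\to\mathbb N$, and equality in $PR\mathbb X$ is $PR$-equality of these maps. A predicate is a $PR\mathbb X$ map $\chi:\mathbb X\to\{\nu0,\nu1\}$ (provably in $PR$). Objects of $PR\mathbb X_a$ are the sets $A=\{x\in\mathbb X:\chi(x)\}$ for predicates $\chi$, and maps $A\to B=\{x\in\mathbb X:\varphi(x)\}$ are the $PR\mathbb X$ maps $f$ with $PR\vdash\chi(a)\Rightarrow\varphi(f(a))$. *Inside* $T$, let $\ulcorner PR\mathbb X\urcorner\subset\mathbb N$ be the set of codes of $PR\mathbb X$ map terms, and for such codes $u,v$ and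 $k\in\mathbb N$ let $u\,\check=_k\,v$ say that $k$ codes a deduction tree of $PR$ whose root is the equality of the $PR$ maps $\mathbb N\to\mathbb N$ denoted by $u$ and $v$. Let $u\,\check=\,v$ mean $\exists k\;u\,\check=_k\,v$, and let $\mathrm{Pro}_{PR}(k,u)$ mean $u\,\check=_k\ulcorner\mathrm{true}\urcorner$, where $\mathrm{true}$ is the map $x\mapsto\nu 1$ on $\mathbb X$. Evaluation $ev(u,x)$ is given by its double recursive equations: $ev(\ulcorner ba\urcorner,x)=ba(x)$ for the basic maps $ba$, $ev(v\odot u,x)=ev(v,ev(u,x))$, $ev(\langle u;v\rangle,x)=\langle ev(u,x);ev(v,x)\rangle$, $ev(u\#v,\langle x;y\rangle)=\langle ev(u,x);ev(v,y)\rangle$, $ev(u^{\$},\langle x;\nu0\rangle)=x$, $ev(u^{\$},\langle x;\nu(n+1)\rangle)=ev(u,ev(u^{\$},\langle x;\nu n\rangle))$, and $\bot$ in the remaining (trash) cases. Here $v\odot u$, $\langle u;v\rangle$, $u\#v$, $u^{\$}$ are the codes of composition, induced map, product map and iterated. Then: 1. $T\vdash$ for all $k\in\mathbb N$, $u,v\in\ulcorner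 PR\mathbb X\urcorner$ and $x\in\mathbb X\cup\{\bot\}$: if $u\,\check=_k\,v$, then $ev(u,x)$ and $ev(v,x)$ are (uniquely) defined and $ev(u,x)=ev(v,x)$. 2. For all $PR\mathbb X_a$ maps $f,g:A\to B$: $T\vdash\ \ulcorner f\urcorner\,\check=\,\ulcorner g\urcorner\Rightarrow\forall a\in A\; f(a)=g(a)$. The same holds if the premise is replaced by internal equality on the domain $A=\{\mathbb X:\chi\}$, that is, by internal $PR$-provability of $\chi(a)\Rightarrow f(a)\doteq g(a)$. 3. For every predicate $\chi:\mathbb X\to\{\nu0,\nu1\}$: $T\vdash\ \exists k\,\mathrm{Pro}_{PR}(k,\ulcorner\chi\urcorner)\Rightarrow\forall x\in\mathbb X\;\chi(x)$. -/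

import Mathlib

open FirstOrder FirstOrder.Language

universe w

namespace FramedPR

/-! ## The theory PR of primitive recursion (external syntax) -/

/-- Objects of PR: the terminal object, the natural numbers object, binary products. -/
inductive Ob : Type
  | one : Ob
  | nat : Ob
  | prod : Ob → Ob → Ob

/-- Map terms of PR. `comp g f` is `g ∘ f`, `pair f g` is the induced map `(f, g)`,
`iter f` is the iterated `f^§ : A × ℕ → A`. -/
inductive PR : Ob → Ob → Type
  | zero : PR Ob.one Ob.nat
  | succ : PR Ob.nat Ob.nat
  | id (A : Ob) : PR A A
  | comp {A B C : Ob} (g : PR B C) (f : PR A B) : PR A C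
  | term (A : Ob) : PR A Ob.one
  | fst (A B : Ob) : PR (Ob.prod A B) A
  | snd (A B : Ob) : PR (Ob.prod A B) B
  | pair {A B C : Ob} (f : PR C A) (g : PR C B) : PR C (Ob.prod A B)
  | iter {A : Ob} (f : PR A A) : PR (Ob.prod A Ob.nat) A

namespace PR

/-- The zero map `0 ∘ Π : A → ℕ`. -/
def zeroAt (A : Ob) : PR A Ob.nat := comp zero (term A)

/-- The constant one, `A → ℕ`; this is also the truth value `true`. -/
def oneAt (A : Ob) : PR A Ob.nat := comp succ (zeroAt A)

/-- `(id, 0) : A → A × ℕ`. -/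
def atZero (A : Ob) : PR A (Ob.prod A Ob.nat) := pair (id A) (zeroAt A)

/-- `A × s : A × ℕ → A × ℕ`. -/
def atSucc (A : Ob) : PR (Ob.prod A Ob.nat) (Ob.prod A Ob.nat) :=
  pair (comp (id A) (fst A Ob.nat)) (comp succ (snd A Ob.nat))

/-- `f × ℕ : A × ℕ → B × ℕ`. -/
def timesNat {A B : Ob} (f : PR A B) : PR (Ob.prod A Ob.nat) (Ob.prod B Ob.nat) :=
  pair (comp f (fst A Ob.nat)) (comp (id Ob.nat) (snd A Ob.nat))

end PR

open PR in
/-- Derivable equality `PR ⊢ f = g` of map terms. -/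
inductive PREq : {A B : Ob} → PR A B → PR A B → Prop
  | refl {A B : Ob} (f : PR A B) : PREq f f
  | symm {A B : Ob} {f g : PR A B} : PREq f g → PREq g f
  | trans {A B : Ob} {f g h : PR A B} : PREq f g → PREq g h → PREq f h
  | assoc {A B C D : Ob} (f : PR A B) (g : PR B C) (h : PR C D) :
      PREq (comp h (comp g f)) (comp (comp h g) f)
  | idLeft {A B : Ob} (f : PR A B) : PREq (comp (id B) f) f
  | idRight {A B : Ob} (f : PR A B) : PREq (comp f (id A)) f
  | compFst {A B C : Ob} {f f' : PR A B} (g : PR B C) :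
      PREq f f' → PREq (comp g f) (comp g f')
  | compSnd {A B C : Ob} (f : PR A B) {g g' : PR B C} :
      PREq g g' → PREq (comp g f) (comp g' f)
  | termUnique {A : Ob} (f : PR A Ob.one) : PREq f (term A)
  | pairCongr {A B C : Ob} {f f' : PR C A} {g g' : PR C B} :
      PREq f f' → PREq g g' → PREq (pair f g) (pair f' g')
  | godementFst {A B C : Ob} (f : PR C A) (g : PR C B) :
      PREq (comp (fst A B) (pair f g)) f
  | godementSnd {A B C : Ob} (f : PR C A) (g : PR C B) :
      PREq (comp (snd A B) (pair f g)) g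
  | surjPair {A B C : Ob} (h : PR C (Ob.prod A B)) :
      PREq (pair (comp (fst A B) h) (comp (snd A B) h)) h
  | distr {A B C D : Ob} (h : PR D C) (f : PR C A) (g : PR C B) :
      PREq (comp (pair f g) h) (pair (comp f h) (comp g h))
  | anchor {A : Ob} (f : PR A A) : PREq (comp (iter f) (atZero A)) (id A)
  | step {A : Ob} (f : PR A A) : PREq (comp (iter f) (atSucc A)) (comp f (iter f))
  | freyd {A B : Ob} (f : PR A B) (g : PR B B) (h : PR (Ob.prod A Ob.nat) B) :
      PREq (comp h (atZero A)) f → PREq (comp h (atSucc A)) (comp g h) →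
      PREq h (comp (iter g) (timesNat f))

/-! ## Some arithmetic as PR maps -/

namespace PR

/-- Full primitive recursion: `f(a, 0) = g(a)`, `f(a, n + 1) = h((a, n), f(a, n))`. -/
def prec {A B : Ob} (g : PR A B) (h : PR (Ob.prod (Ob.prod A Ob.nat) B) B) :
    PR (Ob.prod A Ob.nat) B :=
  comp (snd (Ob.prod A Ob.nat) B)
    (comp (iter (pair (comp (atSucc A) (fst (Ob.prod A Ob.nat) B)) h))
      (timesNat (pair (atZero A) g)))

/-- `(a, 0) ↦ g(a)`, `(a, n + 1) ↦ h(a, n)`. -/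
def cases {A B : Ob} (g : PR A B) (h : PR (Ob.prod A Ob.nat) B) : PR (Ob.prod A Ob.nat) B :=
  prec g (comp h (fst (Ob.prod A Ob.nat) B))

/-- `0 ↦ z`, `n + 1 ↦ h(n)`. -/
def casesNat {B : Ob} (z : PR Ob.one B) (h : PR Ob.nat B) : PR Ob.nat B :=
  comp (cases z (comp h (snd Ob.one Ob.nat))) (pair (term Ob.nat) (id Ob.nat))

/-- `(a, b) ↦ (b, a)`. -/
def swap (A B : Ob) : PR (Ob.prod A B) (Ob.prod B A) := pair (snd A B) (fst A B)

def add : PR (Ob.prod Ob.nat Ob.nat) Ob.nat := iter succ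

def pred : PR Ob.nat Ob.nat := casesNat zero (id Ob.nat)

/-- Truncated subtraction. -/
def monus : PR (Ob.prod Ob.nat Ob.nat) Ob.nat := iter pred

/-- `0 ↦ 1`, `n + 1 ↦ 0`. -/
def neg : PR Ob.nat Ob.nat := casesNat (oneAt Ob.one) (zeroAt Ob.nat)

/-- The equality predicate of `ℕ`, with values in `{0, 1}`. -/
def eqNat : PR (Ob.prod Ob.nat Ob.nat) Ob.nat :=
  comp neg (comp add (pair monus (comp monus (swap Ob.nat Ob.nat))))

/-- Implication: `(0, b) ↦ 1`, `(n + 1, b) ↦ b`. -/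
def imp : PR (Ob.prod Ob.nat Ob.nat) Ob.nat :=
  comp (cases (oneAt Ob.nat) (fst Ob.nat Ob.nat)) (swap Ob.nat Ob.nat)

/-- One step of Cantor's walk: `(m, n + 1) ↦ (m + 1, n)` and `(m, 0) ↦ (0, m + 1)`. -/
def walk : PR (Ob.prod Ob.nat Ob.nat) (Ob.prod Ob.nat Ob.nat) :=
  cases (pair (zeroAt Ob.nat) succ)
    (pair (comp succ (fst Ob.nat Ob.nat)) (snd Ob.nat Ob.nat))

/-- Cantor's count of `ℕ × ℕ`: the `k`-th station of the walk that starts at `(0, 0)`. -/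
def unpair : PR Ob.nat (Ob.prod Ob.nat Ob.nat) :=
  comp (iter walk) (pair (pair (zeroAt Ob.nat) (zeroAt Ob.nat)) (id Ob.nat))

/-- Triangular numbers. -/
def triangle : PR Ob.nat Ob.nat :=
  comp (prec zero
      (comp add (pair (snd (Ob.prod Ob.one Ob.nat) Ob.nat)
        (comp succ (comp (snd Ob.one Ob.nat) (fst (Ob.prod Ob.one Ob.nat) Ob.nat))))))
    (pair (term Ob.nat) (id Ob.nat))

/-- The inverse of `unpair`. -/
def cpair : PR (Ob.prod Ob.nat Ob.nat) Ob.nat :=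
  comp add (pair (comp triangle add) (fst Ob.nat Ob.nat))

end PR

/-! ## The universe monoid PRX

The elements of the universal set `X` (nested pairs of numerals) and the waste symbol `⊥` are
coded bijectively by natural numbers: `⊥` is `0`, the numeral `ν n` is `1 + c(0, n)`, and the pair
`⟨x; y⟩` of `x, y ≥ 1` is `1 + c(x, y - 1)`, where `c` is Cantor's pairing. So `X` is the set of
positive numbers, and `X ∪ {⊥}` is `ℕ`. -/

/-- Map terms of PRX: zero, successor, identity, terminal map, diagonal, projections; composition
`comp g f = g ∘ f`, induced map, product map, iterated map. -/
inductive PRX : Type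
  | zero : PRX
  | succ : PRX
  | id : PRX
  | term : PRX
  | diag : PRX
  | fst : PRX
  | snd : PRX
  | comp (g f : PRX) : PRX
  | ind (f g : PRX) : PRX
  | prod (f g : PRX) : PRX
  | iter (f : PRX) : PRX

namespace PR

/-- `ν 0 ↦ ν 0`, everything else to `⊥`. -/
def xzero : PR Ob.nat Ob.nat :=
  casesNat zero (casesNat (oneAt Ob.one) (zeroAt Ob.nat))

/-- `ν n ↦ ν (n + 1)`, everything else to `⊥`. -/
def xsucc : PR Ob.nat Ob.nat :=
  casesNat zero
    (comp
      (comp (cases (comp succ (comp cpair (pair (zeroAt Ob.nat) succ)))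
          (zeroAt (Ob.prod Ob.nat Ob.nat)))
        (swap Ob.nat Ob.nat))
      unpair)

/-- `x ↦ ν 0` on `X`, `⊥ ↦ ⊥`. -/
def xterm : PR Ob.nat Ob.nat := casesNat zero (oneAt Ob.nat)

/-- `(x, y) ↦ ⟨x; y⟩` for `x, y` in `X`; the value is `⊥` if one of the arguments is `⊥`. -/
def xpair : PR (Ob.prod Ob.nat Ob.nat) Ob.nat :=
  cases (zeroAt Ob.nat)
    (comp
      (cases (zeroAt Ob.nat)
        (comp succ (comp cpair (pair (comp succ (snd Ob.nat Ob.nat)) (fst Ob.nat Ob.nat)))))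
      (swap Ob.nat Ob.nat))

/-- `⟨x; y⟩ ↦ x`, everything else to `⊥`. -/
def xfst : PR Ob.nat Ob.nat := casesNat zero (comp (fst Ob.nat Ob.nat) unpair)

/-- `⟨x; y⟩ ↦ y`, everything else to `⊥`. -/
def xsnd : PR Ob.nat Ob.nat :=
  casesNat zero
    (comp
      (comp (cases (zeroAt Ob.nat) (comp succ (fst Ob.nat Ob.nat))) (swap Ob.nat Ob.nat))
      unpair)

/-- `ν n ↦ n`. -/
def xnum : PR Ob.nat Ob.nat := casesNat zero (comp (snd Ob.nat Ob.nat) unpair)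

/-- `⟨x; ν n⟩ ↦ (x, n)`. -/
def xprep : PR Ob.nat (Ob.prod Ob.nat Ob.nat) := pair xfst (comp xnum xsnd)

/-- `(y, ν n) ↦ y`, and `(y, z) ↦ ⊥` if `z` is not a numeral. -/
def xguard : PR (Ob.prod Ob.nat Ob.nat) Ob.nat :=
  cases (zeroAt Ob.nat)
    (comp (cases (id Ob.nat) (zeroAt (Ob.prod Ob.nat Ob.nat)))
      (pair (fst Ob.nat Ob.nat)
        (comp (comp (fst Ob.nat Ob.nat) unpair) (snd Ob.nat Ob.nat))))

end PR

namespace PRX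

/-- The map of PR from `ℕ` to `ℕ` that a PRX term denotes. -/
def toPR : PRX → PR Ob.nat Ob.nat
  | zero => PR.xzero
  | succ => PR.xsucc
  | id => PR.id Ob.nat
  | term => PR.xterm
  | diag => PR.comp PR.xpair (PR.pair (PR.id Ob.nat) (PR.id Ob.nat))
  | fst => PR.xfst
  | snd => PR.xsnd
  | comp g f => PR.comp g.toPR f.toPR
  | ind f g => PR.comp PR.xpair (PR.pair f.toPR g.toPR)
  | prod f g =>
      PR.comp PR.xpair (PR.pair (PR.comp f.toPR PR.xfst) (PR.comp g.toPR PR.xsnd))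
  | iter f =>
      PR.comp PR.xguard (PR.pair (PR.comp (PR.iter f.toPR) PR.xprep) PR.xsnd)

/-- The predicate `true`: `x ↦ ν 1` on `X`, `⊥ ↦ ⊥`. -/
def true : PRX := comp succ (comp zero term)

/-- `ν 0 ↦ ν 0`, `ν (n + 1) ↦ ν 1`, everything else to `⊥`. -/
def sign : PRX := comp (iter true) (ind (comp zero term) id)

/-- `χ` is a predicate `X → 2 = {ν 0, ν 1}`: PR derives `sign ∘ χ = χ` and `Π ∘ χ = Π`
(the latter says that `χ` has no value `⊥` on `X`). -/
def IsPredicate (χ : PRX) : Prop :=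
  PREq (comp sign χ).toPR χ.toPR ∧ PREq (comp term χ).toPR term.toPR

/-- The PR predicate `f(a) ≐ g(a)`. -/
def eqPred (f g : PRX) : PR Ob.nat Ob.nat := PR.comp PR.eqNat (PR.pair f.toPR g.toPR)

/-- The PR predicate `χ(a) ⟹ f(a) ≐ g(a)`. -/
def impEq (χ f g : PRX) : PR Ob.nat Ob.nat :=
  PR.comp PR.imp (PR.pair (eqPred χ true) (eqPred f g))

end PRX

/-! ## The theory PRXa: PRX with predicate abstraction -/

/-- Objects `{X : χ}` of PRXa. -/
structure PRXaObj where
  χ : PRX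
  isPredicate : χ.IsPredicate

/-- Maps `f : {X : χ} → {X : φ}` of PRXa: maps `f` of PRX such that PR derives
`χ(a) ⟹ φ(f(a))`. -/
structure PRXaMap (A B : PRXaObj) where
  f : PRX
  maps : PREq (PRX.impEq A.χ (PRX.comp B.χ f) PRX.true) (PR.oneAt Ob.nat)

/-! ## Set theory -/

inductive setRel : ℕ → Type
  | mem : setRel 2

/-- The first order language with one binary relation symbol, membership. -/
def setLang : Language := ⟨fun _ => Empty, setRel⟩

/-- The membership symbol. -/
def memSym : setLang.Relations 2 := setRel.mem

/-- The atomic formula `x_i ∈ x_j`. -/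
def memF {n : ℕ} (i j : Fin n) : setLang.BoundedFormula Empty n :=
  memSym.boundedFormula₂ (&i) (&j)

/-- The atomic formula `x_i = x_j`. -/
def eqF {n : ℕ} (i j : Fin n) : setLang.BoundedFormula Empty n :=
  Term.bdEqual (L := setLang) (&i) (&j)

def extensionality : setLang.Sentence :=
  ∀' ∀' ((∀' ((memF 2 0) ⇔ (memF 2 1))) ⟹ eqF 0 1)

def pairing : setLang.Sentence :=
  ∀' ∀' ∃' ∀' ((memF 3 2) ⇔ (eqF 3 0 ⊔ eqF 3 1))

def union : setLang.Sentence :=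
  ∀' ∃' ∀' ((memF 2 1) ⇔ (∃' (memF 2 3 ⊓ memF 3 0)))

def powerset : setLang.Sentence :=
  ∀' ∃' ∀' ((memF 2 1) ⇔ (∀' (memF 3 2 ⟹ memF 3 0)))

def infinity : setLang.Sentence :=
  ∃' ((∃' (memF 1 0 ⊓ ∀' ∼(memF 2 1))) ⊓
    ∀' (memF 1 0 ⟹ ∃' (memF 2 0 ⊓ ∀' ((memF 3 2) ⇔ (memF 3 1 ⊔ eqF 3 1)))))

/-- Separation for a formula `φ` in the parameters `x_0, …, x_(n-1)` and the element variable
`x_n`: for all parameters and all `a` there is a `b` whose elements are the `x ∈ a` with `φ`. -/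
def separation (n : ℕ) (φ : setLang.BoundedFormula Empty (n + 1)) : setLang.Sentence :=
  BoundedFormula.alls (n := n) (∀' ∃' ∀'
    ((memF (n := n + 3) ⟨n + 2, by omega⟩ ⟨n + 1, by omega⟩) ⇔
      ((memF (n := n + 3) ⟨n + 2, by omega⟩ ⟨n, by omega⟩) ⊓ (φ.liftAt 2 n))))

/-- Zermelo set theory. -/
def zermelo : setLang.Theory :=
  {extensionality, pairing, union, powerset, infinity} ∪
    {σ | ∃ (n : ℕ) (φ : setLang.BoundedFormula Empty (n + 1)), σ = separation n φ}

/-- `T` derives `Φ`: `Φ` holds in all models of `T`. It is used for properties `Φ` whose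
definition quantifies over elements of the model only, that is, for first order formulas. -/
def Derives (T : setLang.Theory)
    (Φ : ∀ (M : Type w) [setLang.Structure M] [Nonempty M], Prop) : Prop :=
  ∀ (M : Type w) [setLang.Structure M] [Nonempty M], M ⊨ T → Φ M

/-! ## Notions inside a model of set theory

All quantifiers below range over elements of the model `M`. In particular natural numbers,
codes and deduction trees are those of `M`, standard or not. -/

noncomputable section

variable {M : Type*} [setLang.Structure M] [Nonempty M]

/-- Membership of the model. -/
def Mem (x y : M) : Prop := Structure.RelMap memSym ![x, y]

infix:50 " ∈ₘ " => Mem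

/-- Description operator: the element with property `P`; it is applied only where `P` is
satisfied by exactly one element. -/
def the (P : M → Prop) : M := Classical.epsilon P

def empty : M := the fun e : M => ∀ z, ¬ z ∈ₘ e

/-- `n ∪ {n}`. -/
def suc (n : M) : M := the fun m => ∀ z, z ∈ₘ m ↔ z ∈ₘ n ∨ z = n

/-- `n ∈ ω`: `n` is an element of all inductive sets. -/
def IsNat (n : M) : Prop :=
  ∀ I : M, empty ∈ₘ I → (∀ m, m ∈ₘ I → suc m ∈ₘ I) → n ∈ₘ I

/-- `{x, y}`. -/
def upair (x y : M) : M := the fun p => ∀ z, z ∈ₘ p ↔ z = x ∨ z = y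

/-- The Kuratowski pair. -/
def kpair (x y : M) : M := upair (upair x x) (upair x y)

/-- `S` contains all `(k, (m, n))` such that Cantor's walk is in `(m, n)` after `k` steps. -/
structure CantorClosed (S : M) : Prop where
  start : kpair empty (kpair empty empty) ∈ₘ S
  down : ∀ k m n, IsNat k → IsNat m → IsNat n →
    kpair k (kpair m (suc n)) ∈ₘ S → kpair (suc k) (kpair (suc m) n) ∈ₘ S
  jump : ∀ k m, IsNat k → IsNat m →
    kpair k (kpair m empty) ∈ₘ S → kpair (suc k) (kpair empty (suc m)) ∈ₘ S

/-- Cantor's pairing of natural numbers. -/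
def cp (m n : M) : M :=
  the fun k => IsNat k ∧ ∀ S, CantorClosed S → kpair k (kpair m n) ∈ₘ S

def num : ℕ → M
  | 0 => empty
  | n + 1 => suc (num n)

def tri (a b c : M) : M := cp a (cp b c)

/-- The code with tag `t` and entries `a`, `b`. -/
def code (t : ℕ) (a b : M) : M := tri (num t) a b

/-! ### Inductively defined sets of numbers, as intersections of all closed sets -/

def In1 (S a : M) : Prop := IsNat a ∧ a ∈ₘ S

def In2 (S a b : M) : Prop := IsNat a ∧ IsNat b ∧ cp a b ∈ₘ S

def In3 (S a b c : M) : Prop := IsNat a ∧ IsNat b ∧ IsNat c ∧ tri a b c ∈ₘ S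

/-- The least unary relation on numbers with the closure property `C`. -/
def Least1 (C : (M → Prop) → Prop) (a : M) : Prop :=
  IsNat a ∧ ∀ S : M, C (In1 S) → In1 S a

def Least2 (C : (M → M → Prop) → Prop) (a b : M) : Prop :=
  IsNat a ∧ IsNat b ∧ ∀ S : M, C (In2 S) → In2 S a b

def Least3 (C : (M → M → M → Prop) → Prop) (a b c : M) : Prop :=
  IsNat a ∧ IsNat b ∧ IsNat c ∧ ∀ S : M, C (In3 S) → In3 S a b c

/-! ### Codes of PR objects and maps -/

def oOne : M := code 0 empty empty
def oNat : M := code 1 empty empty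
def oProd (A B : M) : M := code 2 A B

def pZero : M := code 0 empty empty
def pSucc : M := code 1 empty empty
def pId (A : M) : M := code 2 A empty
def pComp (g f : M) : M := code 3 g f
def pTerm (A : M) : M := code 4 A empty
def pFst (A B : M) : M := code 5 A B
def pSnd (A B : M) : M := code 6 A B
def pPair (f g : M) : M := code 7 f g
def pIter (f : M) : M := code 8 f empty

def pAtZero (A : M) : M := pPair (pId A) (pComp pZero (pTerm A))
def pAtSucc (A : M) : M :=
  pPair (pComp (pId A) (pFst A oNat)) (pComp pSucc (pSnd A oNat))
def pTimesNat (A f : M) : M :=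
  pPair (pComp f (pFst A oNat)) (pComp (pId oNat) (pSnd A oNat))

/-- The code in `M` of an object of PR. -/
def _root_.FramedPR.Ob.quote : Ob → M
  | Ob.one => oOne
  | Ob.nat => oNat
  | Ob.prod A B => oProd A.quote B.quote

/-- The code in `M` of a map term of PR. -/
def _root_.FramedPR.PR.quote : {A B : Ob} → PR A B → M
  | _, _, PR.zero => pZero
  | _, _, PR.succ => pSucc
  | _, _, PR.id A => pId A.quote
  | _, _, PR.comp g f => pComp g.quote f.quote
  | _, _, PR.term A => pTerm A.quote
  | _, _, PR.fst A B => pFst A.quote B.quote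
  | _, _, PR.snd A B => pSnd A.quote B.quote
  | _, _, PR.pair f g => pPair f.quote g.quote
  | _, _, PR.iter f => pIter f.quote

structure ObClosed (R : M → Prop) : Prop where
  one : R oOne
  nat : R oNat
  prod : ∀ A B, R A → R B → R (oProd A B)

/-- `A` is the code of an object of PR. -/
def IsOb (A : M) : Prop := Least1 ObClosed A

structure TypeClosed (R : M → M → M → Prop) : Prop where
  zero : R pZero oOne oNat
  succ : R pSucc oNat oNat
  id : ∀ A, IsOb A → R (pId A) A A
  comp : ∀ f g A B C, R f A B → R g B C → R (pComp g f) A C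
  term : ∀ A, IsOb A → R (pTerm A) A oOne
  fst : ∀ A B, IsOb A → IsOb B → R (pFst A B) (oProd A B) A
  snd : ∀ A B, IsOb A → IsOb B → R (pSnd A B) (oProd A B) B
  pair : ∀ f g A B C, R f C A → R g C B → R (pPair f g) C (oProd A B)
  iter : ∀ f A, R f A A → R (pIter f) (oProd A oNat) A

/-- `f` is the code of a map term `A → B` of PR. -/
def HasType (f A B : M) : Prop := Least3 TypeClosed f A B

/-- Closure under the deduction rules of PR; `R k f g` means that `k` is (the code of) a
deduction tree with root `f ≐ g`. The number `k` lists the last rule, its data, and the trees of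
the premises. -/
structure DedClosed (R : M → M → M → Prop) : Prop where
  refl : ∀ f A B, HasType f A B → R (code 0 f empty) f f
  symm : ∀ i f g, R i f g → R (code 1 i empty) g f
  trans : ∀ i j f g h, R i f g → R j g h → R (code 2 i j) f h
  assoc : ∀ f g h A B C D, HasType f A B → HasType g B C → HasType h C D →
    R (code 3 h (cp g f)) (pComp h (pComp g f)) (pComp (pComp h g) f)
  idLeft : ∀ f A B, HasType f A B → R (code 4 f empty) (pComp (pId B) f) f
  idRight : ∀ f A B, HasType f A B → R (code 5 f empty) (pComp f (pId A)) f
  compFst : ∀ i f f' g A B C, HasType f A B → HasType f' A B → HasType g B C →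
    R i f f' → R (code 6 i g) (pComp g f) (pComp g f')
  compSnd : ∀ i f g g' A B C, HasType f A B → HasType g B C → HasType g' B C →
    R i g g' → R (code 7 i f) (pComp g f) (pComp g' f)
  termUnique : ∀ f A, HasType f A oOne → R (code 8 f empty) f (pTerm A)
  pairCongr : ∀ i j f f' g g' A B C, HasType f C A → HasType f' C A →
    HasType g C B → HasType g' C B → R i f f' → R j g g' →
    R (code 9 i j) (pPair f g) (pPair f' g')
  godementFst : ∀ f g A B C, HasType f C A → HasType g C B →
    R (code 10 f g) (pComp (pFst A B) (pPair f g)) f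
  godementSnd : ∀ f g A B C, HasType f C A → HasType g C B →
    R (code 11 f g) (pComp (pSnd A B) (pPair f g)) g
  surjPair : ∀ h A B C, HasType h C (oProd A B) →
    R (code 12 h empty) (pPair (pComp (pFst A B) h) (pComp (pSnd A B) h)) h
  distr : ∀ h f g A B C D, HasType h D C → HasType f C A → HasType g C B →
    R (code 13 h (cp f g)) (pComp (pPair f g) h) (pPair (pComp f h) (pComp g h))
  anchor : ∀ f A, HasType f A A →
    R (code 14 f empty) (pComp (pIter f) (pAtZero A)) (pId A)
  step : ∀ f A, HasType f A A →
    R (code 15 f empty) (pComp (pIter f) (pAtSucc A)) (pComp f (pIter f))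
  freyd : ∀ i j f g h A B, HasType f A B → HasType g B B → HasType h (oProd A oNat) B →
    R i (pComp h (pAtZero A)) f → R j (pComp h (pAtSucc A)) (pComp g h) →
    R (code 16 i j) h (pComp (pIter g) (pTimesNat A f))

/-- Internal equality of PR maps: `k` is a deduction tree of PR with root `f ≐ g`. -/
def PRDed (k f g : M) : Prop := Least3 DedClosed k f g

/-! ### Codes of PRX maps -/

def xZero : M := code 0 empty empty
def xSucc : M := code 1 empty empty
def xId : M := code 2 empty empty
def xTerm : M := code 3 empty empty
def xDiag : M := code 4 empty empty
def xFst : M := code 5 empty empty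
def xSnd : M := code 6 empty empty
def xComp (v u : M) : M := code 7 v u
def xInd (u v : M) : M := code 8 u v
def xProd (u v : M) : M := code 9 u v
def xIter (u : M) : M := code 10 u empty

/-- The code in `M` of a map term of PRX. -/
def _root_.FramedPR.PRX.quote : PRX → M
  | PRX.zero => xZero
  | PRX.succ => xSucc
  | PRX.id => xId
  | PRX.term => xTerm
  | PRX.diag => xDiag
  | PRX.fst => xFst
  | PRX.snd => xSnd
  | PRX.comp g f => xComp g.quote f.quote
  | PRX.ind f g => xInd f.quote g.quote
  | PRX.prod f g => xProd f.quote g.quote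
  | PRX.iter f => xIter f.quote

structure PRXClosed (R : M → Prop) : Prop where
  zero : R xZero
  succ : R xSucc
  id : R xId
  term : R xTerm
  diag : R xDiag
  fst : R xFst
  snd : R xSnd
  comp : ∀ u v, R u → R v → R (xComp v u)
  ind : ∀ u v, R u → R v → R (xInd u v)
  prod : ∀ u v, R u → R v → R (xProd u v)
  iter : ∀ u, R u → R (xIter u)

/-- `u` is in the map code set of PRX. -/
def IsPRX (u : M) : Prop := Least1 PRXClosed u

/-- The clauses of `PRX.toPR`, on codes. -/
structure ToPRClosed (R : M → M → Prop) : Prop where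
  zero : R xZero PRX.zero.toPR.quote
  succ : R xSucc PRX.succ.toPR.quote
  id : R xId PRX.id.toPR.quote
  term : R xTerm PRX.term.toPR.quote
  diag : R xDiag PRX.diag.toPR.quote
  fst : R xFst PRX.fst.toPR.quote
  snd : R xSnd PRX.snd.toPR.quote
  comp : ∀ u v p q, R u p → R v q → R (xComp v u) (pComp q p)
  ind : ∀ u v p q, R u p → R v q →
    R (xInd u v) (pComp PR.xpair.quote (pPair p q))
  prod : ∀ u v p q, R u p → R v q →
    R (xProd u v)
      (pComp PR.xpair.quote (pPair (pComp p PR.xfst.quote) (pComp q PR.xsnd.quote)))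
  iter : ∀ u p, R u p →
    R (xIter u)
      (pComp PR.xguard.quote
        (pPair (pComp (pIter p) PR.xprep.quote) PR.xsnd.quote))

/-- `p` is the code of the PR map `ℕ → ℕ` that the PRX code `u` denotes. -/
def ToPR (u p : M) : Prop := Least2 ToPRClosed u p

/-- Internal equality `u ≐_k v` of PRX codes, inherited from PR: `k` is a deduction tree of PR
for the equality of the maps `ℕ → ℕ` denoted by `u` and `v`. -/
def EqPRX (k u v : M) : Prop := ∃ p q : M, ToPR u p ∧ ToPR v q ∧ PRDed k p q

/-- `k` is a proof of the predicate with code `c`. -/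
def Pro (k c : M) : Prop := EqPRX k c PRX.true.quote

/-! ### Evaluation -/

/-- The waste symbol. -/
def bot : M := empty

/-- `x ∈ X`. -/
def InX (x : M) : Prop := IsNat x ∧ x ≠ bot

/-- The numeral `ν n`. -/
def nu (n : M) : M := suc (cp empty n)

/-- `z = ⟨x; y⟩` with `x, y ∈ X`. -/
def IsXPair (x y z : M) : Prop :=
  InX x ∧ InX y ∧ ∃ n, IsNat n ∧ y = suc n ∧ z = suc (cp x n)

/-- `z = ⟨x; y⟩`, with trash propagation. -/
def XPairVal (x y z : M) : Prop :=
  IsXPair x y z ∨ ((x = bot ∨ y = bot) ∧ z = bot)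

/-- The double recursive equations of evaluation; `R u x y` stands for `ev(u, x) = y`. -/
structure EvClosed (R : M → M → M → Prop) : Prop where
  zero : R xZero (nu empty) (nu empty)
  zeroTrash : ∀ x, IsNat x → x ≠ nu empty → R xZero x bot
  succ : ∀ n, IsNat n → R xSucc (nu n) (nu (suc n))
  succTrash : ∀ x, IsNat x → (∀ n, IsNat n → x ≠ nu n) → R xSucc x bot
  id : ∀ x, IsNat x → R xId x x
  term : ∀ x, InX x → R xTerm x (nu empty)
  termTrash : R xTerm bot bot
  diag : ∀ x z, IsNat x → XPairVal x x z → R xDiag x z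
  fst : ∀ x y z, IsXPair x y z → R xFst z x
  fstTrash : ∀ z, IsNat z → (∀ x y, ¬ IsXPair x y z) → R xFst z bot
  snd : ∀ x y z, IsXPair x y z → R xSnd z y
  sndTrash : ∀ z, IsNat z → (∀ x y, ¬ IsXPair x y z) → R xSnd z bot
  comp : ∀ u v x y z, R u x y → R v y z → R (xComp v u) x z
  ind : ∀ u v x y z w, R u x y → R v x z → XPairVal y z w → R (xInd u v) x w
  prod : ∀ u v x y z x' y' w, IsXPair x y z → R u x x' → R v y y' → XPairVal x' y' w →
    R (xProd u v) z w
  prodTrash : ∀ u v z, IsPRX u → IsPRX v → IsNat z → (∀ x y, ¬ IsXPair x y z) →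
    R (xProd u v) z bot
  iterZero : ∀ u x z, IsPRX u → IsXPair x (nu empty) z → R (xIter u) z x
  iterSucc : ∀ u x n z z' y w, IsNat n → IsXPair x (nu n) z → IsXPair x (nu (suc n)) z' →
    R (xIter u) z y → R u y w → R (xIter u) z' w
  iterTrash : ∀ u z, IsPRX u → IsNat z → (∀ x n, IsNat n → ¬ IsXPair x (nu n) z) →
    R (xIter u) z bot

/-- The graph `ev(u, x) = y` of evaluation. -/
def Ev (u x y : M) : Prop := Least3 EvClosed u x y

/-! ### Concrete maps in set theory -/

/-- The graph `f(a) = b` in `M` of a map of PR: the object `1` is `{∅}`, the natural numbers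
object is `ω`, products are sets of Kuratowski pairs. -/
def _root_.FramedPR.PR.Val : {A B : Ob} → PR A B → M → M → Prop
  | _, _, PR.zero, _, b => b = empty
  | _, _, PR.succ, a, b => b = suc a
  | _, _, PR.id _, a, b => b = a
  | _, _, PR.comp g f, a, b => ∃ c, f.Val a c ∧ g.Val c b
  | _, _, PR.term _, _, b => b = empty
  | _, _, PR.fst _ _, a, b => ∃ c, a = kpair b c
  | _, _, PR.snd _ _, a, b => ∃ c, a = kpair c b
  | _, _, PR.pair f g, a, b => ∃ c d, f.Val a c ∧ g.Val a d ∧ b = kpair c d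
  | _, _, PR.iter f, a, b => ∃ x n, IsNat n ∧ a = kpair x n ∧
      ∀ S : M, kpair empty x ∈ₘ S →
        (∀ m y z, IsNat m → kpair m y ∈ₘ S → f.Val y z → kpair (suc m) z ∈ₘ S) →
        kpair n b ∈ₘ S

/-- The graph `f(a) = b` in `M` of a map of PRX. -/
def _root_.FramedPR.PRX.Val (f : PRX) (a b : M) : Prop := f.toPR.Val a b

/-- The predicate `χ` holds at `a`. -/
def _root_.FramedPR.PRX.Holds (χ : PRX) (a : M) : Prop := ∀ z : M, χ.Val a z ↔ z = nu (num 1)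

/-- `F` and `G` are both defined with exactly one value, and these values are equal. -/
def SameValue (F G : M → Prop) : Prop := ∃ y : M, (∀ z, F z ↔ z = y) ∧ (∀ z, G z ↔ z = y)

end

end FramedPR

open FramedPR

/-! Fix a model `M` of `T`. It satisfies Zermelo's axioms, but its numbers, codes and deduction
trees may be nonstandard. An induction over them is therefore legitimate only for a first order
definable predicate, which separation turns into a set of `M`. `Df`, `Dfn` and `DfnF` form the
calculus that verifies definability; `Omega.induction` and `lfp_induction` are the induction
principles obtained from it.

Since ω is a set of `M`, evaluation of arbitrary codes of PR, which PR itself does not provide,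
becomes a definable relation: `EvPR` is the least fixed point of the recursive clauses. By induction
inside `M`, a well typed code evaluates to a total, single-valued function between the coded objects
(`lift3_typed`), and each deduction rule preserves equality of these functions; Freyd's rule is
uniqueness of iteration, hence induction on ω. So a deduction tree with root `f ≐ g` forces `f` and
`g` to have the same graph (`lift2_sameEv`).

Codes of PRX are translated into codes of PR maps from ℕ to ℕ (`Transl`). The double recursive
evaluation `Ev` coincides with `EvPR` of the translation; the two inclusions are `Ev.evPR` and
`Transl.in3`. This yields evaluation soundness, `EqPRX.sameValue_ev`.

For actual map terms, evaluating the quoted term gives the denoted function `PR.den`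
(`evPR_cd_den`), and the concrete graph `PR.Val` is the graph of the same function (`PR.val_enc`).
An internal equation between quotes thus becomes an equation between the maps themselves. For
equality on a domain, the provable implication is evaluated at a point where its premise has the
value 1; logical soundness is the case of an equation with `PRX.true`. -/

namespace FramedPR

/-! ## Definability with parameters -/

section Definability

variable {M : Type w} [setLang.Structure M]

/-- `P` is first order definable with parameters from `M`; the free variables of the formula are
the parameters. -/
def Df {n : ℕ} (P : (Fin n → M) → Prop) : Prop :=
  ∃ φ : setLang.BoundedFormula M n, ∀ v, φ.Realize id v ↔ P v

namespace Df

theorem congr {n : ℕ} {P Q : (Fin n → M) → Prop} (hP : Df P) (h : ∀ v, Q v ↔ P v) : Df Q := by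
  obtain ⟨φ, hφ⟩ := hP
  exact ⟨φ, fun v => (hφ v).trans (h v).symm⟩

theorem not {n : ℕ} {P : (Fin n → M) → Prop} (hP : Df P) : Df fun v => ¬ P v := by
  obtain ⟨φ, hφ⟩ := hP
  exact ⟨φ.not, fun v => by simp [hφ]⟩

theorem and {n : ℕ} {P Q : (Fin n → M) → Prop} (hP : Df P) (hQ : Df Q) :
    Df fun v => P v ∧ Q v := by
  obtain ⟨φ, hφ⟩ := hP
  obtain ⟨ψ, hψ⟩ := hQ
  exact ⟨φ ⊓ ψ, fun v => by simp [hφ, hψ]⟩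

theorem or {n : ℕ} {P Q : (Fin n → M) → Prop} (hP : Df P) (hQ : Df Q) :
    Df fun v => P v ∨ Q v := by
  obtain ⟨φ, hφ⟩ := hP
  obtain ⟨ψ, hψ⟩ := hQ
  exact ⟨φ ⊔ ψ, fun v => by simp [hφ, hψ]⟩

theorem iff {n : ℕ} {P Q : (Fin n → M) → Prop} (hP : Df P) (hQ : Df Q) :
    Df fun v => (P v ↔ Q v) := by
  obtain ⟨φ, hφ⟩ := hP
  obtain ⟨ψ, hψ⟩ := hQ
  exact ⟨φ.iff ψ, fun v => by simp [hφ, hψ]⟩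

theorem all {n : ℕ} {P : (Fin (n + 1) → M) → Prop} (hP : Df P) :
    Df fun v : Fin n → M => ∀ x, P (Fin.snoc v x) := by
  obtain ⟨φ, hφ⟩ := hP
  exact ⟨φ.all, fun v => by simp [hφ]⟩

theorem ex {n : ℕ} {P : (Fin (n + 1) → M) → Prop} (hP : Df P) :
    Df fun v : Fin n → M => ∃ x, P (Fin.snoc v x) := by
  obtain ⟨φ, hφ⟩ := hP
  exact ⟨φ.ex, fun v => by simp [hφ]⟩

theorem mem {n : ℕ} (i j : Fin n) : Df fun v : Fin n → M => v i ∈ₘ v j :=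
  ⟨memSym.boundedFormula₂ (Term.var (Sum.inr i)) (Term.var (Sum.inr j)), fun v => by
    simp [BoundedFormula.realize_rel₂, Mem]⟩

theorem eq {n : ℕ} (i j : Fin n) : Df fun v : Fin n → M => v i = v j :=
  ⟨Term.bdEqual (Term.var (Sum.inr i)) (Term.var (Sum.inr j)), fun v => by simp⟩

theorem eqConst {n : ℕ} (i : Fin n) (c : M) : Df fun v : Fin n → M => v i = c :=
  ⟨Term.bdEqual (Term.var (Sum.inr i)) (Term.var (Sum.inl c)), fun v => by simp⟩

/-- Passing to `φ.toFormula` makes all variables free, so that one relabelling substitutes the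
variables, repetitions allowed, and leaves the parameters in place. -/
theorem reindex {k n : ℕ} {P : (Fin k → M) → Prop} (hP : Df P) (σ : Fin k → Fin n) :
    Df fun v : Fin n → M => P (v ∘ σ) := by
  obtain ⟨φ, hφ⟩ := hP
  refine ⟨BoundedFormula.relabel (k := 0) (Sum.map id σ) φ.toFormula, fun v => ?_⟩
  refine Iff.trans ?_ (hφ _)
  rw [BoundedFormula.realize_relabel]
  have := BoundedFormula.realize_toFormula φ (Sum.elim id v ∘ Sum.map id σ)
  rw [Formula.Realize] at this
  refine Iff.trans ?_ (this.trans ?_)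
  · rw [Subsingleton.elim (v ∘ Fin.natAdd n : Fin 0 → M) default]
    rfl
  · rfl

end Df

end Definability

/-! ## Models of Zermelo set theory -/

/-- `M` is a model of Zermelo set theory, in terms of the membership of `M`. -/
class ZModel (M : Type w) [setLang.Structure M] : Prop where
  ext : ∀ a b : M, (∀ z, z ∈ₘ a ↔ z ∈ₘ b) → a = b
  pairing : ∀ a b : M, ∃ p, ∀ z, z ∈ₘ p ↔ z = a ∨ z = b
  union : ∀ a : M, ∃ u, ∀ z, z ∈ₘ u ↔ ∃ y, z ∈ₘ y ∧ y ∈ₘ a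
  powerset : ∀ a : M, ∃ p, ∀ z, z ∈ₘ p ↔ ∀ y, y ∈ₘ z → y ∈ₘ a
  infinity : ∃ I : M, (∃ e, e ∈ₘ I ∧ ∀ z, ¬ z ∈ₘ e) ∧
    ∀ x, x ∈ₘ I → ∃ y, y ∈ₘ I ∧ ∀ z, z ∈ₘ y ↔ z ∈ₘ x ∨ z = x
  -- `Df` admits parameters from `M`, so a single variable is enough.
  separation : ∀ P : M → Prop, Df (fun v : Fin 1 → M => P (v 0)) →
    ∀ a, ∃ b, ∀ x, x ∈ₘ b ↔ x ∈ₘ a ∧ P x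

section

variable {M : Type w} [setLang.Structure M] [Nonempty M]

theorem realize_memF {n : ℕ} (i j : Fin n) (v : Empty → M) (xs : Fin n → M) :
    (memF i j).Realize v xs ↔ xs i ∈ₘ xs j := by
  simp [memF, BoundedFormula.realize_rel₂, Mem]

theorem realize_eqF {n : ℕ} (i j : Fin n) (v : Empty → M) (xs : Fin n → M) :
    (eqF i j).Realize v xs ↔ xs i = xs j := by
  simp [eqF]

/-- A formula with parameters from `M` mentions only finitely many of them. They are turned into the
leading variables, which the universal closure of the schema instantiates; the element variable
comes last. -/
theorem separation_of_realize (h : ∀ n φ, M ⊨ separation n φ) (P : M → Prop)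
    (hP : Df (fun v : Fin 1 → M => P (v 0))) (a : M) : ∃ b, ∀ x, x ∈ₘ b ↔ x ∈ₘ a ∧ P x := by
  classical
  obtain ⟨φ, hφ⟩ := hP
  let e := φ.freeVarFinset.equivFin
  let ψ : setLang.BoundedFormula (Fin φ.freeVarFinset.card) 1 := φ.restrictFreeVar e
  let χ : setLang.BoundedFormula Empty (φ.freeVarFinset.card + 1) := ψ.relabel Sum.inr
  let par : Fin φ.freeVarFinset.card → M := fun i => (e.symm i : M)
  have key : ∀ xs : Fin (φ.freeVarFinset.card + 1) → M, (∀ i, xs (Fin.castSucc i) = par i) →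
      (χ.Realize default xs ↔ P (xs (Fin.last _))) := by
    intro xs hxs
    rw [BoundedFormula.realize_relabel]
    rw [BoundedFormula.realize_restrictFreeVar id, hφ]
    · rfl
    · intro c
      have := hxs (e c)
      simp only [par, e, Equiv.symm_apply_apply] at this
      exact this
  have := h _ χ
  rw [separation, Sentence.Realize, BoundedFormula.realize_alls] at this
  have := this par
  simp only [BoundedFormula.realize_all, BoundedFormula.realize_ex, BoundedFormula.realize_iff,
    BoundedFormula.realize_inf, realize_memF] at this
  obtain ⟨b, hb⟩ := this a
  refine ⟨b, fun x => ?_⟩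
  have := hb x
  -- The lift by two skips the variables of the given set and of its subset, which stand between the
  -- parameters and the element variable.
  rw [BoundedFormula.realize_liftAt (by omega), Subsingleton.elim (default : Empty → M) default,
    key] at this
  · simpa [Fin.snoc] using this
  · intro i
    simp only [Function.comp_apply, Fin.snoc, Fin.val_castSucc, i.isLt, if_true]
    simp only [Fin.val_castAdd, Fin.val_castSucc]
    rw [dif_pos (by omega), dif_pos (by simp), dif_pos (by simp)]
    rfl

theorem zModel_of_realize (h : ∀ σ ∈ zermelo, M ⊨ σ) : ZModel M where
  ext := by
    have := h extensionality (by simp [zermelo])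
    simp only [extensionality, Sentence.Realize, Formula.Realize, BoundedFormula.realize_all,
      BoundedFormula.realize_iff, BoundedFormula.realize_imp, realize_memF, realize_eqF] at this
    simpa [Fin.snoc] using this
  pairing := by
    have := h pairing (by simp [zermelo])
    simp only [pairing, Sentence.Realize, Formula.Realize, BoundedFormula.realize_all,
      BoundedFormula.realize_ex, BoundedFormula.realize_sup,
      BoundedFormula.realize_iff, realize_memF, realize_eqF] at this
    simpa [Fin.snoc] using this
  union := by
    have := h union (by simp [zermelo])
    simp only [union, Sentence.Realize, Formula.Realize, BoundedFormula.realize_all,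
      BoundedFormula.realize_ex, BoundedFormula.realize_inf,
      BoundedFormula.realize_iff, realize_memF] at this
    simpa [Fin.snoc] using this
  powerset := by
    have := h powerset (by simp [zermelo])
    simp only [powerset, Sentence.Realize, Formula.Realize, BoundedFormula.realize_all,
      BoundedFormula.realize_ex,
      BoundedFormula.realize_iff, BoundedFormula.realize_imp, realize_memF] at this
    simpa [Fin.snoc] using this
  infinity := by
    have := h infinity (by simp [zermelo])
    simp only [infinity, Sentence.Realize, Formula.Realize, BoundedFormula.realize_all,
      BoundedFormula.realize_ex, BoundedFormula.realize_sup, BoundedFormula.realize_not,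
      BoundedFormula.realize_inf,
      BoundedFormula.realize_iff, BoundedFormula.realize_imp, realize_memF, realize_eqF] at this
    simpa [Fin.snoc] using this
  separation := separation_of_realize fun n φ => h _ (Or.inr ⟨n, φ, rfl⟩)

end


/-! ## Elementary sets -/

section

variable {M : Type w} [setLang.Structure M] [Nonempty M] [ZModel M]

theorem the_spec {P : M → Prop} (h : ∃ x, P x) : P (the P) := Classical.epsilon_spec h

theorem not_mem_empty (z : M) : ¬ z ∈ₘ empty := by
  obtain ⟨I, ⟨e, -, he⟩, -⟩ := ZModel.infinity (M := M)
  exact the_spec (P := fun e : M => ∀ z, ¬ z ∈ₘ e) ⟨e, he⟩ z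

theorem mem_upair {x y z : M} : z ∈ₘ upair x y ↔ z = x ∨ z = y :=
  the_spec (P := fun p => ∀ z, z ∈ₘ p ↔ z = x ∨ z = y) (ZModel.pairing x y) z

theorem exists_binary_union (a b : M) : ∃ u, ∀ z, z ∈ₘ u ↔ z ∈ₘ a ∨ z ∈ₘ b := by
  obtain ⟨u, hu⟩ := ZModel.union (upair a b)
  refine ⟨u, fun z => ?_⟩
  simp only [hu, mem_upair]
  constructor
  · rintro ⟨y, hz, rfl | rfl⟩ <;> simp [hz]
  · rintro (h | h)
    exacts [⟨a, h, Or.inl rfl⟩, ⟨b, h, Or.inr rfl⟩]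

theorem mem_suc {n z : M} : z ∈ₘ suc n ↔ z ∈ₘ n ∨ z = n := by
  obtain ⟨u, hu⟩ := exists_binary_union n (upair n n)
  exact the_spec (P := fun m => ∀ z, z ∈ₘ m ↔ z ∈ₘ n ∨ z = n)
    ⟨u, fun z => by simp [hu, mem_upair]⟩ z

theorem eq_suc_iff {m n : M} : m = suc n ↔ ∀ z, z ∈ₘ m ↔ z ∈ₘ n ∨ z = n :=
  ⟨fun h z => h ▸ mem_suc, fun h => ZModel.ext _ _ fun z => (h z).trans mem_suc.symm⟩

theorem suc_ne_empty (n : M) : suc n ≠ empty := fun h =>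
  not_mem_empty n (h ▸ mem_suc.2 (Or.inr rfl))

theorem eq_empty_iff {e : M} : e = empty ↔ ∀ z, ¬ z ∈ₘ e :=
  ⟨fun h z => h ▸ not_mem_empty z,
    fun h => ZModel.ext _ _ fun z => iff_of_false (h z) (not_mem_empty z)⟩

theorem eq_upair_iff {p x y : M} : p = upair x y ↔ ∀ z, z ∈ₘ p ↔ z = x ∨ z = y :=
  ⟨fun h z => h ▸ mem_upair, fun h => ZModel.ext _ _ fun z => (h z).trans mem_upair.symm⟩

theorem upair_inj_right {x y z : M} (h : upair x y = upair x z) : y = z := by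
  have h1 : y ∈ₘ upair x z := h ▸ mem_upair.2 (Or.inr rfl)
  have h2 : z ∈ₘ upair x y := h ▸ mem_upair.2 (Or.inr rfl)
  rcases mem_upair.1 h1 with h1 | h1
  · rcases mem_upair.1 h2 with h2 | h2
    exacts [h1.trans h2.symm, h2.symm]
  · exact h1

theorem kpair_inj {x y x' y' : M} : kpair x y = kpair x' y' ↔ x = x' ∧ y = y' := by
  refine ⟨fun h => ?_, fun ⟨h1, h2⟩ => h1 ▸ h2 ▸ rfl⟩
  have hx : x = x' := by
    have h1 : upair x' x' ∈ₘ kpair x y := by rw [h]; exact mem_upair.2 (Or.inl rfl)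
    have key : ∀ a, upair x' x' = upair x a → x = x' := fun a ha =>
      (by simpa using mem_upair.1 (ha ▸ mem_upair.2 (Or.inl rfl) : x ∈ₘ upair x' x'))
    rcases mem_upair.1 h1 with h1 | h1 <;> exact key _ h1
  subst hx
  exact ⟨rfl, upair_inj_right (upair_inj_right h)⟩

theorem Df.upair : Df fun v : Fin 3 → M => v 0 = FramedPR.upair (v 1) (v 2) :=
  (Df.all ((Df.mem 3 0).iff ((Df.eq 3 1).or (Df.eq 3 2)))).congr fun v => by
    rw [eq_upair_iff]; rfl

/-- The language has no terms besides variables, so the parts of a compound value are quantified: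
the variables 3 and 4 are the two inner unordered pairs. -/
theorem Df.kpair : Df fun v : Fin 3 → M => v 0 = FramedPR.kpair (v 1) (v 2) :=
  (Df.ex (Df.ex ((Df.upair.reindex ![3, 1, 1]).and
    ((Df.upair.reindex ![4, 1, 2]).and (Df.upair.reindex ![0, 3, 4]))))).congr fun v =>
      ⟨fun h => ⟨_, _, rfl, rfl, h⟩, fun ⟨_, _, h1, h2, h3⟩ =>
        h3.trans (congrArg₂ FramedPR.upair h1 h2)⟩

/-- A Kuratowski pair of elements of `a ∪ b` lies in the double power set of `a ∪ b`, so separation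
suffices and no replacement is involved. -/
theorem exists_product (a b : M) :
    ∃ c, ∀ z, z ∈ₘ c ↔ ∃ x y, x ∈ₘ a ∧ y ∈ₘ b ∧ kpair x y = z := by
  obtain ⟨u, hu⟩ := exists_binary_union a b
  obtain ⟨p, hp⟩ := ZModel.powerset u
  obtain ⟨q, hq⟩ := ZModel.powerset p
  have hD : Df fun v : Fin 1 → M => ∃ x y, x ∈ₘ a ∧ y ∈ₘ b ∧ v 0 = kpair x y :=
    (Df.ex (Df.ex (Df.ex (Df.ex ((Df.eqConst 3 a).and ((Df.eqConst 4 b).and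
      ((Df.mem 1 3).and ((Df.mem 2 4).and (Df.kpair.reindex ![0, 1, 2]))))))))).congr fun v =>
        ⟨fun ⟨x, y, h⟩ => ⟨x, y, a, b, rfl, rfl, h⟩, by
          rintro ⟨x, y, a', b', h1, h2, h⟩
          obtain rfl : a' = a := h1
          obtain rfl : b' = b := h2
          exact ⟨x, y, h⟩⟩
  obtain ⟨c, hc⟩ :=
    ZModel.separation (fun z => ∃ x y, x ∈ₘ a ∧ y ∈ₘ b ∧ z = kpair x y) hD q
  refine ⟨c, fun z => ⟨fun hz => ?_, ?_⟩⟩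
  · obtain ⟨-, x, y, hx, hy, h⟩ := (hc z).1 hz
    exact ⟨x, y, hx, hy, h.symm⟩
  · rintro ⟨x, y, hx, hy, rfl⟩
    refine (hc _).2 ⟨(hq _).2 fun s hs => (hp _).2 fun t ht => (hu _).2 ?_, x, y, hx, hy, rfl⟩
    rcases mem_upair.1 hs with rfl | rfl <;> rcases mem_upair.1 ht with rfl | rfl <;> simp [hx, hy]

end

/-! ## Definable predicates and functions on types coded in `M` -/

/-- A type whose elements are coded by elements of `M`. -/
class Enc (M : Type w) [setLang.Structure M] (X : Type*) where
  enc : X → M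
  inj : Function.Injective enc
  range : Df fun v : Fin 1 → M => ∃ x, enc x = v 0

section

variable (M : Type w) [setLang.Structure M] [Nonempty M] [ZModel M]
variable {X Y Z : Type*} [Enc M X] [Enc M Y] [Enc M Z]

instance : Enc M M := ⟨id, Function.injective_id, (Df.eq 0 0).congr fun v => by simp⟩

noncomputable instance : Enc M (X × Y) where
  enc p := kpair (Enc.enc p.1) (Enc.enc p.2)
  inj p q h := Prod.ext (Enc.inj (kpair_inj.1 h).1) (Enc.inj (kpair_inj.1 h).2)
  range := (Df.ex (Df.ex ((Df.kpair.reindex ![0, 1, 2]).and (((Enc.range (X := X)).reindex ![1]).and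
    ((Enc.range (X := Y)).reindex ![2]))))).congr fun v => by
      constructor
      · rintro ⟨⟨x, y⟩, h⟩
        exact ⟨Enc.enc x, Enc.enc y, h.symm, ⟨x, rfl⟩, ⟨y, rfl⟩⟩
      · rintro ⟨a, b, h, ⟨x, hx⟩, ⟨y, hy⟩⟩
        exact ⟨(x, y), (congrArg₂ kpair hx hy).trans h.symm⟩

/-- Definability, with parameters from `M`, of a predicate. -/
def Dfn (P : X → Prop) : Prop := Df fun v : Fin 1 → M => ∃ x, Enc.enc x = v 0 ∧ P x

/-- Definability, with parameters from `M`, of a function. -/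
def DfnF (f : X → Y) : Prop := Dfn M fun p : X × Y => f p.1 = p.2

variable {M}

namespace Dfn

theorem congr {P Q : X → Prop} (hP : Dfn M P) (h : ∀ x, Q x ↔ P x) : Dfn M Q := by
  rwa [show Q = P from funext fun x => propext (h x)]

/-- The range of the coding has to be added, since elements that are not codes satisfy the negated
formula too. -/
theorem not {P : X → Prop} (hP : Dfn M P) : Dfn M fun x => ¬ P x :=
  (Df.and Enc.range (Df.not hP)).congr fun v => by
    constructor
    · rintro ⟨x, hx, h⟩
      exact ⟨⟨x, hx⟩, fun ⟨y, hy, h'⟩ => h (Enc.inj (hy.trans hx.symm) ▸ h')⟩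
    · rintro ⟨⟨x, hx⟩, h⟩
      exact ⟨x, hx, fun h' => h ⟨x, hx, h'⟩⟩

theorem and {P Q : X → Prop} (hP : Dfn M P) (hQ : Dfn M Q) : Dfn M fun x => P x ∧ Q x :=
  (Df.and hP hQ).congr fun v => by
    constructor
    · rintro ⟨x, hx, h, h'⟩
      exact ⟨⟨x, hx, h⟩, x, hx, h'⟩
    · rintro ⟨⟨x, hx, h⟩, y, hy, h'⟩
      exact ⟨x, hx, h, Enc.inj (hy.trans hx.symm) ▸ h'⟩

theorem or {P Q : X → Prop} (hP : Dfn M P) (hQ : Dfn M Q) : Dfn M fun x => P x ∨ Q x :=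
  (hP.not.and hQ.not).not.congr fun x => by tauto

theorem imp {P Q : X → Prop} (hP : Dfn M P) (hQ : Dfn M Q) : Dfn M fun x => P x → Q x :=
  (hP.not.or hQ).congr fun x => by tauto

theorem iff {P Q : X → Prop} (hP : Dfn M P) (hQ : Dfn M Q) : Dfn M fun x => (P x ↔ Q x) :=
  ((hP.imp hQ).and (hQ.imp hP)).congr fun x => by tauto

theorem ex {P : X → Y → Prop} (hP : Dfn M fun p : X × Y => P p.1 p.2) :
    Dfn M fun x => ∃ y, P x y :=
  (Df.ex (Df.ex ((Df.kpair.reindex ![2, 0, 1]).and (hP.reindex ![2])))).congr fun v => by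
    constructor
    · rintro ⟨x, hx, y, h⟩
      exact ⟨Enc.enc y, kpair (Enc.enc x) (Enc.enc y), congrArg₂ kpair hx rfl, (x, y), rfl, h⟩
    · rintro ⟨l, p, hp, ⟨x, y⟩, hq, h⟩
      exact ⟨x, (kpair_inj.1 (hq.trans hp)).1, y, h⟩

theorem all {P : X → Y → Prop} (hP : Dfn M fun p : X × Y => P p.1 p.2) :
    Dfn M fun x => ∀ y, P x y :=
  (ex (P := fun x y => ¬ P x y) hP.not).not.congr fun x => by simp

/-- The value of `f` is quantified existentially and tied to the argument by the graph of `f`. -/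
theorem comp {P : Y → Prop} (hP : Dfn M P) {f : X → Y} (hf : DfnF M f) : Dfn M fun x => P (f x) :=
  (Df.ex (Df.ex ((Df.kpair.reindex ![2, 0, 1]).and
    ((Df.reindex hP ![1]).and (Df.reindex hf ![2]))))).congr fun v => by
      constructor
      · rintro ⟨x, hx, h⟩
        exact ⟨Enc.enc (f x), kpair (Enc.enc x) (Enc.enc (f x)), congrArg₂ kpair hx rfl,
          ⟨f x, rfl, h⟩, (x, f x), rfl, rfl⟩
      · rintro ⟨l, p, hp, ⟨y, hy, h⟩, ⟨x, y'⟩, hq, h'⟩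
        obtain ⟨h1, h2⟩ := kpair_inj.1 (hq.trans hp)
        obtain rfl : y = y' := Enc.inj (hy.trans h2.symm)
        obtain rfl : f x = y := h'
        exact ⟨x, h1, h⟩

theorem eqPair : Dfn M fun p : X × X => p.1 = p.2 :=
  (Df.ex ((Df.kpair.reindex ![0, 1, 1]).and ((Enc.range (X := X)).reindex ![1]))).congr fun v => by
    constructor
    · rintro ⟨⟨x, y⟩, hx, rfl : x = y⟩
      exact ⟨Enc.enc x, hx.symm, x, rfl⟩
    · rintro ⟨l, hl, x, hx⟩
      exact ⟨(x, x), (congrArg₂ kpair hx hx).trans hl.symm, rfl⟩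

theorem memPair : Dfn M fun p : M × M => p.1 ∈ₘ p.2 :=
  (Df.ex (Df.ex ((Df.kpair.reindex ![0, 1, 2]).and (Df.mem 1 2)))).congr fun v => by
    constructor
    · rintro ⟨⟨x, y⟩, hx, h⟩
      exact ⟨x, y, hx.symm, h⟩
    · rintro ⟨x, y, hx, h⟩
      exact ⟨(x, y), hx.symm, h⟩

end Dfn

namespace DfnF

theorem of_df {f : X → Y}
    (h : Df fun v : Fin 1 → M => ∃ x, kpair (Enc.enc x) (Enc.enc (f x)) = v 0) : DfnF M f :=
  Df.congr h fun _ => ⟨fun ⟨⟨x, _⟩, hx, h⟩ => ⟨x, (congrArg _ (congrArg _ h)).trans hx⟩,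
    fun ⟨x, h⟩ => ⟨(x, f x), h, rfl⟩⟩

theorem const (c : Y) : DfnF M fun _ : X => c :=
  of_df <| (Df.ex (Df.ex ((Df.kpair.reindex ![0, 1, 2]).and (((Enc.range (X := X)).reindex ![1]).and
    (Df.eqConst 2 (Enc.enc c)))))).congr fun v => by
      constructor
      · rintro ⟨x, hx⟩
        exact ⟨Enc.enc x, _, hx.symm, ⟨x, rfl⟩, rfl⟩
      · rintro ⟨a, b, h, ⟨x, hx⟩, hb⟩
        exact ⟨x, (congrArg₂ kpair hx hb.symm).trans h.symm⟩

theorem id : DfnF M fun x : X => x := Dfn.eqPair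

theorem fstProj : DfnF M fun p : X × Y => p.1 :=
  of_df <| (Df.ex (Df.ex (Df.ex ((Df.kpair.reindex ![1, 2, 3]).and ((Df.kpair.reindex ![0, 1, 2]).and
    (((Enc.range (X := X)).reindex ![2]).and ((Enc.range (X := Y)).reindex ![3]))))))).congr
      fun v => by
        constructor
        · rintro ⟨⟨x, y⟩, hx⟩
          exact ⟨kpair (Enc.enc x) (Enc.enc y), Enc.enc x, Enc.enc y, rfl, hx.symm, ⟨x, rfl⟩, y, rfl⟩
        · rintro ⟨p, a, b, hp, h, ⟨x, hx⟩, y, hy⟩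
          exact ⟨(x, y), (congrArg₂ kpair ((congrArg₂ kpair hx hy).trans hp.symm) hx).trans
            h.symm⟩

theorem sndProj : DfnF M fun p : X × Y => p.2 :=
  of_df <| (Df.ex (Df.ex (Df.ex ((Df.kpair.reindex ![1, 2, 3]).and ((Df.kpair.reindex ![0, 1, 3]).and
    (((Enc.range (X := X)).reindex ![2]).and ((Enc.range (X := Y)).reindex ![3]))))))).congr
      fun v => by
        constructor
        · rintro ⟨⟨x, y⟩, hx⟩
          exact ⟨kpair (Enc.enc x) (Enc.enc y), Enc.enc x, Enc.enc y, rfl, hx.symm, ⟨x, rfl⟩, y, rfl⟩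
        · rintro ⟨p, a, b, hp, h, ⟨x, hx⟩, y, hy⟩
          exact ⟨(x, y), (congrArg₂ kpair ((congrArg₂ kpair hx hy).trans hp.symm) hy).trans
            h.symm⟩

theorem encProj : DfnF M fun x : X => (Enc.enc x : M) :=
  of_df <| (Df.ex ((Df.kpair.reindex ![0, 1, 1]).and ((Enc.range (X := X)).reindex ![1]))).congr fun v => by
    constructor
    · rintro ⟨x, hx⟩
      exact ⟨Enc.enc x, hx.symm, x, rfl⟩
    · rintro ⟨l, hl, x, hx⟩
      exact ⟨x, (congrArg₂ kpair hx hx).trans hl.symm⟩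

theorem pair {f : X → Y} {g : X → Z} (hf : DfnF M f) (hg : DfnF M g) :
    DfnF M fun x => (f x, g x) :=
  of_df <| (Df.ex (Df.ex (Df.ex (Df.ex (Df.ex (Df.ex ((Df.kpair.reindex ![0, 1, 4]).and
    ((Df.kpair.reindex ![4, 2, 3]).and ((Df.kpair.reindex ![5, 1, 2]).and
      ((Df.kpair.reindex ![6, 1, 3]).and ((Df.reindex hf ![5]).and
        (Df.reindex hg ![6])))))))))))).congr fun v => by
          constructor
          · rintro ⟨x, hx⟩
            exact ⟨Enc.enc x, Enc.enc (f x), Enc.enc (g x), _, _, _, hx.symm, rfl, rfl, rfl,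
              ⟨(x, f x), rfl, rfl⟩, (x, g x), rfl, rfl⟩
          · rintro ⟨a, b, c, p, q, r, h1, h2, h3, h4, ⟨⟨x, y⟩, h5, h⟩, ⟨x', z⟩, h6, h'⟩
            obtain ⟨h7, h8⟩ := kpair_inj.1 (h5.trans h3)
            obtain ⟨h9, h10⟩ := kpair_inj.1 (h6.trans h4)
            obtain rfl : x = x' := Enc.inj (h7.trans h9.symm)
            obtain rfl : f x = y := h
            obtain rfl : g x = z := h'
            exact ⟨x, (congrArg₂ kpair h7 ((congrArg₂ kpair h8 h10).trans h2.symm)).trans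
              h1.symm⟩

theorem comp {g : Y → Z} (hg : DfnF M g) {f : X → Y} (hf : DfnF M f) :
    DfnF M fun x => g (f x) :=
  of_df <| (Df.ex (Df.ex (Df.ex (Df.ex (Df.ex ((Df.kpair.reindex ![0, 1, 3]).and
    ((Df.kpair.reindex ![4, 1, 2]).and ((Df.kpair.reindex ![5, 2, 3]).and
      ((Df.reindex hf ![4]).and (Df.reindex hg ![5])))))))))).congr fun v => by
        constructor
        · rintro ⟨x, hx⟩
          exact ⟨Enc.enc x, Enc.enc (f x), Enc.enc (g (f x)), _, _, hx.symm, rfl, rfl,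
            ⟨(x, f x), rfl, rfl⟩, (f x, g (f x)), rfl, rfl⟩
        · rintro ⟨a, b, c, p, q, h1, h2, h3, ⟨⟨x, y⟩, h5, h⟩, ⟨y', z⟩, h6, h'⟩
          obtain ⟨h7, h8⟩ := kpair_inj.1 (h5.trans h2)
          obtain ⟨h9, h10⟩ := kpair_inj.1 (h6.trans h3)
          obtain rfl : y = y' := Enc.inj (h8.trans h9.symm)
          obtain rfl : f x = y := h
          obtain rfl : g (f x) = z := h'
          exact ⟨x, (congrArg₂ kpair h7 h10).trans h1.symm⟩

theorem fst {f : X → Y × Z} (hf : DfnF M f) : DfnF M fun x => (f x).1 := fstProj.comp hf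

theorem snd {f : X → Y × Z} (hf : DfnF M f) : DfnF M fun x => (f x).2 := sndProj.comp hf

theorem encode {f : X → Y} (hf : DfnF M f) : DfnF M fun x => (Enc.enc (f x) : M) :=
  encProj.comp hf

end DfnF

namespace Dfn

theorem eq {f g : X → Y} (hf : DfnF M f) (hg : DfnF M g) : Dfn M fun x => f x = g x :=
  eqPair.comp (hf.pair hg)

theorem mem {f g : X → M} (hf : DfnF M f) (hg : DfnF M g) : Dfn M fun x => f x ∈ₘ g x :=
  memPair.comp (hf.pair hg)

theorem comp₂ {Y₁ Y₂ : Type*} [Enc M Y₁] [Enc M Y₂] {R : Y₁ → Y₂ → Prop}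
    (hR : Dfn M fun p : Y₁ × Y₂ => R p.1 p.2) {f : X → Y₁} {g : X → Y₂} (hf : DfnF M f)
    (hg : DfnF M g) : Dfn M fun x => R (f x) (g x) :=
  hR.comp (hf.pair hg)

theorem comp₃ {Y₁ Y₂ Y₃ : Type*} [Enc M Y₁] [Enc M Y₂] [Enc M Y₃] {R : Y₁ → Y₂ → Y₃ → Prop}
    (hR : Dfn M fun p : Y₁ × Y₂ × Y₃ => R p.1 p.2.1 p.2.2) {f : X → Y₁} {g : X → Y₂} {h : X → Y₃}
    (hf : DfnF M f) (hg : DfnF M g) (hh : DfnF M h) : Dfn M fun x => R (f x) (g x) (h x) :=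
  hR.comp (hf.pair (hg.pair hh))

end Dfn

theorem DfnF.of_graph {f : X → Y} (h : Dfn M fun p : X × Y => p.2 = f p.1) : DfnF M f :=
  h.congr fun _ => eq_comm

end

/-- Structural proof of definability; composition with the definable functions `hg₁`, `hg₂` and
predicates `hR₁`, `hR₂`, `hR₃` of the local context is included. -/
theorem Dfn.auto {M : Type w} [setLang.Structure M] [Nonempty M] [ZModel M] {X : Type*} [Enc M X]
    {P : X → Prop} (h : Dfn M P := by
      repeat first
        | assumption
        | with_reducible refine DfnF.to_sem ?_
        | with_reducible refine Dfn.comp₃ hR₃ ?_ ?_ ?_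
        | with_reducible refine Dfn.comp₂ hR₂ ?_ ?_
        | with_reducible refine Dfn.comp hR₁ ?_
        | with_reducible apply Dfn.and
        | with_reducible apply Dfn.or
        | with_reducible apply Dfn.not
        | with_reducible apply Dfn.imp
        | with_reducible apply Dfn.iff
        | with_reducible apply Dfn.ex
        | with_reducible apply Dfn.all
        | with_reducible apply Dfn.eq_sem
        | with_reducible apply Dfn.eq
        | with_reducible apply Dfn.mem
        | with_reducible exact DfnF.id
        | with_reducible exact DfnF.fstProj
        | with_reducible exact DfnF.sndProj
        | with_reducible exact DfnF.const _
        | with_reducible apply DfnF.fst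
        | with_reducible apply DfnF.snd
        | with_reducible apply DfnF.pair
        | with_reducible apply DfnF.encode
        | with_reducible apply DfnF.succ
        | with_reducible apply DfnF.pairing
        | with_reducible apply DfnF.code
        | with_reducible apply Ob.mk_dfn
        | with_reducible apply Ob.left_nat_dfn
        | with_reducible apply Ob.right_nat_dfn
        | with_reducible apply Ob.left_dfn
        | with_reducible apply Ob.right_dfn
        | with_reducible apply PR.den_nat_dfn
        | with_reducible apply PR.den_comp_dfn
        | with_reducible refine DfnF.comp hg₁ ?_
        | with_reducible refine DfnF.comp hg₂ ?_
        | exact DfnF.succ DfnF.id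
        | exact PR.den_dfn (A := Ob.nat) _) : Dfn M P := h

/-! ### Comprehension for types whose codes form a set, and the set ω. -/

section

variable (M : Type w) [setLang.Structure M] [Nonempty M] [ZModel M]
variable {X Y Z : Type*} [Enc M X] [Enc M Y] [Enc M Z]

/-- The codes of elements of `X` form a set of `M`. -/
class SetEnc (X : Type*) [Enc M X] : Prop where
  exists_set : ∃ s : M, ∀ z, z ∈ₘ s ↔ ∃ x : X, Enc.enc x = z

instance [SetEnc M X] [SetEnc M Y] : SetEnc M (X × Y) where
  exists_set := by
    obtain ⟨s, hs⟩ := SetEnc.exists_set (M := M) (X := X)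
    obtain ⟨t, ht⟩ := SetEnc.exists_set (M := M) (X := Y)
    obtain ⟨c, hc⟩ := exists_product s t
    refine ⟨c, fun z => (hc z).trans ⟨?_, ?_⟩⟩
    · rintro ⟨x, y, hx, hy, rfl⟩
      obtain ⟨x, rfl⟩ := (hs _).1 hx
      obtain ⟨y, rfl⟩ := (ht _).1 hy
      exact ⟨(x, y), rfl⟩
    · rintro ⟨⟨x, y⟩, rfl⟩
      exact ⟨_, _, (hs _).2 ⟨x, rfl⟩, (ht _).2 ⟨y, rfl⟩, rfl⟩

noncomputable instance : Enc M PUnit where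
  enc _ := empty
  inj _ _ _ := rfl
  range := (Df.eqConst 0 empty).congr fun v => by simp [eq_comm]

instance : SetEnc M PUnit where
  exists_set := ⟨upair empty empty, fun z => by
    rw [mem_upair]
    exact ⟨fun h => ⟨⟨⟩, by rcases h with rfl | rfl <;> rfl⟩, fun ⟨_, h⟩ => Or.inl h.symm⟩⟩

variable {M}

/-- The bounding set that separation requires is supplied by `SetEnc`. -/
theorem exists_set_of_dfn [SetEnc M X] {P : X → Prop} (hP : Dfn M P) :
    ∃ S : M, ∀ z, z ∈ₘ S ↔ ∃ x, Enc.enc x = z ∧ P x := by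
  obtain ⟨s, hs⟩ := SetEnc.exists_set (M := M) (X := X)
  obtain ⟨S, hS⟩ := ZModel.separation (fun z => ∃ x, Enc.enc x = z ∧ P x) hP s
  refine ⟨S, fun z => (hS z).trans ⟨fun h => h.2, fun h => ⟨(hs z).2 ?_, h⟩⟩⟩
  obtain ⟨x, hx, -⟩ := h
  exact ⟨x, hx⟩

theorem exists_set_enc_mem [SetEnc M X] {P : X → Prop} (hP : Dfn M P) :
    ∃ S : M, ∀ x, Enc.enc x ∈ₘ S ↔ P x := by
  obtain ⟨S, hS⟩ := exists_set_of_dfn hP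
  refine ⟨S, fun x => (hS _).trans ⟨?_, fun h => ⟨x, rfl, h⟩⟩⟩
  rintro ⟨y, hy, h⟩
  exact Enc.inj hy ▸ h

theorem suc_dfn : DfnF M (suc : M → M) :=
  DfnF.of_graph <| Dfn.congr (P := fun p : M × M => ∀ z, z ∈ₘ p.2 ↔ z ∈ₘ p.1 ∨ z = p.1)
    .auto fun _ => eq_suc_iff

theorem isNat_dfn : Dfn M (IsNat : M → Prop) := by
  have hg₁ := suc_dfn (M := M)
  unfold IsNat
  exact Dfn.auto

/-- Natural numbers belong to every inductive set, hence to the one given by infinity; this set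
bounds the separation. -/
theorem exists_omega : ∃ s : M, ∀ z, z ∈ₘ s ↔ IsNat z := by
  obtain ⟨I, ⟨e, he, he'⟩, hI⟩ := ZModel.infinity (M := M)
  obtain rfl := eq_empty_iff.2 he'
  obtain ⟨s, hs⟩ := ZModel.separation (IsNat : M → Prop)
    (Df.congr isNat_dfn fun v => ⟨fun h => ⟨v 0, rfl, h⟩, fun ⟨_, h, h'⟩ => by rw [← h]; exact h'⟩) I
  refine ⟨s, fun z => (hs z).trans ⟨fun h => h.2, fun h => ⟨h I he fun m hm => ?_, h⟩⟩⟩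
  obtain ⟨y, hy, hy'⟩ := hI m hm
  rwa [← eq_suc_iff.2 hy']

end

/-! ## The natural numbers of `M` -/

/-- The type of natural numbers of `M`. -/
def Omega (M : Type w) [setLang.Structure M] [Nonempty M] : Type w := {n : M // IsNat n}

section

variable {M : Type w} [setLang.Structure M] [Nonempty M]

instance : CoeOut (Omega M) M := ⟨Subtype.val⟩

theorem isNat_empty : IsNat (empty : M) := fun _ h _ => h

theorem IsNat.suc {n : M} (h : IsNat n) : IsNat (suc n) := fun I h0 hs => hs _ (h I h0 hs)

noncomputable instance : Zero (Omega M) := ⟨⟨empty, isNat_empty⟩⟩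

/-- The successor function of the natural numbers of `M`. -/
noncomputable def Omega.succ (n : Omega M) : Omega M := ⟨suc n.1, n.2.suc⟩

theorem Omega.coe_succ (n : Omega M) : (n.succ : M) = suc (n : M) := rfl

variable [ZModel M] {X Y Z : Type*} [Enc M X] [Enc M Y] [Enc M Z]

instance : Enc M (Omega M) where
  enc := Subtype.val
  inj := Subtype.val_injective
  range := Df.congr isNat_dfn fun v =>
    ⟨fun ⟨n, h⟩ => ⟨v 0, rfl, h ▸ n.2⟩, fun ⟨_, h, h'⟩ => ⟨⟨_, h'⟩, h⟩⟩

instance : SetEnc M (Omega M) where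
  exists_set := by
    obtain ⟨s, hs⟩ := exists_omega (M := M)
    exact ⟨s, fun z => (hs z).trans ⟨fun h => ⟨⟨z, h⟩, rfl⟩, fun ⟨n, h⟩ => h ▸ n.2⟩⟩

namespace DfnF

theorem coe {f : X → Omega M} (hf : DfnF M f) : DfnF M fun x => (f x : M) := hf.encode

theorem of_coe {f : X → Omega M} (hf : DfnF M fun x => (f x : M)) : DfnF M f :=
  .of_graph <| Dfn.congr (P := fun p : X × Omega M => (p.2 : M) = f p.1)
    (.eq (coe sndProj) (.comp hf fstProj)) fun _ => Subtype.ext_iff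

theorem succ {f : X → Omega M} (hf : DfnF M f) : DfnF M fun x => (f x).succ :=
  of_coe (suc_dfn.comp hf.coe)

end DfnF

namespace Omega

-- The extension of a definable `P` is an inductive set of `M`, and `IsNat` places every number in
-- all inductive sets, nonstandard numbers included.
@[elab_as_elim]
theorem induction {P : Omega M → Prop} (hP : Dfn M P) (zero : P 0) (succ : ∀ n, P n → P n.succ)
    (n : Omega M) : P n := by
  obtain ⟨S, hS⟩ := exists_set_of_dfn hP
  obtain ⟨m, hm, h⟩ := (hS n.1).1 (n.2 S ((hS _).2 ⟨0, rfl, zero⟩) fun m hm => by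
    obtain ⟨k, rfl, hk⟩ := (hS m).1 hm
    exact (hS _).2 ⟨k.succ, rfl, succ k hk⟩)
  exact Enc.inj hm ▸ h

@[simp]
theorem succ_ne_zero (n : Omega M) : n.succ ≠ 0 := fun h => suc_ne_empty _ (congrArg Subtype.val h)

@[simp]
theorem zero_ne_succ (n : Omega M) : 0 ≠ n.succ := (succ_ne_zero n).symm

theorem transitive (n : Omega M) : ∀ x y : M, x ∈ₘ y → y ∈ₘ (n : M) → x ∈ₘ (n : M) := by
  induction n using Omega.induction with
  | hP =>
    have hg₁ : DfnF M (fun n : Omega M => (n : M)) := DfnF.encProj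
    exact Dfn.auto
  | zero => exact fun x y _ h => absurd h (not_mem_empty _)
  | succ n ih =>
    intro x y hx hy
    rw [coe_succ, mem_suc] at hy ⊢
    rcases hy with hy | rfl
    exacts [Or.inl (ih x y hx hy), Or.inl hx]

-- Two different numbers with the same successor would be elements of each other, and by
-- transitivity they would then have the same elements. Transitivity replaces foundation, which is
-- not among the axioms.
@[simp]
theorem succ_inj {m n : Omega M} : m.succ = n.succ ↔ m = n := by
  refine ⟨fun h => Subtype.ext ?_, fun h => h ▸ rfl⟩
  have h' : suc (m : M) = suc (n : M) := congrArg Subtype.val h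
  have h1 : (m : M) ∈ₘ suc (n : M) := h' ▸ mem_suc.2 (Or.inr rfl)
  have h2 : (n : M) ∈ₘ suc (m : M) := h' ▸ mem_suc.2 (Or.inr rfl)
  rcases mem_suc.1 h1 with h1 | h1
  · rcases mem_suc.1 h2 with h2 | h2
    · exact ZModel.ext _ _ fun z =>
        ⟨fun hz => transitive n _ _ hz h1, fun hz => transitive m _ _ hz h2⟩
    · exact h2.symm
  · exact h1

theorem eq_zero_or_succ (n : Omega M) : n = 0 ∨ ∃ m : Omega M, n = m.succ := by
  induction n using Omega.induction with
  | hP =>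
    have hg₁ := DfnF.succ (M := M) (X := Omega M) DfnF.id
    exact Dfn.auto
  | zero => exact Or.inl rfl
  | succ n _ => exact Or.inr ⟨n, rfl⟩

end Omega

/-! ## Inductive definitions -/

/-- The least fixed point of `Φ` among the predicates that are sets of `M`. -/
def lfp (M : Type w) [setLang.Structure M] {X : Type*} [Enc M X]
    (Φ : (X → Prop) → X → Prop) (x : X) : Prop :=
  ∀ S : M, (∀ y, Φ (fun z => Enc.enc z ∈ₘ S) y → Enc.enc y ∈ₘ S) → Enc.enc x ∈ₘ S

/-- `Φ` is definable, uniformly in sets of `M`. -/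
def DfnOp (M : Type w) [setLang.Structure M] [Nonempty M] [ZModel M] {X : Type*} [Enc M X]
    (Φ : (X → Prop) → X → Prop) : Prop :=
  Dfn M fun p : M × X => Φ (fun z => Enc.enc z ∈ₘ p.1) p.2

theorem lfp_dfn {Φ : (X → Prop) → X → Prop} (hΦ : DfnOp M Φ) : Dfn M (lfp M Φ) := by
  have hR₁ : Dfn M fun p : (X × M) × X => Φ (fun z => Enc.enc z ∈ₘ p.1.2) p.2 :=
    Dfn.comp hΦ (DfnF.pair (.snd (.fst .id)) (.snd .id))
  unfold lfp
  exact Dfn.auto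

theorem lfp_induction [SetEnc M X] {Φ : (X → Prop) → X → Prop} {R : X → Prop} (hR : Dfn M R)
    (h : ∀ y, Φ R y → R y) {x : X} (hx : lfp M Φ x) : R x := by
  obtain ⟨S, hS⟩ := exists_set_enc_mem hR
  obtain rfl : (fun z => Enc.enc z ∈ₘ S) = R := funext fun z => propext (hS z)
  exact hx S h

/-- Knaster–Tarski inside `M`. The least fixed point is definable and therefore given by a set `S`;
taking `S` as a parameter makes `Φ (lfp M Φ)` definable as well, so that induction applies to it. -/
theorem lfp_iff [SetEnc M X] {Φ : (X → Prop) → X → Prop} (hΦ : DfnOp M Φ)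
    (mono : ∀ R R' : X → Prop, (∀ x, R x → R' x) → ∀ x, Φ R x → Φ R' x) (x : X) :
    lfp M Φ x ↔ Φ (lfp M Φ) x := by
  have intro : ∀ x, Φ (lfp M Φ) x → lfp M Φ x := fun x hx S hS =>
    hS _ (mono _ _ (fun z hz => hz S hS) _ hx)
  refine ⟨fun h => lfp_induction (R := Φ (lfp M Φ)) ?_ (mono _ _ intro) h, intro x⟩
  obtain ⟨S, hS⟩ := exists_set_enc_mem (lfp_dfn hΦ)
  obtain h : (fun z => Enc.enc z ∈ₘ S) = lfp M Φ := funext fun z => propext (hS z)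
  rw [← h]
  exact Dfn.comp hΦ (DfnF.pair (.const S) .id)

/-! ## Iteration of definable functions -/

/-- The clauses of the graph of `(x, n) ↦ g^n(x)`. -/
def IterOp (g : X → X) (R : (X × Omega M) × X → Prop) (q : (X × Omega M) × X) : Prop :=
  (q.1.2 = 0 ∧ q.2 = q.1.1) ∨ ∃ m b, q.1.2 = Omega.succ m ∧ R ((q.1.1, m), b) ∧ q.2 = g b

theorem iterOp_dfn {g : X → X} (hg₁ : DfnF M g) : DfnOp M (IterOp (M := M) g) := by
  have hg₂ := DfnF.succ (M := M) (X := Omega M) DfnF.id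
  unfold DfnOp IterOp
  exact Dfn.auto

open Classical in
/-- `(x, n) ↦ g^n(x)`, for natural numbers `n` of `M`. -/
noncomputable def iterate (g : X → X) (p : X × Omega M) : X :=
  -- For definable `g` on a type whose codes form a set, the graph is total by
  -- `lfp_iterOp_existsUnique`, and the default `p.1` plays no role.
  if h : ∃ b, lfp M (IterOp g) (p, b) then h.choose else p.1

theorem iterOp_mono (g : X → X) (R R' : (X × Omega M) × X → Prop) (h : ∀ q, R q → R' q) (q)
    (hq : IterOp g R q) : IterOp g R' q := by
  rcases hq with hq | ⟨m, b, h1, h2, h3⟩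
  exacts [Or.inl hq, Or.inr ⟨m, b, h1, h _ h2, h3⟩]

section

variable [SetEnc M X] {g : X → X}

theorem lfp_iterOp_zero (hg : DfnF M g) (x b : X) : lfp M (IterOp (M := M) g) ((x, 0), b) ↔ b = x := by
  rw [lfp_iff (iterOp_dfn hg) (iterOp_mono g)]
  simp [IterOp]

theorem lfp_iterOp_succ (hg : DfnF M g) (x b : X) (n : Omega M) :
    lfp M (IterOp g) ((x, n.succ), b) ↔ ∃ c, lfp M (IterOp g) ((x, n), c) ∧ b = g c := by
  rw [lfp_iff (iterOp_dfn hg) (iterOp_mono g)]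
  simp [IterOp]

theorem lfp_iterOp_existsUnique (hg : DfnF M g) (x : X) (n : Omega M) :
    ∃ b, ∀ c, lfp M (IterOp g) ((x, n), c) ↔ c = b := by
  induction n using Omega.induction with
  | hP =>
    have hR₁ := lfp_dfn (iterOp_dfn hg)
    exact Dfn.auto
  | zero => exact ⟨x, lfp_iterOp_zero hg x⟩
  | succ n ih =>
    obtain ⟨b, hb⟩ := ih
    exact ⟨g b, fun c => by simp [lfp_iterOp_succ hg, hb]⟩

theorem lfp_iterOp_iff (hg : DfnF M g) (p : X × Omega M) (b : X) :
    lfp M (IterOp g) (p, b) ↔ b = iterate g p := by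
  obtain ⟨c, hc⟩ := lfp_iterOp_existsUnique hg p.1 p.2
  have h : ∃ b, lfp M (IterOp g) (p, b) := ⟨c, (hc c).2 rfl⟩
  rw [iterate, dif_pos h, (hc _).1 h.choose_spec]
  exact hc b

theorem iterate_dfn (hg : DfnF M g) : DfnF M (iterate (M := M) g) :=
  .of_graph <| Dfn.congr (lfp_dfn (iterOp_dfn hg)) fun _ => (lfp_iterOp_iff hg _ _).symm

theorem iterate_zero (hg : DfnF M g) (x : X) : iterate g (x, (0 : Omega M)) = x :=
  ((lfp_iterOp_zero hg x _).1 ((lfp_iterOp_iff hg _ _).2 rfl))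

theorem iterate_succ (hg : DfnF M g) (x : X) (n : Omega M) : iterate g (x, n.succ) = g (iterate g (x, n)) := by
  obtain ⟨c, h, h'⟩ := (lfp_iterOp_succ hg x _ n).1 ((lfp_iterOp_iff hg _ _).2 rfl)
  rw [h', (lfp_iterOp_iff hg _ _).1 h]

end

end

/-! ## The functions denoted by maps of PR -/

/-- The type of elements of an object of PR, over the natural numbers of `M`. -/
@[reducible] def Ob.Sem (M : Type w) [setLang.Structure M] [Nonempty M] : Ob → Type w
  | Ob.one => PUnit
  | Ob.nat => Omega M
  | Ob.prod A B => A.Sem M × B.Sem M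

section

variable {M : Type w} [setLang.Structure M] [Nonempty M] [ZModel M]

@[reducible] noncomputable def Ob.encSem : (A : Ob) → Enc M (A.Sem M)
  | Ob.one => inferInstanceAs (Enc M PUnit)
  | Ob.nat => inferInstanceAs (Enc M (Omega M))
  | Ob.prod A B =>
    letI := A.encSem
    letI := B.encSem
    inferInstanceAs (Enc M (A.Sem M × B.Sem M))

noncomputable instance Ob.instEnc (A : Ob) : Enc M (A.Sem M) := A.encSem

theorem Ob.setEncSem : (A : Ob) → SetEnc M (A.Sem M)
  | Ob.one => inferInstanceAs (SetEnc M PUnit)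
  | Ob.nat => inferInstanceAs (SetEnc M (Omega M))
  | Ob.prod A B =>
    letI := A.setEncSem
    letI := B.setEncSem
    inferInstanceAs (SetEnc M (A.Sem M × B.Sem M))

instance (A : Ob) : SetEnc M (A.Sem M) := A.setEncSem

/-- The pair of elements of two objects. -/
def Ob.mk {A B : Ob} (a : A.Sem M) (b : B.Sem M) : (Ob.prod A B).Sem M := (a, b)

def Ob.left {A B : Ob} (p : (Ob.prod A B).Sem M) : A.Sem M := Prod.fst p

def Ob.right {A B : Ob} (p : (Ob.prod A B).Sem M) : B.Sem M := Prod.snd p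

@[simp] theorem Ob.left_mk {A B : Ob} (a : A.Sem M) (b : B.Sem M) : Ob.left (Ob.mk a b) = a := rfl

@[simp] theorem Ob.right_mk {A B : Ob} (a : A.Sem M) (b : B.Sem M) : Ob.right (Ob.mk a b) = b := rfl

@[simp] theorem Ob.mk_left_right {A B : Ob} (p : (Ob.prod A B).Sem M) :
    Ob.mk (Ob.left p) (Ob.right p) = p := rfl

theorem Ob.mk_inj {A B : Ob} {a a' : A.Sem M} {b b' : B.Sem M} :
    Ob.mk a b = Ob.mk a' b' ↔ a = a' ∧ b = b' := Prod.mk_inj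

theorem Ob.mk_dfn {X : Type*} [Enc M X] {A B : Ob} {f : X → A.Sem M} {g : X → B.Sem M}
    (hf : DfnF M f) (hg : DfnF M g) : DfnF M fun x => Ob.mk (f x) (g x) := hf.pair hg

theorem Ob.left_dfn {X : Type*} [Enc M X] {A B : Ob} {f : X → (Ob.prod A B).Sem M}
    (hf : DfnF M f) : DfnF M fun x => Ob.left (f x) := DfnF.fst (Y := A.Sem M) (Z := B.Sem M) hf

theorem Ob.right_dfn {X : Type*} [Enc M X] {A B : Ob} {f : X → (Ob.prod A B).Sem M}
    (hf : DfnF M f) : DfnF M fun x => Ob.right (f x) := DfnF.snd (Y := A.Sem M) (Z := B.Sem M) hf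

/-- The function denoted by a map of PR. -/
noncomputable def PR.den : {A B : Ob} → PR A B → A.Sem M → B.Sem M
  | _, _, PR.zero, _ => (0 : Omega M)
  | _, _, PR.succ, n => Omega.succ (M := M) n
  | _, _, PR.id _, a => a
  | _, _, PR.comp g f, a => g.den (f.den a)
  | _, _, PR.term _, _ => PUnit.unit
  | _, _, PR.fst _ _, a => Ob.left a
  | _, _, PR.snd _ _, a => Ob.right a
  | _, _, PR.pair f g, a => Ob.mk (f.den a) (g.den a)
  | _, _, PR.iter (A := A) f, a => iterate (M := M) (X := A.Sem M) f.den a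

theorem PR.den_dfn {A B : Ob} (f : PR A B) : DfnF M (f.den (M := M)) := by
  induction f with
  | zero => exact DfnF.const (X := PUnit) (0 : Omega M)
  | succ => exact DfnF.succ (M := M) (X := Omega M) DfnF.id
  | id A => exact DfnF.id
  | comp g f hg hf => exact hg.comp hf
  | term A => exact DfnF.const (Y := PUnit) _
  | fst A B => exact DfnF.fstProj (X := A.Sem M) (Y := B.Sem M)
  | snd A B => exact DfnF.sndProj (X := A.Sem M) (Y := B.Sem M)
  | @pair A B C f g hf hg => exact DfnF.pair (Y := A.Sem M) (Z := B.Sem M) hf hg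
  | @iter A f hf => exact iterate_dfn (X := A.Sem M) hf

theorem PR.den_comp_dfn {X : Type*} [Enc M X] {A B : Ob} {f : PR A B} {g : X → A.Sem M}
    (hg : DfnF M g) : DfnF M fun x => f.den (g x) := f.den_dfn.comp hg

/-- `Ob.nat.Sem M` and `Omega M` are one type under two names; this and the following variants let
`Dfn.auto` pass from one to the other. -/
theorem DfnF.to_sem {X : Type*} [Enc M X] {f : X → Omega M} (hf : DfnF M f) :
    @DfnF M _ _ _ X (Ob.nat.Sem M) _ (Ob.instEnc Ob.nat) f := hf

theorem Ob.left_nat_dfn {X : Type*} [Enc M X] {B : Ob} {f : X → (Ob.prod Ob.nat B).Sem M}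
    (hf : DfnF M f) : DfnF M (Y := Omega M) fun x => Ob.left (f x) := Ob.left_dfn hf

theorem Ob.right_nat_dfn {X : Type*} [Enc M X] {A : Ob} {f : X → (Ob.prod A Ob.nat).Sem M}
    (hf : DfnF M f) : DfnF M (Y := Omega M) fun x => Ob.right (f x) := Ob.right_dfn hf

theorem Dfn.eq_sem {X : Type*} [Enc M X] {A : Ob} {f g : X → A.Sem M} (hf : DfnF M f)
    (hg : DfnF M g) : Dfn M fun x => f x = g x := Dfn.eq hf hg

theorem PR.den_nat_dfn {X : Type*} [Enc M X] {A : Ob} {f : PR A Ob.nat} {g : X → A.Sem M}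
    (hg : DfnF M g) : DfnF M (Y := Omega M) fun x => f.den (g x) := f.den_dfn.comp hg

/-! ### Computation rules of the denoted functions: recursion, arithmetic, Cantor's walk. -/

namespace PR

section

variable {A B C : Ob}

@[simp] theorem den_zero (a : Ob.one.Sem M) : zero.den a = (0 : Omega M) := rfl
@[simp] theorem den_succ (n : Omega M) : succ.den (M := M) n = n.succ := rfl
@[simp] theorem den_id (a : A.Sem M) : (PR.id A).den a = a := rfl
@[simp] theorem den_comp (g : PR B C) (f : PR A B) (a : A.Sem M) :
    (comp g f).den a = g.den (f.den a) := rfl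
@[simp] theorem den_fst (a : (Ob.prod A B).Sem M) : (fst A B).den a = Ob.left a := rfl
@[simp] theorem den_snd (a : (Ob.prod A B).Sem M) : (snd A B).den a = Ob.right a := rfl
@[simp] theorem den_pair (f : PR A B) (g : PR A C) (a : A.Sem M) :
    (pair f g).den a = Ob.mk (f.den a) (g.den a) := rfl
@[simp] theorem den_iter_zero (f : PR A A) (a : A.Sem M) :
    (iter f).den (M := M) (Ob.mk (B := Ob.nat) a (0 : Omega M)) = a := iterate_zero f.den_dfn a
@[simp] theorem den_iter_succ (f : PR A A) (a : A.Sem M) (n : Omega M) :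
    (iter f).den (M := M) (Ob.mk (B := Ob.nat) a n.succ) = f.den ((iter f).den (M := M) (Ob.mk (B := Ob.nat) a n)) :=
  iterate_succ f.den_dfn a n
@[simp] theorem den_zeroAt (a : A.Sem M) : (zeroAt A).den a = (0 : Omega M) := rfl
@[simp] theorem den_oneAt (a : A.Sem M) : (oneAt A).den a = (0 : Omega M).succ := rfl
@[simp] theorem den_atZero (a : A.Sem M) : (atZero A).den a = (Ob.mk (B := Ob.nat) a (0 : Omega M)) := rfl
@[simp] theorem den_atSucc (a : A.Sem M) (n : Omega M) :
    (atSucc A).den (M := M) (Ob.mk (B := Ob.nat) a n) = (Ob.mk (B := Ob.nat) a n.succ) := rfl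
@[simp] theorem den_timesNat (f : PR A B) (a : A.Sem M) (n : Omega M) :
    (timesNat f).den (M := M) (Ob.mk (B := Ob.nat) a n) = Ob.mk (B := Ob.nat) (f.den a) n := rfl

@[simp] theorem den_prec_zero (g : PR A B) (h : PR (Ob.prod (Ob.prod A Ob.nat) B) B)
    (a : A.Sem M) : (prec g h).den (M := M) (Ob.mk (B := Ob.nat) a (0 : Omega M)) = g.den a := by
  simp [prec]

/-- The iteration inside `prec` carries a record of argument and counter beside the value. After `n`
steps the record is `(a, n)`, which is what `h` has to receive. -/
theorem den_prec_aux (g : PR A B) (h : PR (Ob.prod (Ob.prod A Ob.nat) B) B) (a : A.Sem M)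
    (n : Omega M) :
    Ob.left ((iter (pair (comp (atSucc A) (fst (Ob.prod A Ob.nat) B)) h)).den (M := M)
      (Ob.mk (B := Ob.nat) (Ob.mk (Ob.mk (B := Ob.nat) a (0 : Omega M)) (g.den a)) n)) =
        Ob.mk (B := Ob.nat) a n := by
  induction n using Omega.induction with
  | hP =>
    exact Dfn.eq (Ob.left_dfn ((den_dfn _).comp (Ob.mk_dfn (.const _) .id)))
      (Ob.mk_dfn (.const _) .id)
  | zero => simp
  | succ n ih => simp [ih]

@[simp] theorem den_prec_succ (g : PR A B) (h : PR (Ob.prod (Ob.prod A Ob.nat) B) B)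
    (a : A.Sem M) (n : Omega M) : (prec g h).den (M := M) (Ob.mk (B := Ob.nat) a n.succ) =
      h.den (M := M) (Ob.mk (Ob.mk (B := Ob.nat) a n) ((prec g h).den (M := M) (Ob.mk (B := Ob.nat) a n))) := by
  simp only [prec, den_comp, den_snd, den_timesNat, den_pair, den_atZero, den_iter_succ]
  rw [← den_prec_aux g h a n, Ob.mk_left_right, Ob.right_mk]

@[simp] theorem den_cases_zero (g : PR A B) (h : PR (Ob.prod A Ob.nat) B) (a : A.Sem M) :
    (cases g h).den (M := M) (Ob.mk (B := Ob.nat) a (0 : Omega M)) = g.den a := by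
  simp [cases]

@[simp] theorem den_cases_succ (g : PR A B) (h : PR (Ob.prod A Ob.nat) B) (a : A.Sem M)
    (n : Omega M) : (cases g h).den (M := M) (Ob.mk (B := Ob.nat) a n.succ) = h.den (M := M) (Ob.mk (B := Ob.nat) a n) := by
  simp [cases]

@[simp] theorem den_casesNat_zero (z : PR Ob.one B) (h : PR Ob.nat B) :
    (casesNat z h).den (0 : Omega M) = z.den (M := M) PUnit.unit := by
  simp [casesNat]

@[simp] theorem den_casesNat_succ (z : PR Ob.one B) (h : PR Ob.nat B) (n : Omega M) :
    (casesNat z h).den n.succ = h.den n := by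
  simp [casesNat]

@[simp] theorem den_swap (a : A.Sem M) (b : B.Sem M) :
    (swap A B).den (Ob.mk a b) = Ob.mk b a := by
  simp [swap]

end

/-- The pair of natural numbers, as an element of the object `ℕ × ℕ`. -/
abbrev nn (m n : Omega M) : (Ob.prod Ob.nat Ob.nat).Sem M := Ob.mk (A := Ob.nat) (B := Ob.nat) m n

@[simp] theorem den_add_zero (m : Omega M) : add.den (nn m 0) = m := by simp [add]

@[simp] theorem den_add_succ (m n : Omega M) :
    add.den (nn m n.succ) = Omega.succ (M := M) (add.den (nn m n)) := by simp [add]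

@[simp] theorem den_zero_add (n : Omega M) : add.den (nn 0 n) = n := by
  induction n using Omega.induction with
  | hP => exact Dfn.auto
  | zero => simp
  | succ n ih => rw [den_add_succ, ih]

@[simp] theorem den_succ_add (m n : Omega M) :
    add.den (nn m.succ n) = Omega.succ (M := M) (add.den (nn m n)) := by
  induction n using Omega.induction with
  | hP => exact Dfn.auto
  | zero => simp
  | succ n ih => rw [den_add_succ, ih, den_add_succ]

@[simp] theorem den_pred_succ (n : Omega M) : pred.den n.succ = n := by simp [pred]

@[simp] theorem den_monus_zero (m : Omega M) : monus.den (nn m 0) = m := by simp [monus]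

@[simp] theorem den_monus_succ (m n : Omega M) :
    monus.den (nn m n.succ) = pred.den (monus.den (nn m n)) := by simp [monus]

theorem den_succ_monus_succ (m n : Omega M) :
    monus.den (nn m.succ n.succ) = monus.den (nn m n) := by
  induction n using Omega.induction with
  | hP => exact Dfn.auto
  | zero => simp
  | succ n ih => rw [den_monus_succ, ih, den_monus_succ]

@[simp] theorem den_monus_self (m : Omega M) : monus.den (nn m m) = (0 : Omega M) := by
  induction m using Omega.induction with
  | hP => exact Dfn.auto
  | zero => simp
  | succ n ih => rw [den_succ_monus_succ, ih]

/-- Both differences are unchanged when both arguments drop by one; hence the induction on `m` has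
to treat all `n` at once. -/
theorem eq_of_den_monus (m n : Omega M) (h : monus.den (nn m n) = (0 : Omega M))
    (h' : monus.den (nn n m) = (0 : Omega M)) : m = n := by
  revert n
  induction m using Omega.induction with
  | hP => exact Dfn.auto
  | zero => intro n _ h'; simpa using h'.symm
  | succ m ih =>
    intro n h h'
    obtain rfl | ⟨n, rfl⟩ := n.eq_zero_or_succ
    · simp at h
    · rw [den_succ_monus_succ] at h h'
      rw [ih n h h']

@[simp] theorem den_neg_zero : neg.den (0 : Omega M) = (0 : Omega M).succ := by simp [neg]

@[simp] theorem den_neg_succ (n : Omega M) : neg.den n.succ = (0 : Omega M) := by simp [neg]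

/-- `eqNat` negates the sum of the two truncated differences, and a sum vanishes only if both
summands do. -/
theorem den_eqNat_eq_one_iff (m n : Omega M) :
    eqNat.den (nn m n) = (0 : Omega M).succ ↔ m = n := by
  simp only [eqNat, den_comp, den_pair, den_swap]
  refine ⟨fun h => eq_of_den_monus m n ?_ ?_, fun h => by simp [h]⟩ <;>
    generalize (monus.den (nn m n) : Omega M) = a at h ⊢ <;>
    generalize (monus.den (nn n m) : Omega M) = b at h ⊢ <;>
    obtain rfl | ⟨a, rfl⟩ := a.eq_zero_or_succ <;> obtain rfl | ⟨b, rfl⟩ := b.eq_zero_or_succ <;>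
    simp at h ⊢

@[simp] theorem den_imp_succ (m n : Omega M) : imp.den (nn m.succ n) = n := by simp [imp]

@[simp] theorem den_walk_zero (m : Omega M) : walk.den (nn m 0) = nn 0 m.succ := by simp [walk]

@[simp] theorem den_walk_succ (m n : Omega M) : walk.den (nn m n.succ) = nn m.succ n := by
  simp [walk]

@[simp] theorem den_unpair_zero : unpair.den (0 : Omega M) = nn 0 0 := by simp [unpair]

@[simp] theorem den_unpair_succ (n : Omega M) :
    unpair.den n.succ = walk.den (unpair.den n) := by simp [unpair]

@[simp] theorem den_triangle_zero : triangle.den (0 : Omega M) = (0 : Omega M) := by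
  simp [triangle]

@[simp] theorem den_triangle_succ (n : Omega M) :
    triangle.den n.succ = add.den (nn (triangle.den n) n.succ) := by simp [triangle]

end PR

/-- Cantor's pairing. -/
noncomputable def Omega.pair (m n : Omega M) : Omega M := PR.cpair.den (PR.nn m n)

theorem DfnF.pairing {X : Type*} [Enc M X] {f g : X → Omega M} (hf : DfnF M f) (hg : DfnF M g) :
    DfnF M fun x => Omega.pair (f x) (g x) :=
  PR.cpair.den_dfn.comp (Ob.mk_dfn (A := Ob.nat) (B := Ob.nat) hf hg)

namespace PR

theorem den_cpair (m n : Omega M) : cpair.den (nn m n) = Omega.pair m n := rfl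

theorem pair_eq (m n : Omega M) :
    Omega.pair m n = add.den (nn (triangle.den (add.den (nn m n))) m) := by
  simp [Omega.pair, cpair]

/-- Each step of the walk raises the Cantor number of the position by one: on a diagonal the first
coordinate grows, and the jump from `(m, 0)` to `(0, m + 1)` trades `m` for an increase of the
triangular number by `m + 1`. -/
theorem pair_left_right_unpair (k : Omega M) :
    Omega.pair (Ob.left (unpair.den k)) (Ob.right (unpair.den k)) = k := by
  induction k using Omega.induction with
  | hP => exact Dfn.auto
  | zero => simp [pair_eq]
  | succ k ih =>
    rw [den_unpair_succ]
    conv_rhs => rw [← ih]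
    rw [← Ob.mk_left_right (unpair.den k)]
    generalize (Ob.left (unpair.den k) : Omega M) = m
    generalize (Ob.right (unpair.den k) : Omega M) = n
    obtain rfl | ⟨n, rfl⟩ := n.eq_zero_or_succ <;> simp [pair_eq]

/-- From `(0, m + n)` the walk reaches `(m, n)` in `m` steps. The starting points `(0, s)` are
reached by induction on `s`: the end `(s, 0)` of one diagonal is followed by `(0, s + 1)`. -/
theorem exists_unpair (m n : Omega M) : ∃ k : Omega M, unpair.den k = nn m n := by
  have down : ∀ m n : Omega M, (∃ k : Omega M, unpair.den k = nn 0 (add.den (nn m n))) →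
      ∃ k : Omega M, unpair.den k = nn m n := by
    intro m
    induction m using Omega.induction with
    | hP => exact Dfn.auto
    | zero => simp
    | succ m ih =>
      intro n h
      obtain ⟨k, hk⟩ := ih n.succ (by simpa using h)
      exact ⟨k.succ, by simp [hk]⟩
  apply down
  generalize (add.den (nn m n) : Omega M) = s
  induction s using Omega.induction with
  | hP => exact Dfn.auto
  | zero => exact ⟨0, by simp⟩
  | succ s ih =>
    obtain ⟨k, hk⟩ := down s 0 (by simpa only [PR.den_add_zero] using ih)
    exact ⟨k.succ, by simp [hk]⟩

@[simp] theorem den_unpair_pair (m n : Omega M) : unpair.den (Omega.pair m n) = nn m n := by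
  obtain ⟨k, hk⟩ := exists_unpair m n
  have := pair_left_right_unpair k
  rw [hk] at this
  rw [← hk]
  exact congrArg _ this

end PR

namespace Omega

@[simp] theorem pair_inj {m n m' n' : Omega M} : pair m n = pair m' n' ↔ m = m' ∧ n = n' := by
  refine ⟨fun h => ?_, fun ⟨h, h'⟩ => h ▸ h' ▸ rfl⟩
  have := congrArg PR.unpair.den h
  simp only [PR.den_unpair_pair] at this
  exact Ob.mk_inj.1 this

theorem exists_pair (k : Omega M) : ∃ m n, k = pair m n :=
  ⟨_, _, (PR.pair_left_right_unpair k).symm⟩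

@[simp] theorem pair_zero_zero : pair (0 : Omega M) 0 = 0 := by simp [PR.pair_eq]

end Omega

/-! ## The pairing of natural numbers, numerals and codes -/

theorem IsNat.exists_coe {n : M} (h : IsNat n) : ∃ k : Omega M, (k : M) = n := ⟨⟨n, h⟩, rfl⟩

theorem the_eq {P : M → Prop} {a : M} (h : ∀ x, P x ↔ x = a) : the P = a :=
  (h _).1 (the_spec ⟨a, (h a).2 rfl⟩)

theorem mem_of_cantorClosed {S : M} (hS : CantorClosed S) (k : Omega M) :
    Enc.enc (k, (PR.unpair.den k : (Ob.prod Ob.nat Ob.nat).Sem M)) ∈ₘ S := by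
  induction k using Omega.induction with
  | hP => exact .mem (.encode (.pair .id (PR.den_dfn (A := Ob.nat) _))) (.const _)
  | zero => rw [PR.den_unpair_zero]; exact hS.start
  | succ k ih =>
    rw [PR.den_unpair_succ]
    rw [← Ob.mk_left_right (PR.unpair.den k)] at ih ⊢
    generalize (Ob.left (PR.unpair.den k) : Omega M) = m at ih ⊢
    generalize (Ob.right (PR.unpair.den k) : Omega M) = n at ih ⊢
    obtain rfl | ⟨n, rfl⟩ := n.eq_zero_or_succ
    · rw [PR.den_walk_zero]
      exact hS.jump _ _ k.2 m.2 ih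
    · rw [PR.den_walk_succ]
      exact hS.down _ _ _ k.2 m.2 n.2 ih

/-- The graph of `unpair` is a closed set without superfluous elements. Together with
`mem_of_cantorClosed` it determines the intersection of all closed sets, from which `cp` is defined.
-/
theorem exists_cantorClosed : ∃ S : M, CantorClosed S ∧
    (∀ (k : Omega M) (p : (Ob.prod Ob.nat Ob.nat).Sem M), Enc.enc (k, p) ∈ₘ S ↔
      p = PR.unpair.den k) ∧ ∀ k a b : M, kpair k (kpair a b) ∈ₘ S → IsNat a ∧ IsNat b := by
  obtain ⟨S, hS⟩ := exists_set_of_dfn (M := M)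
    (P := fun q : Omega M × (Ob.prod Ob.nat Ob.nat).Sem M => q.2 = PR.unpair.den q.1)
    (.eq .sndProj ((PR.den_dfn (A := Ob.nat) _).comp .fstProj))
  have hS' : ∀ (k : Omega M) (p : (Ob.prod Ob.nat Ob.nat).Sem M), Enc.enc (k, p) ∈ₘ S ↔
      p = PR.unpair.den k := fun k p => (hS _).trans
    ⟨fun ⟨q, hq, h⟩ => by obtain rfl := Enc.inj hq; exact h, fun h => ⟨_, rfl, h⟩⟩
  have hS'' : ∀ k a b : M, kpair k (kpair a b) ∈ₘ S → IsNat a ∧ IsNat b := fun k a b h => by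
    obtain ⟨⟨k', a', b'⟩, hq, -⟩ := (hS _).1 h
    obtain ⟨-, h⟩ := kpair_inj.1 hq
    obtain ⟨rfl, rfl⟩ := kpair_inj.1 h
    exact ⟨a'.2, b'.2⟩
  refine ⟨S, ⟨(hS' 0 (PR.nn 0 0)).2 (by simp), fun k m n hk hm hn h => ?_,
    fun k m hk hm h => ?_⟩, hS', hS''⟩
  · obtain ⟨k, rfl⟩ := hk.exists_coe
    obtain ⟨m, rfl⟩ := hm.exists_coe
    obtain ⟨n, rfl⟩ := hn.exists_coe
    have := (hS' k (PR.nn m n.succ)).1 h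
    exact (hS' k.succ (PR.nn m.succ n)).2 (by
      rw [PR.den_unpair_succ, ← this, PR.den_walk_succ])
  · obtain ⟨k, rfl⟩ := hk.exists_coe
    obtain ⟨m, rfl⟩ := hm.exists_coe
    have := (hS' k (PR.nn m 0)).1 h
    exact (hS' k.succ (PR.nn 0 m.succ)).2 (by
      rw [PR.den_unpair_succ, ← this, PR.den_walk_zero])

theorem cp_coe (m n : Omega M) : cp (m : M) (n : M) = Omega.pair m n := by
  refine the_eq fun k => ⟨?_, ?_⟩
  · rintro ⟨hk, h⟩
    obtain ⟨k, rfl⟩ := hk.exists_coe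
    obtain ⟨S, hS, hS', -⟩ := exists_cantorClosed (M := M)
    have := (hS' k (PR.nn m n)).1 (h S hS)
    rw [← PR.den_unpair_pair] at this
    have h2 := congrArg (fun p => Omega.pair (Ob.left p) (Ob.right p)) this
    simp only [PR.pair_left_right_unpair] at h2
    exact congrArg Subtype.val h2.symm
  · rintro rfl
    refine ⟨(Omega.pair m n).2, fun S hS => ?_⟩
    have := mem_of_cantorClosed hS (Omega.pair m n)
    rwa [PR.den_unpair_pair] at this

/-- The graph of `unpair` shows that no number satisfies the description, so `cp` takes the same
default value at all such arguments. -/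
theorem cp_of_not_isNat {a b : M} (h : ¬ (IsNat a ∧ IsNat b)) : cp a b = the fun _ => False := by
  obtain ⟨S, hS, -, hS'⟩ := exists_cantorClosed (M := M)
  exact congrArg the (funext fun k => eq_false fun hk => h (hS' k a b (hk.2 S hS)))

/-- Serves the rule of surjective pairing, where a product type may occur without its factors being
known to be numbers. If `a`, `b` are not both numbers, `cp a b` is the default value; were that not
a number, pairing it with the tag would give the default value again, so the code would not be a
number either. -/
theorem isNat_cp_of_code {t : ℕ} {a b : M} (h : IsNat (FramedPR.code t a b)) : IsNat (cp a b) := by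
  by_cases hab : IsNat a ∧ IsNat b
  · exact cp_coe ⟨a, hab.1⟩ ⟨b, hab.2⟩ ▸ (Omega.pair _ _).2
  · by_contra hc
    rw [FramedPR.code, tri, cp_of_not_isNat fun h => hc h.2, ← cp_of_not_isNat hab] at h
    exact hc h

/-- Standard numerals. -/
noncomputable def Omega.numeral : ℕ → Omega M
  | 0 => 0
  | n + 1 => (numeral n).succ

theorem num_eq_coe : ∀ n : ℕ, (num n : M) = (Omega.numeral n : Omega M)
  | 0 => rfl
  | n + 1 => congrArg suc (num_eq_coe n)

namespace Omega

@[simp] theorem numeral_inj {m n : ℕ} : (numeral m : Omega M) = numeral n ↔ m = n := by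
  refine ⟨fun h => ?_, fun h => h ▸ rfl⟩
  induction m generalizing n with
  | zero => cases n with
    | zero => rfl
    | succ n => exact absurd h (zero_ne_succ _)
  | succ m ih => cases n with
    | zero => exact absurd h (succ_ne_zero _)
    | succ n => rw [ih (succ_inj.1 h)]

/-- The code with tag `t` and entries `a`, `b`. -/
noncomputable def cd (t : ℕ) (a b : Omega M) : Omega M := pair (numeral t) (pair a b)

@[simp] theorem cd_inj {t t' : ℕ} {a b a' b' : Omega M} :
    cd t a b = cd t' a' b' ↔ t = t' ∧ a = a' ∧ b = b' := by
  simp [cd]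

end Omega

theorem DfnF.code {X : Type*} [Enc M X] {t : ℕ} {f g : X → Omega M} (hf : DfnF M f)
    (hg : DfnF M g) : DfnF M fun x => Omega.cd t (f x) (g x) :=
  .pairing (.const _) (.pairing hf hg)

theorem code_coe (t : ℕ) (a b : Omega M) : FramedPR.code t (a : M) (b : M) = Omega.cd t a b := by
  rw [FramedPR.code, tri, num_eq_coe, cp_coe, cp_coe]; rfl

end
section

variable {M : Type w} [setLang.Structure M] [Nonempty M] [ZModel M]

open FramedPR.Omega (cd)

/-! ## Elements of coded objects and evaluation of coded maps of PR -/

/-- The clauses of `El`. -/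
def ElOp (R : Omega M × Omega M → Prop) (p : Omega M × Omega M) : Prop :=
  (p.1 = cd 0 0 0 ∧ p.2 = 0) ∨ p.1 = cd 1 0 0 ∨
    ∃ A B a b, p.1 = cd 2 A B ∧ p.2 = .pair a b ∧ R (A, a) ∧ R (B, b)

/-- `a` codes an element of the object of PR with code `A`; pairs are coded by Cantor's pairing. -/
def El (A a : Omega M) : Prop := lfp M ElOp (A, a)

theorem elOp_dfn : DfnOp M (ElOp (M := M)) := by
  unfold DfnOp ElOp
  exact Dfn.auto

theorem el_dfn : Dfn M fun p : Omega M × Omega M => El p.1 p.2 := lfp_dfn elOp_dfn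

theorem el_iff (A a : Omega M) :
    El A a ↔ (A = cd 0 0 0 ∧ a = 0) ∨ A = cd 1 0 0 ∨
      ∃ A₁ A₂ a₁ a₂, A = cd 2 A₁ A₂ ∧ a = .pair a₁ a₂ ∧ El A₁ a₁ ∧ El A₂ a₂ :=
  lfp_iff elOp_dfn (fun R R' h p => by
    rintro (hp | hp | ⟨A, B, a, b, h1, h2, h3, h4⟩)
    exacts [Or.inl hp, Or.inr (Or.inl hp), Or.inr (Or.inr ⟨A, B, a, b, h1, h2, h _ h3, h _ h4⟩)]) _

@[simp] theorem el_one (a : Omega M) : El (cd 0 0 0) a ↔ a = 0 := by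
  rw [el_iff]; simp

@[simp] theorem el_nat (a : Omega M) : El (cd 1 0 0) a := by
  rw [el_iff]; simp

theorem el_prod (A B k : Omega M) :
    El (cd 2 A B) k ↔ ∃ a b, k = .pair a b ∧ El A a ∧ El B b := by
  rw [el_iff]
  simp only [Omega.cd_inj]
  constructor
  · rintro (⟨⟨h, _⟩, _⟩ | ⟨h, _⟩ | ⟨A', B', a, b, ⟨-, rfl, rfl⟩, h⟩)
    · simp at h
    · simp at h
    · exact ⟨a, b, h⟩
  · rintro ⟨a, b, h⟩
    exact Or.inr (Or.inr ⟨A, B, a, b, by simp, h⟩)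

@[simp] theorem el_prod_pair (A B a b : Omega M) : El (cd 2 A B) (.pair a b) ↔ El A a ∧ El B b := by
  simp [el_prod]

/-- The clauses of `EvPR`. -/
def EvOp (R : Omega M × Omega M × Omega M → Prop) (p : Omega M × Omega M × Omega M) : Prop :=
  (p.1 = cd 0 0 0 ∧ p.2.1 = 0 ∧ p.2.2 = 0) ∨
  (p.1 = cd 1 0 0 ∧ p.2.2 = Omega.succ p.2.1) ∨
  (∃ A, p.1 = cd 2 A 0 ∧ El A p.2.1 ∧ p.2.2 = p.2.1) ∨
  (∃ g f c, p.1 = cd 3 g f ∧ R (f, p.2.1, c) ∧ R (g, c, p.2.2)) ∨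
  (∃ A, p.1 = cd 4 A 0 ∧ El A p.2.1 ∧ p.2.2 = 0) ∨
  (∃ A B b, p.1 = cd 5 A B ∧ p.2.1 = .pair p.2.2 b ∧ El A p.2.2 ∧ El B b) ∨
  (∃ A B a, p.1 = cd 6 A B ∧ p.2.1 = .pair a p.2.2 ∧ El A a ∧ El B p.2.2) ∨
  (∃ f g a b, p.1 = cd 7 f g ∧ p.2.2 = .pair a b ∧ R (f, p.2.1, a) ∧ R (g, p.2.1, b)) ∨
  (∃ f x, p.1 = cd 8 f 0 ∧
    -- Zero iterations do not call `f`. Requiring `f` to be defined at `x` cuts the domain of the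
    -- iterated map down to `A × ℕ`, just as the tests with `El` do in the clauses for identities,
    -- terminal maps and projections.
    ((p.2.1 = .pair x 0 ∧ p.2.2 = x ∧ ∃ y, R (f, x, y)) ∨
      ∃ n y, p.2.1 = .pair x (Omega.succ n) ∧ R (cd 8 f 0, .pair x n, y) ∧ R (f, y, p.2.2)))

/-- The graph of evaluation of codes of maps of PR; the domain of definition of the code of a map
`A → B` is the set of codes of elements of `A`. -/
def EvPR (f a b : Omega M) : Prop := lfp M EvOp (f, a, b)

theorem evOp_dfn : DfnOp M (EvOp (M := M)) := by
  have hR₂ := el_dfn (M := M)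
  unfold DfnOp EvOp
  exact Dfn.auto

theorem evPR_dfn : Dfn M fun p : Omega M × Omega M × Omega M => EvPR p.1 p.2.1 p.2.2 :=
  lfp_dfn evOp_dfn

theorem evOp_mono (R R' : Omega M × Omega M × Omega M → Prop) (h : ∀ p, R p → R' p) (p)
    (hp : EvOp R p) : EvOp R' p := by
  unfold EvOp at hp ⊢
  refine hp.imp id (Or.imp id (Or.imp id (Or.imp ?_ (Or.imp id (Or.imp id (Or.imp id
    (Or.imp ?_ ?_)))))))
  · rintro ⟨g, f, c, h1, h2, h3⟩
    exact ⟨g, f, c, h1, h _ h2, h _ h3⟩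
  · rintro ⟨f, g, a, b, h1, h2, h3, h4⟩
    exact ⟨f, g, a, b, h1, h2, h _ h3, h _ h4⟩
  · rintro ⟨f, x, h1, ⟨h2, h3, y, h4⟩ | ⟨n, y, h2, h3, h4⟩⟩
    exacts [⟨f, x, h1, Or.inl ⟨h2, h3, y, h _ h4⟩⟩, ⟨f, x, h1, Or.inr ⟨n, y, h2, h _ h3, h _ h4⟩⟩]

theorem evPR_iff (f a b : Omega M) : EvPR f a b ↔ EvOp (fun p => EvPR p.1 p.2.1 p.2.2) (f, a, b) :=
  lfp_iff evOp_dfn evOp_mono _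

@[simp] theorem evPR_zero (a b : Omega M) : EvPR (cd 0 0 0) a b ↔ a = 0 ∧ b = 0 := by
  rw [evPR_iff]; simp [EvOp]

@[simp] theorem evPR_succ (a b : Omega M) : EvPR (cd 1 0 0) a b ↔ b = a.succ := by
  rw [evPR_iff]; simp [EvOp]

@[simp] theorem evPR_id (A a b : Omega M) : EvPR (cd 2 A 0) a b ↔ El A a ∧ b = a := by
  rw [evPR_iff]; simp [EvOp]

@[simp] theorem evPR_comp (g f a b : Omega M) :
    EvPR (cd 3 g f) a b ↔ ∃ c, EvPR f a c ∧ EvPR g c b := by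
  rw [evPR_iff]; simp [EvOp]

@[simp] theorem evPR_term (A a b : Omega M) : EvPR (cd 4 A 0) a b ↔ El A a ∧ b = 0 := by
  rw [evPR_iff]; simp [EvOp]

@[simp] theorem evPR_fst (A B a b : Omega M) :
    EvPR (cd 5 A B) a b ↔ ∃ c, a = .pair b c ∧ El A b ∧ El B c := by
  rw [evPR_iff]; simp [EvOp]

@[simp] theorem evPR_snd (A B a b : Omega M) :
    EvPR (cd 6 A B) a b ↔ ∃ c, a = .pair c b ∧ El A c ∧ El B b := by
  rw [evPR_iff]; simp [EvOp]

@[simp] theorem evPR_pair (f g a b : Omega M) :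
    EvPR (cd 7 f g) a b ↔ ∃ c d, b = .pair c d ∧ EvPR f a c ∧ EvPR g a d := by
  rw [evPR_iff]; simp [EvOp]

theorem evPR_iter_zero (f x b : Omega M) :
    EvPR (cd 8 f 0) (.pair x 0) b ↔ b = x ∧ ∃ y, EvPR f x y := by
  rw [evPR_iff]; simp [EvOp]

theorem evPR_iter_succ (f x n b : Omega M) :
    EvPR (cd 8 f 0) (.pair x n.succ) b ↔ ∃ y, EvPR (cd 8 f 0) (.pair x n) y ∧ EvPR f y b := by
  rw [evPR_iff]; simp [EvOp]

/-! ## Typed codes -/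

/-- The code `f` evaluates to a function from the elements of `A` to the elements of `B`. -/
structure Typed (f A B : Omega M) : Prop where
  total : ∀ a, El A a → ∃ b, El B b ∧ ∀ c, EvPR f a c ↔ c = b
  dom : ∀ a b, EvPR f a b → El A a

namespace Typed

variable {f g h A B C D : Omega M}

theorem exists_value (hf : Typed f A B) {a : Omega M} (ha : El A a) : ∃ b, EvPR f a b := by
  obtain ⟨b, -, h⟩ := hf.total a ha
  exact ⟨b, (h b).2 rfl⟩

theorem cod (hf : Typed f A B) {a b : Omega M} (h : EvPR f a b) : El B b := by
  obtain ⟨c, hc, h'⟩ := hf.total a (hf.dom a b h)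
  exact (h' b).1 h ▸ hc

theorem unique (hf : Typed f A B) {a b c : Omega M} (h : EvPR f a b) (h' : EvPR f a c) :
    b = c := by
  obtain ⟨d, -, hd⟩ := hf.total a (hf.dom a b h)
  exact ((hd b).1 h).trans ((hd c).1 h').symm

theorem zero : Typed (cd 0 0 0 : Omega M) (cd 0 0 0) (cd 1 0 0) :=
  ⟨fun a ha => ⟨0, by simp_all⟩, by simp_all⟩

theorem succ : Typed (cd 1 0 0 : Omega M) (cd 1 0 0) (cd 1 0 0) :=
  ⟨fun a ha => ⟨a.succ, by simp_all⟩, by simp_all⟩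

theorem id (A : Omega M) : Typed (cd 2 A 0) A A :=
  ⟨fun a ha => ⟨a, by simp_all⟩, by simp_all⟩

theorem comp (hf : Typed f A B) (hg : Typed g B C) : Typed (cd 3 g f) A C := by
  refine ⟨fun a ha => ?_, fun a c h => ?_⟩
  · obtain ⟨b, hb, h⟩ := hf.total a ha
    obtain ⟨c, hc, h'⟩ := hg.total b hb
    exact ⟨c, hc, by simp [h, h']⟩
  · obtain ⟨b, hb, -⟩ := (evPR_comp ..).1 h
    exact hf.dom _ _ hb

theorem term (A : Omega M) : Typed (cd 4 A 0) A (cd 0 0 0) :=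
  ⟨fun a ha => ⟨0, by simp_all⟩, by simp_all⟩

theorem fst (A B : Omega M) : Typed (cd 5 A B) (cd 2 A B) A := by
  refine ⟨fun k hk => ?_, fun k a h => ?_⟩
  · obtain ⟨a, b, rfl, ha, hb⟩ := (el_prod ..).1 hk
    exact ⟨a, ha, fun c => ⟨by simp +contextual [eq_comm], by rintro rfl; simp [ha, hb]⟩⟩
  · obtain ⟨b, rfl, ha, hb⟩ := (evPR_fst ..).1 h
    simp [ha, hb]

theorem snd (A B : Omega M) : Typed (cd 6 A B) (cd 2 A B) B := by
  refine ⟨fun k hk => ?_, fun k a h => ?_⟩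
  · obtain ⟨a, b, rfl, ha, hb⟩ := (el_prod ..).1 hk
    exact ⟨b, hb, fun c => ⟨by simp +contextual [eq_comm], by rintro rfl; simp [ha, hb]⟩⟩
  · obtain ⟨b, rfl, ha, hb⟩ := (evPR_snd ..).1 h
    simp [ha, hb]

theorem pair (hf : Typed f C A) (hg : Typed g C B) : Typed (cd 7 f g) C (cd 2 A B) := by
  refine ⟨fun c hc => ?_, fun a c h => ?_⟩
  · obtain ⟨a, ha, h⟩ := hf.total c hc
    obtain ⟨b, hb, h'⟩ := hg.total c hc
    exact ⟨.pair a b, by simp [ha, hb], by simp [h, h']⟩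
  · obtain ⟨_, _, -, h, -⟩ := (evPR_pair ..).1 h
    exact hf.dom _ _ h

theorem iter_total (hf : Typed f A A) {x : Omega M} (hx : El A x) (n : Omega M) :
    ∃ b, El A b ∧ ∀ c, EvPR (cd 8 f 0) (.pair x n) c ↔ c = b := by
  induction n using Omega.induction with
  | hP =>
    have hR₂ := el_dfn (M := M)
    have hR₃ := evPR_dfn (M := M)
    exact Dfn.auto
  | zero =>
    exact ⟨x, hx, fun c => by simp [evPR_iter_zero, hf.exists_value hx]⟩
  | succ n ih =>
    obtain ⟨b, hb, h⟩ := ih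
    obtain ⟨c, hc, h'⟩ := hf.total b hb
    exact ⟨c, hc, by simp [evPR_iter_succ, h, h']⟩

/-- Counting down ends in the zero clause, which demands that `f` be defined at `x`. -/
theorem iter_dom (hf : Typed f A A) (x n : Omega M) :
    ∀ b, EvPR (cd 8 f 0) (.pair x n) b → El A x := by
  induction n using Omega.induction with
  | hP =>
    have hR₂ := el_dfn (M := M)
    have hR₃ := evPR_dfn (M := M)
    exact Dfn.auto
  | zero =>
    intro b hb
    obtain ⟨-, y, hy⟩ := (evPR_iter_zero ..).1 hb
    exact hf.dom _ _ hy
  | succ n ih =>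
    intro b hb
    obtain ⟨y, hy, -⟩ := (evPR_iter_succ ..).1 hb
    exact ih y hy

theorem iter (hf : Typed f A A) : Typed (cd 8 f 0) (cd 2 A (cd 1 0 0)) A := by
  refine ⟨fun k hk => ?_, fun k b h => ?_⟩
  · obtain ⟨x, n, rfl, hx, -⟩ := (el_prod ..).1 hk
    exact iter_total hf hx n
  · obtain ⟨x, n, rfl⟩ := k.exists_pair
    simp [iter_dom hf x n b h]

end Typed

end
section

variable {M : Type w} [setLang.Structure M] [Nonempty M] [ZModel M]

open FramedPR.Omega (cd)

/-! ## Induction on inductively defined sets of numbers -/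

/-- An element of `ω` as a natural number of `M`. -/
def IsNat.toOmega {n : M} (h : IsNat n) : Omega M := ⟨n, h⟩

/-- False outside ω, which is the shape of `In2 S`; a definable relation thereby becomes literally
equal to some `In2 S`, and likewise for `Lift3` and `In3`. -/
def Lift2 (R : Omega M → Omega M → Prop) (a b : M) : Prop :=
  ∃ (ha : IsNat a) (hb : IsNat b), R ha.toOmega hb.toOmega

def Lift3 (R : Omega M → Omega M → Omega M → Prop) (a b c : M) : Prop :=
  ∃ (ha : IsNat a) (hb : IsNat b) (hc : IsNat c), R ha.toOmega hb.toOmega hc.toOmega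

theorem Lift2.of {R : Omega M → Omega M → Prop} {a b : Omega M} {x y : M} (hx : x = a) (hy : y = b)
    (h : R a b) : Lift2 R x y := by
  subst hx hy
  exact ⟨a.2, b.2, h⟩

theorem Lift3.of {R : Omega M → Omega M → Omega M → Prop} {a b c : Omega M} {x y z : M}
    (hx : x = a) (hy : y = b) (hz : z = c) (h : R a b c) : Lift3 R x y z := by
  subst hx hy hz
  exact ⟨a.2, b.2, c.2, h⟩

theorem exists_in2_eq {R : Omega M → Omega M → Prop}
    (hR₂ : Dfn M fun p : Omega M × Omega M => R p.1 p.2) : ∃ S : M, In2 S = Lift2 R := by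
  obtain ⟨S, hS⟩ := exists_set_enc_mem (M := M)
    (P := fun k : Omega M => ∃ a b, k = .pair a b ∧ R a b) Dfn.auto
  refine ⟨S, funext fun a => funext fun b => propext ?_⟩
  have key (a b : Omega M) : cp (a : M) b ∈ₘ S ↔ R a b := by
    rw [cp_coe]
    refine (hS (.pair a b)).trans ?_
    simp only [Omega.pair_inj]
    exact ⟨fun ⟨_, _, ⟨h1, h2⟩, h⟩ => h1 ▸ h2 ▸ h, fun h => ⟨a, b, ⟨rfl, rfl⟩, h⟩⟩
  exact ⟨fun ⟨ha, hb, h⟩ => ⟨ha, hb, (key ha.toOmega hb.toOmega).1 h⟩,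
    fun ⟨ha, hb, h⟩ => ⟨ha, hb, (key ha.toOmega hb.toOmega).2 h⟩⟩

theorem exists_in3_eq {R : Omega M → Omega M → Omega M → Prop}
    (hR₃ : Dfn M fun p : Omega M × Omega M × Omega M => R p.1 p.2.1 p.2.2) :
    ∃ S : M, In3 S = Lift3 R := by
  obtain ⟨S, hS⟩ := exists_set_enc_mem (M := M)
    (P := fun k : Omega M => ∃ a b c, k = .pair a (.pair b c) ∧ R a b c) Dfn.auto
  refine ⟨S, funext fun a => funext fun b => funext fun c => propext ?_⟩
  have key (a b c : Omega M) : tri (a : M) b c ∈ₘ S ↔ R a b c := by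
    rw [tri, cp_coe, cp_coe]
    refine (hS (.pair a (.pair b c))).trans ?_
    simp only [Omega.pair_inj]
    exact ⟨fun ⟨_, _, _, ⟨h1, h2, h3⟩, h⟩ => h1 ▸ h2 ▸ h3 ▸ h,
      fun h => ⟨a, b, c, ⟨rfl, rfl, rfl⟩, h⟩⟩
  exact ⟨fun ⟨ha, hb, hc, h⟩ => ⟨ha, hb, hc, (key ha.toOmega hb.toOmega hc.toOmega).1 h⟩,
    fun ⟨ha, hb, hc, h⟩ => ⟨ha, hb, hc, (key ha.toOmega hb.toOmega hc.toOmega).2 h⟩⟩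

/-- The relation `R` is given by a set of `M` and so takes part in the intersection that defines
`Least2`. The ternary version works in the same way. -/
theorem least2_induction {C : (M → M → Prop) → Prop} {R : Omega M → Omega M → Prop}
    (hR : Dfn M fun p : Omega M × Omega M => R p.1 p.2) (hC : C (Lift2 R)) {a b : M}
    (h : Least2 C a b) : Lift2 R a b := by
  obtain ⟨S, hS⟩ := exists_in2_eq hR
  rw [← hS] at hC ⊢
  exact h.2.2 S hC

theorem least3_induction {C : (M → M → M → Prop) → Prop} {R : Omega M → Omega M → Omega M → Prop}
    (hR : Dfn M fun p : Omega M × Omega M × Omega M => R p.1 p.2.1 p.2.2) (hC : C (Lift3 R))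
    {a b c : M} (h : Least3 C a b c) : Lift3 R a b c := by
  obtain ⟨S, hS⟩ := exists_in3_eq hR
  rw [← hS] at hC ⊢
  exact h.2.2.2 S hC

/-! ## Soundness of internal equality of PR -/

theorem typed_dfn :
    Dfn M fun p : Omega M × Omega M × Omega M => Typed p.1 p.2.1 p.2.2 := by
  have hR₂ := el_dfn (M := M)
  have hR₃ := evPR_dfn (M := M)
  exact Dfn.congr (P := fun p : Omega M × Omega M × Omega M =>
    (∀ a, El p.2.1 a → ∃ b, El p.2.2 b ∧ ∀ c, EvPR p.1 a c ↔ c = b) ∧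
      ∀ a b, EvPR p.1 a b → El p.2.1 a) Dfn.auto fun p => ⟨fun h => ⟨h.1, h.2⟩, fun h => ⟨h.1, h.2⟩⟩

theorem IsOb.isNat {A : M} (h : IsOb A) : IsNat A := h.1

theorem oNat_coe : (oNat : M) = (cd 1 0 0 : Omega M) := code_coe 1 0 0

/-- Induction over the typing relation of `M`. The closure properties of `Typed` hold for arbitrary
numbers in place of object codes, so `IsOb` contributes only that these are numbers. -/
theorem lift3_typed {f A B : M} (h : HasType f A B) : Lift3 Typed f A B := by
  refine least3_induction typed_dfn ?_ h
  constructor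
  case zero => exact .of (code_coe 0 0 0) (code_coe 0 0 0) oNat_coe .zero
  case succ => exact .of (code_coe 1 0 0) oNat_coe oNat_coe .succ
  case id => exact fun A hA => .of (code_coe 2 hA.isNat.toOmega 0) rfl rfl (.id hA.isNat.toOmega)
  case comp =>
    rintro f g A B C ⟨hf, hA, hB, h1⟩ ⟨hg, _, hC, h2⟩
    exact .of (code_coe 3 hg.toOmega hf.toOmega) rfl rfl (h1.comp h2)
  case term =>
    exact fun A hA => .of (code_coe 4 hA.isNat.toOmega 0) rfl (code_coe 0 0 0)
      (.term hA.isNat.toOmega)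
  case fst =>
    exact fun A B hA hB => .of (code_coe 5 hA.isNat.toOmega hB.isNat.toOmega)
      (code_coe 2 hA.isNat.toOmega hB.isNat.toOmega) rfl (.fst hA.isNat.toOmega hB.isNat.toOmega)
  case snd =>
    exact fun A B hA hB => .of (code_coe 6 hA.isNat.toOmega hB.isNat.toOmega)
      (code_coe 2 hA.isNat.toOmega hB.isNat.toOmega) rfl (.snd hA.isNat.toOmega hB.isNat.toOmega)
  case pair =>
    rintro f g A B C ⟨hf, hC, hA, h1⟩ ⟨hg, _, hB, h2⟩
    exact .of (code_coe 7 hf.toOmega hg.toOmega) rfl (code_coe 2 hA.toOmega hB.toOmega) (h1.pair h2)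
  case iter =>
    rintro f A ⟨hf, hA, _, h⟩
    refine .of (code_coe 8 hf.toOmega 0) ?_ rfl h.iter
    exact (congrArg _ oNat_coe).trans (code_coe 2 hA.toOmega (cd 1 0 0))

/-- `f` and `g` have the same values. -/
def SameEv (f g : Omega M) : Prop := ∀ a b, EvPR f a b ↔ EvPR g a b

namespace Omega

/-- The code of `(id, 0) : A → A × ℕ`. -/
noncomputable def cdAtZero (A : Omega M) : Omega M := cd 7 (cd 2 A 0) (cd 3 (cd 0 0 0) (cd 4 A 0))

/-- The code of `A × s`. -/
noncomputable def cdAtSucc (A : Omega M) : Omega M :=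
  cd 7 (cd 3 (cd 2 A 0) (cd 5 A (cd 1 0 0))) (cd 3 (cd 1 0 0) (cd 6 A (cd 1 0 0)))

/-- The code of `f × ℕ`. -/
noncomputable def cdTimesNat (A f : Omega M) : Omega M :=
  cd 7 (cd 3 f (cd 5 A (cd 1 0 0))) (cd 3 (cd 2 (cd 1 0 0) 0) (cd 6 A (cd 1 0 0)))

end Omega

open FramedPR.Omega

theorem pAtZero_coe (A : Omega M) : pAtZero (A : M) = cdAtZero A := by
  have h0 : (empty : M) = (0 : Omega M) := rfl
  simp only [pAtZero, pPair, pId, pComp, pZero, pTerm, h0, code_coe, cdAtZero]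

theorem pAtSucc_coe (A : Omega M) : pAtSucc (A : M) = cdAtSucc A := by
  have h0 : (empty : M) = (0 : Omega M) := rfl
  simp only [pAtSucc, pPair, pId, pComp, pSucc, pFst, pSnd, oNat, h0, code_coe, cdAtSucc]

theorem pTimesNat_coe (A f : Omega M) : pTimesNat (A : M) (f : M) = cdTimesNat A f := by
  have h0 : (empty : M) = (0 : Omega M) := rfl
  simp only [pTimesNat, pPair, pId, pComp, pFst, pSnd, oNat, h0, code_coe, cdTimesNat]

theorem evPR_atZero (A a b : Omega M) : EvPR (cdAtZero A) a b ↔ El A a ∧ b = .pair a 0 := by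
  simp only [cdAtZero, evPR_pair, evPR_id, evPR_comp, evPR_term, evPR_zero]
  constructor
  · rintro ⟨_, _, rfl, ⟨h, rfl⟩, _, -, -, rfl⟩
    exact ⟨h, rfl⟩
  · rintro ⟨h, rfl⟩
    exact ⟨a, 0, rfl, ⟨h, rfl⟩, 0, ⟨h, rfl⟩, rfl, rfl⟩

theorem evPR_atSucc (A a n b : Omega M) :
    EvPR (cdAtSucc A) (.pair a n) b ↔ El A a ∧ b = .pair a n.succ := by
  simp only [cdAtSucc, evPR_pair, evPR_id, evPR_comp, evPR_fst, evPR_snd, evPR_succ, pair_inj]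
  constructor
  · rintro ⟨_, _, rfl, ⟨_, ⟨_, ⟨rfl, rfl⟩, -, -⟩, h, rfl⟩, _, ⟨_, ⟨rfl, rfl⟩, -, -⟩, rfl⟩
    exact ⟨h, rfl⟩
  · rintro ⟨h, rfl⟩
    exact ⟨a, n.succ, rfl, ⟨a, ⟨n, ⟨rfl, rfl⟩, h, el_nat n⟩, h, rfl⟩, n,
      ⟨a, ⟨rfl, rfl⟩, h, el_nat n⟩, rfl⟩

theorem evPR_timesNat (A f a n b : Omega M) :
    EvPR (cdTimesNat A f) (.pair a n) b ↔ El A a ∧ ∃ c, EvPR f a c ∧ b = .pair c n := by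
  simp only [cdTimesNat, evPR_pair, evPR_id, evPR_comp, evPR_fst, evPR_snd, pair_inj]
  constructor
  · rintro ⟨c, _, rfl, ⟨_, ⟨_, ⟨rfl, rfl⟩, h, -⟩, h'⟩, _, ⟨_, ⟨rfl, rfl⟩, -, -⟩, -, rfl⟩
    exact ⟨h, c, h', rfl⟩
  · rintro ⟨h, c, h', rfl⟩
    exact ⟨c, n, rfl, ⟨a, ⟨n, ⟨rfl, rfl⟩, h, el_nat n⟩, h'⟩, n,
      ⟨a, ⟨rfl, rfl⟩, h, el_nat n⟩, el_nat n, rfl⟩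

namespace SameEv

variable {f f' g g' h A B C : Omega M}

theorem refl (f : Omega M) : SameEv f f := fun _ _ => Iff.rfl

theorem symm (h : SameEv f g) : SameEv g f := fun a b => (h a b).symm

theorem trans (h : SameEv f g) (h' : SameEv g f') : SameEv f f' :=
  fun a b => (h a b).trans (h' a b)

theorem assoc (f g h : Omega M) : SameEv (cd 3 h (cd 3 g f)) (cd 3 (cd 3 h g) f) := fun a b => by
  simp only [evPR_comp]
  exact ⟨fun ⟨d, ⟨c, h1, h2⟩, h3⟩ => ⟨c, h1, d, h2, h3⟩,
    fun ⟨c, h1, d, h2, h3⟩ => ⟨d, ⟨c, h1, h2⟩, h3⟩⟩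

theorem idLeft (hf : Typed f A B) : SameEv (cd 3 (cd 2 B 0) f) f := fun a b => by
  simp only [evPR_comp, evPR_id]
  exact ⟨fun ⟨c, h1, _, h2⟩ => h2 ▸ h1, fun h => ⟨b, h, hf.cod h, rfl⟩⟩

theorem idRight (hf : Typed f A B) : SameEv (cd 3 f (cd 2 A 0)) f := fun a b => by
  simp only [evPR_comp, evPR_id]
  exact ⟨fun ⟨c, ⟨_, h1⟩, h2⟩ => h1 ▸ h2, fun h => ⟨a, ⟨hf.dom _ _ h, rfl⟩, h⟩⟩

theorem comp (h : SameEv f f') (h' : SameEv g g') : SameEv (cd 3 g f) (cd 3 g' f') := fun a b => by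
  simp only [evPR_comp, h _ _, h' _ _]

theorem pair (h : SameEv f f') (h' : SameEv g g') : SameEv (cd 7 f g) (cd 7 f' g') := fun a b => by
  simp only [evPR_pair, h _ _, h' _ _]

theorem termUnique (hf : Typed f A (cd 0 0 0)) : SameEv f (cd 4 A 0) := fun a b => by
  rw [evPR_term]
  refine ⟨fun h => ⟨hf.dom _ _ h, by simpa using hf.cod h⟩, ?_⟩
  rintro ⟨ha, rfl⟩
  obtain ⟨b, hb, h⟩ := hf.total a ha
  rw [h]
  simpa [eq_comm] using hb

/-- Evaluation is a partial relation, so totality of `g` enters: the pair is defined only where both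
components are. -/
theorem godementFst (hf : Typed f C A) (hg : Typed g C B) :
    SameEv (cd 3 (cd 5 A B) (cd 7 f g)) f := fun a b => by
  simp only [evPR_comp, evPR_fst, evPR_pair]
  constructor
  · rintro ⟨_, ⟨_, _, rfl, h, -⟩, _, h', -, -⟩
    rwa [← (pair_inj.1 h').1]
  · intro h
    obtain ⟨c, hc⟩ := hg.exists_value (hf.dom _ _ h)
    exact ⟨_, ⟨b, c, rfl, h, hc⟩, c, rfl, hf.cod h, hg.cod hc⟩

theorem godementSnd (hf : Typed f C A) (hg : Typed g C B) :
    SameEv (cd 3 (cd 6 A B) (cd 7 f g)) g := fun a b => by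
  simp only [evPR_comp, evPR_snd, evPR_pair]
  constructor
  · rintro ⟨_, ⟨_, _, rfl, -, h⟩, _, h', -, -⟩
    rwa [← (pair_inj.1 h').2]
  · intro h
    obtain ⟨c, hc⟩ := hf.exists_value (hg.dom _ _ h)
    exact ⟨_, ⟨c, b, rfl, hc, h⟩, c, rfl, hf.cod hc, hg.cod h⟩

theorem surjPair (hh : Typed h C (cd 2 A B)) :
    SameEv (cd 7 (cd 3 (cd 5 A B) h) (cd 3 (cd 6 A B) h)) h := fun a b => by
  simp only [evPR_comp, evPR_fst, evPR_snd, evPR_pair]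
  constructor
  · rintro ⟨x, y, rfl, ⟨_, h1, y', rfl, -, -⟩, _, h2, x', rfl, -, -⟩
    obtain ⟨rfl, rfl⟩ := pair_inj.1 (hh.unique h1 h2)
    exact h1
  · intro h
    obtain ⟨x, y, rfl, hx, hy⟩ := (el_prod ..).1 (hh.cod h)
    exact ⟨x, y, rfl, ⟨_, h, y, rfl, hx, hy⟩, _, h, x, rfl, hx, hy⟩

theorem distr (hh : Typed h A B) (f g : Omega M) :
    SameEv (cd 3 (cd 7 f g) h) (cd 7 (cd 3 f h) (cd 3 g h)) := fun a b => by
  simp only [evPR_comp, evPR_pair]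
  constructor
  · rintro ⟨c, h1, x, y, rfl, h2, h3⟩
    exact ⟨x, y, rfl, ⟨c, h1, h2⟩, c, h1, h3⟩
  · rintro ⟨x, y, rfl, ⟨c, h1, h2⟩, c', h1', h3⟩
    -- The two components evaluate `h` separately; single-valuedness identifies the intermediate
    -- values.
    obtain rfl := hh.unique h1 h1'
    exact ⟨c, h1, x, y, rfl, h2, h3⟩

theorem anchor (hf : Typed f A A) : SameEv (cd 3 (cd 8 f 0) (cdAtZero A)) (cd 2 A 0) := fun a b => by
  simp only [evPR_comp, evPR_atZero, evPR_id]
  constructor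
  · rintro ⟨_, ⟨ha, rfl⟩, h⟩
    exact ⟨ha, ((evPR_iter_zero ..).1 h).1⟩
  · rintro ⟨ha, rfl⟩
    exact ⟨_, ⟨ha, rfl⟩, (evPR_iter_zero ..).2 ⟨rfl, hf.exists_value ha⟩⟩

theorem step (hf : Typed f A A) :
    SameEv (cd 3 (cd 8 f 0) (cdAtSucc A)) (cd 3 f (cd 8 f 0)) := fun k b => by
  obtain ⟨a, n, rfl⟩ := k.exists_pair
  simp only [evPR_comp, evPR_atSucc]
  constructor
  · rintro ⟨_, ⟨-, rfl⟩, h⟩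
    exact (evPR_iter_succ ..).1 h
  · rintro ⟨c, h, h'⟩
    exact ⟨_, ⟨hf.iter_dom _ _ _ h, rfl⟩, (evPR_iter_succ ..).2 ⟨c, h, h'⟩⟩

/-- If `f` sends `a` to `c`, then `h(a, ·)` and the iteration of `g` from `c` both start at `c` and
both advance by `g`. Induction on the counter inside `M` shows that they agree. -/
theorem freyd (hf : Typed f A B) (hg : Typed g B B) (hh : Typed h (cd 2 A (cd 1 0 0)) B)
    (h0 : SameEv (cd 3 h (cdAtZero A)) f) (h1 : SameEv (cd 3 h (cdAtSucc A)) (cd 3 g h)) :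
    SameEv h (cd 3 (cd 8 g 0) (cdTimesNat A f)) := by
  have e0 : ∀ a b, El A a → (EvPR h (.pair a 0) b ↔ EvPR f a b) := fun a b ha => by
    rw [← h0 a b, evPR_comp]
    simp [evPR_atZero, ha]
  have e1 : ∀ a n b, El A a →
      (EvPR h (.pair a n.succ) b ↔ ∃ c, EvPR h (.pair a n) c ∧ EvPR g c b) := fun a n b ha => by
    rw [← evPR_comp, ← h1 _ b, evPR_comp]
    simp [evPR_atSucc, ha]
  have key : ∀ n a c b, El A a → EvPR f a c →
      (EvPR h (.pair a n) b ↔ EvPR (cd 8 g 0) (.pair c n) b) := by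
    intro n
    induction n using Omega.induction with
    | hP =>
      have hR₂ := el_dfn (M := M)
      have hR₃ := evPR_dfn (M := M)
      exact Dfn.auto
    | zero =>
      intro a c b ha hc
      rw [e0 a b ha, evPR_iter_zero]
      exact ⟨fun hb => ⟨hf.unique hb hc, hg.exists_value (hf.cod hc)⟩, fun hb => hb.1 ▸ hc⟩
    | succ n ih =>
      intro a c b ha hc
      rw [e1 a n b ha, evPR_iter_succ]
      simp only [ih a c _ ha hc]
  intro k b
  obtain ⟨a, n, rfl⟩ := k.exists_pair
  simp only [evPR_comp, evPR_timesNat]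
  constructor
  · intro h
    have ha : El A a := ((el_prod_pair ..).1 (hh.dom _ _ h)).1
    obtain ⟨c, hc⟩ := hf.exists_value ha
    exact ⟨_, ⟨ha, c, hc, rfl⟩, (key n a c b ha hc).1 h⟩
  · rintro ⟨_, ⟨ha, c, hc, rfl⟩, h⟩
    exact (key n a c b ha hc).2 h

end SameEv

theorem sameEv_dfn : Dfn M fun p : Omega M × Omega M => SameEv p.1 p.2 := by
  have hR₃ := evPR_dfn (M := M)
  unfold SameEv
  exact Dfn.auto

/-- Induction over all deduction trees of `M`, standard or not. The invariant compares graphs of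
partial functions and mentions neither the tree nor the types; the types needed by single rules come
from their typing premises through `lift3_typed`. -/
theorem lift2_sameEv {k f g : M} (h : PRDed k f g) : Lift3 (fun _ => SameEv) k f g := by
  refine least3_induction (R := fun _ f g => SameEv f g) ?_ ?_ h
  · have hR₂ := sameEv_dfn (M := M)
    exact Dfn.auto
  constructor
  case refl =>
    rintro f A B hf
    exact .of (code_coe 0 hf.1.toOmega 0) rfl rfl (.refl hf.1.toOmega)
  case symm =>
    rintro i f g ⟨hi, hf, hg, h⟩
    exact .of (code_coe 1 hi.toOmega 0) rfl rfl h.symm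
  case trans =>
    rintro i j f g h ⟨hi, hf, hg, h1⟩ ⟨hj, _, hh, h2⟩
    exact .of (code_coe 2 hi.toOmega hj.toOmega) rfl rfl (h1.trans h2)
  case assoc =>
    rintro f g h A B C D ⟨hf, -⟩ ⟨hg, -⟩ ⟨hh, -⟩
    have e1 := code_coe 3 hg.toOmega hf.toOmega
    have e2 := code_coe 3 hh.toOmega hg.toOmega
    refine .of ((congrArg _ (cp_coe hg.toOmega hf.toOmega)).trans (code_coe 3 hh.toOmega _))
      ((congrArg _ e1).trans (code_coe 3 hh.toOmega _))
      ((congrArg (pComp · f) e2).trans (code_coe 3 _ hf.toOmega)) (.assoc _ _ _)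
  case idLeft =>
    rintro f A B hf
    obtain ⟨hf, hA, hB, h⟩ := lift3_typed hf
    exact .of (code_coe 4 hf.toOmega 0) ((congrArg (pComp · f) (code_coe 2 hB.toOmega 0)).trans
      (code_coe 3 _ hf.toOmega)) rfl (.idLeft h)
  case idRight =>
    rintro f A B hf
    obtain ⟨hf, hA, hB, h⟩ := lift3_typed hf
    exact .of (code_coe 5 hf.toOmega 0) ((congrArg _ (code_coe 2 hA.toOmega 0)).trans
      (code_coe 3 hf.toOmega _)) rfl (.idRight h)
  case compFst =>
    rintro i f f' g A B C - - ⟨hg, -⟩ ⟨hi, hf, hf', h⟩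
    exact .of (code_coe 6 hi.toOmega hg.toOmega) (code_coe 3 hg.toOmega hf.toOmega)
      (code_coe 3 hg.toOmega hf'.toOmega) (h.comp (.refl _))
  case compSnd =>
    rintro i f g g' A B C ⟨hf, -⟩ - - ⟨hi, hg, hg', h⟩
    exact .of (code_coe 7 hi.toOmega hf.toOmega) (code_coe 3 hg.toOmega hf.toOmega)
      (code_coe 3 hg'.toOmega hf.toOmega) (.comp (.refl _) h)
  case termUnique =>
    rintro f A hf
    obtain ⟨hf, hA, h1, h⟩ := lift3_typed hf
    have e : h1.toOmega = cd 0 0 0 := Subtype.ext (code_coe 0 0 0)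
    rw [e] at h
    exact .of (code_coe 8 hf.toOmega 0) rfl (code_coe 4 hA.toOmega 0) (.termUnique h)
  case pairCongr =>
    rintro i j f f' g g' A B C - - - - ⟨hi, hf, hf', h⟩ ⟨hj, hg, hg', h'⟩
    exact .of (code_coe 9 hi.toOmega hj.toOmega) (code_coe 7 hf.toOmega hg.toOmega)
      (code_coe 7 hf'.toOmega hg'.toOmega) (h.pair h')
  case godementFst =>
    rintro f g A B C hf hg
    obtain ⟨hf, hC, hA, h⟩ := lift3_typed hf
    obtain ⟨hg, _, hB, h'⟩ := lift3_typed hg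
    exact .of (code_coe 10 hf.toOmega hg.toOmega)
      ((congrArg₂ pComp (code_coe 5 hA.toOmega hB.toOmega)
        (code_coe 7 hf.toOmega hg.toOmega)).trans (code_coe 3 _ _)) rfl (.godementFst h h')
  case godementSnd =>
    rintro f g A B C hf hg
    obtain ⟨hf, hC, hA, h⟩ := lift3_typed hf
    obtain ⟨hg, _, hB, h'⟩ := lift3_typed hg
    exact .of (code_coe 11 hf.toOmega hg.toOmega)
      ((congrArg₂ pComp (code_coe 6 hA.toOmega hB.toOmega)
        (code_coe 7 hf.toOmega hg.toOmega)).trans (code_coe 3 _ _)) rfl (.godementSnd h h')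
  case surjPair =>
    rintro h A B C hh
    obtain ⟨hh, hC, hP, h⟩ := lift3_typed hh
    -- `A` and `B` need not be numbers, but `cp A B` is one and splits as the Cantor pair of some
    -- `a`, `b`. Every code with entries `A`, `B` then equals the code with the same tag and entries
    -- `a`, `b`.
    obtain ⟨p, hp⟩ := (isNat_cp_of_code hP).exists_coe
    obtain ⟨a, b, rfl⟩ := p.exists_pair
    have e (t : ℕ) : code t A B = (cd t a b : Omega M) := by
      rw [code, tri, ← hp, num_eq_coe, cp_coe]; rfl
    have eP : hP.toOmega = cd 2 a b := Subtype.ext (e 2)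
    rw [eP] at h
    exact .of (code_coe 12 hh.toOmega 0)
      ((congrArg₂ pPair ((congrArg (pComp · _) (e 5)).trans (code_coe 3 _ hh.toOmega))
        ((congrArg (pComp · _) (e 6)).trans (code_coe 3 _ hh.toOmega))).trans (code_coe 7 _ _))
      rfl (.surjPair h)
  case distr =>
    rintro h f g A B C D hh ⟨hf, -⟩ ⟨hg, -⟩
    obtain ⟨hh, hD, hC, h⟩ := lift3_typed hh
    exact .of ((congrArg _ (cp_coe hf.toOmega hg.toOmega)).trans (code_coe 13 hh.toOmega _))
      ((congrArg (pComp · _) (code_coe 7 hf.toOmega hg.toOmega)).trans (code_coe 3 _ hh.toOmega))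
      ((congrArg₂ pPair (code_coe 3 hf.toOmega hh.toOmega)
        (code_coe 3 hg.toOmega hh.toOmega)).trans (code_coe 7 _ _)) (.distr h _ _)
  case anchor =>
    rintro f A hf
    obtain ⟨hf, hA, _, h⟩ := lift3_typed hf
    exact .of (code_coe 14 hf.toOmega 0)
      ((congrArg₂ pComp (code_coe 8 hf.toOmega 0) (pAtZero_coe hA.toOmega)).trans (code_coe 3 _ _))
      (code_coe 2 hA.toOmega 0) (.anchor h)
  case step =>
    rintro f A hf
    obtain ⟨hf, hA, _, h⟩ := lift3_typed hf
    exact .of (code_coe 15 hf.toOmega 0)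
      ((congrArg₂ pComp (code_coe 8 hf.toOmega 0) (pAtSucc_coe hA.toOmega)).trans (code_coe 3 _ _))
      ((congrArg _ (code_coe 8 hf.toOmega 0)).trans (code_coe 3 hf.toOmega _)) (.step h)
  case freyd =>
    rintro i j f g h A B hf hg hh ⟨hi, h1, _, e⟩ ⟨hj, h2, h3, e'⟩
    obtain ⟨hf, hA, hB, tf⟩ := lift3_typed hf
    obtain ⟨hg, _, _, tg⟩ := lift3_typed hg
    obtain ⟨hh, hP, _, th⟩ := lift3_typed hh
    have eP : hP.toOmega = cd 2 hA.toOmega (cd 1 0 0) :=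
      Subtype.ext ((congrArg _ oNat_coe).trans (code_coe 2 hA.toOmega _))
    have e1 : h1.toOmega = cd 3 hh.toOmega (cdAtZero hA.toOmega) :=
      Subtype.ext ((congrArg _ (pAtZero_coe hA.toOmega)).trans (code_coe 3 hh.toOmega _))
    have e2 : h2.toOmega = cd 3 hh.toOmega (cdAtSucc hA.toOmega) :=
      Subtype.ext ((congrArg _ (pAtSucc_coe hA.toOmega)).trans (code_coe 3 hh.toOmega _))
    have e3 : h3.toOmega = cd 3 hg.toOmega hh.toOmega :=
      Subtype.ext (code_coe 3 hg.toOmega hh.toOmega)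
    rw [eP] at th
    rw [e1] at e
    rw [e2, e3] at e'
    exact .of (code_coe 16 hi.toOmega hj.toOmega) rfl
      ((congrArg₂ pComp (code_coe 8 hg.toOmega 0) (pTimesNat_coe hA.toOmega hf.toOmega)).trans
        (code_coe 3 _ _)) (.freyd tf tg th e e')

end
section

variable {M : Type w} [setLang.Structure M] [Nonempty M] [ZModel M]

open FramedPR.Omega (cd)

/-! ## Evaluation of quoted maps of PR -/

/-- The code of an object of PR. -/
noncomputable def Ob.cd : Ob → Omega M
  | Ob.one => Omega.cd 0 0 0
  | Ob.nat => Omega.cd 1 0 0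
  | Ob.prod A B => Omega.cd 2 A.cd B.cd

/-- The code of a map term of PR. -/
noncomputable def PR.cd : {A B : Ob} → PR A B → Omega M
  | _, _, PR.zero => Omega.cd 0 0 0
  | _, _, PR.succ => Omega.cd 1 0 0
  | _, _, PR.id A => Omega.cd 2 A.cd 0
  | _, _, PR.comp g f => Omega.cd 3 g.cd f.cd
  | _, _, PR.term A => Omega.cd 4 A.cd 0
  | _, _, PR.fst A B => Omega.cd 5 A.cd B.cd
  | _, _, PR.snd A B => Omega.cd 6 A.cd B.cd
  | _, _, PR.pair f g => Omega.cd 7 f.cd g.cd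
  | _, _, PR.iter f => Omega.cd 8 f.cd 0

theorem Ob.quote_coe (A : Ob) : (A.quote : M) = (A.cd : Omega M) := by
  induction A with
  | one => exact code_coe 0 0 0
  | nat => exact code_coe 1 0 0
  | prod A B hA hB => rw [Ob.quote, hA, hB]; exact code_coe 2 A.cd B.cd

theorem PR.quote_coe {A B : Ob} (f : PR A B) : (f.quote : M) = (f.cd : Omega M) := by
  induction f with
  | zero => exact code_coe 0 0 0
  | succ => exact code_coe 1 0 0
  | id A => rw [PR.quote, A.quote_coe]; exact code_coe 2 A.cd 0
  | comp g f hg hf => rw [PR.quote, hg, hf]; exact code_coe 3 g.cd f.cd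
  | term A => rw [PR.quote, A.quote_coe]; exact code_coe 4 A.cd 0
  | fst A B => rw [PR.quote, A.quote_coe, B.quote_coe]; exact code_coe 5 A.cd B.cd
  | snd A B => rw [PR.quote, A.quote_coe, B.quote_coe]; exact code_coe 6 A.cd B.cd
  | pair f g hf hg => rw [PR.quote, hf, hg]; exact code_coe 7 f.cd g.cd
  | iter f hf => rw [PR.quote, hf]; exact code_coe 8 f.cd 0

/-- The code of an element of an object of PR. -/
noncomputable def Ob.cod : (A : Ob) → A.Sem M → Omega M
  | Ob.one, _ => 0
  | Ob.nat, n => n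
  | Ob.prod A B, p => .pair (A.cod (Ob.left p)) (B.cod (Ob.right p))

theorem Ob.cod_dfn (A : Ob) : DfnF M (A.cod (M := M)) := by
  induction A with
  | one => exact DfnF.const (X := PUnit) (0 : Omega M)
  | nat => exact DfnF.id (X := Omega M)
  | prod A B hA hB =>
    exact .pairing (hA.comp (Ob.left_dfn .id)) (hB.comp (Ob.right_dfn .id))

theorem el_cod (A : Ob) (a : A.Sem M) : El A.cd (A.cod a) := by
  induction A with
  | one => simp [Ob.cd, Ob.cod]
  | nat => simp [Ob.cd]
  | prod A B hA hB => simp [Ob.cd, Ob.cod, hA, hB]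

theorem typed_cd {A B : Ob} (f : PR A B) : Typed (f.cd : Omega M) A.cd B.cd := by
  induction f with
  | zero => exact .zero
  | succ => exact .succ
  | id A => exact .id _
  | comp g f hg hf => exact hf.comp hg
  | term A => exact .term _
  | fst A B => exact .fst _ _
  | snd A B => exact .snd _ _
  | pair f g hf hg => exact hf.pair hg
  | iter f hf => exact hf.iter

/-- External induction on the map term; the case of iteration needs an internal induction besides,
because the counter is a number of `M`. -/
theorem evPR_cd_den {A B : Ob} (f : PR A B) (a : A.Sem M) :
    EvPR f.cd (A.cod a) (B.cod (f.den a)) := by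
  induction f with
  | zero => simp [PR.cd, Ob.cod]
  | succ => simp [PR.cd, Ob.cod]
  | id A => simp [PR.cd, el_cod]
  | comp g f hg hf => exact (evPR_comp ..).2 ⟨_, hf a, hg _⟩
  | term A => simp [PR.cd, Ob.cod, el_cod]
  | fst A B => simp [PR.cd, Ob.cod, el_cod]
  | snd A B => simp [PR.cd, Ob.cod, el_cod]
  | pair f g hf hg => exact (evPR_pair ..).2 ⟨_, _, rfl, hf a, hg a⟩
  | @iter A f hf =>
    obtain ⟨x, n, rfl⟩ : ∃ (x : A.Sem M) (n : Omega M), a = Ob.mk (B := Ob.nat) x n := ⟨a.1, a.2, rfl⟩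
    change EvPR (cd 8 f.cd 0) (.pair (A.cod x) n) _
    induction n using Omega.induction with
    | hP =>
      have hR₃ := evPR_dfn (M := M)
      have hg₁ := A.cod_dfn (M := M)
      exact Dfn.auto
    | zero =>
      rw [PR.den_iter_zero]
      exact (evPR_iter_zero ..).2 ⟨rfl, _, hf x⟩
    | succ n ih =>
      rw [PR.den_iter_succ]
      exact (evPR_iter_succ ..).2 ⟨_, ih, hf _⟩

theorem evPR_cd {A B : Ob} (f : PR A B) (a : A.Sem M) (b : Omega M) :
    EvPR f.cd (A.cod a) b ↔ b = B.cod (f.den a) :=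
  ⟨fun h => (typed_cd f).unique h (evPR_cd_den f a), fun h => h ▸ evPR_cd_den f a⟩

theorem evPR_cd_nat (f : PR Ob.nat Ob.nat) (a b : Omega M) : EvPR f.cd a b ↔ b = f.den a :=
  evPR_cd (A := Ob.nat) (B := Ob.nat) f a b

theorem evPR_cd_nn (f : PR (Ob.prod Ob.nat Ob.nat) Ob.nat) (a b c : Omega M) :
    EvPR f.cd (.pair a b) c ↔ c = f.den (PR.nn a b) :=
  evPR_cd (B := Ob.nat) f (PR.nn a b) c

/-! ## The basic maps of PRX on numerals and pairs -/

namespace Omega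

/-- The numeral `ν n`. -/
noncomputable def xn (n : Omega M) : Omega M := (pair 0 n).succ

/-- The pair `⟨a + 1; b + 1⟩` of elements of the universal set. -/
noncomputable def xp (a b : Omega M) : Omega M := (pair a.succ b).succ

@[simp] theorem xn_ne_zero (n : Omega M) : xn n ≠ 0 := succ_ne_zero _

@[simp] theorem xp_ne_xn (a b n : Omega M) : xp a b ≠ xn n := by simp [xp, xn, succ_inj]

theorem xn_zero : xn (0 : Omega M) = (0 : Omega M).succ := by simp [xn]

/-- The pair `⟨a + 1; ν n⟩`. -/
noncomputable def xpn (a n : Omega M) : Omega M := xp a (pair 0 n)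

/-- Zero is the waste symbol. For a successor the first Cantor coordinate decides: it is zero for
numerals and positive for pairs. -/
theorem zero_or_xn_or_xp (x : Omega M) : x = 0 ∨ (∃ n, x = xn n) ∨ ∃ a b, x = xp a b := by
  obtain rfl | ⟨k, rfl⟩ := x.eq_zero_or_succ
  · exact Or.inl rfl
  obtain ⟨a, b, rfl⟩ := k.exists_pair
  obtain rfl | ⟨a, rfl⟩ := a.eq_zero_or_succ
  exacts [Or.inr (Or.inl ⟨b, rfl⟩), Or.inr (Or.inr ⟨a, b, rfl⟩)]

end Omega

open FramedPR.Omega (xn xp xpn)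

namespace PR

variable (a b n x : Omega M)

@[simp] theorem den_xzero_zero : xzero.den (0 : Omega M) = (0 : Omega M) := by simp [xzero]
@[simp] theorem den_xzero_xn_zero : xzero.den (xn (0 : Omega M)) = xn (0 : Omega M) := by
  simp [xzero, Omega.xn_zero]
theorem den_xzero_of_ne (h : x ≠ xn 0) : xzero.den x = (0 : Omega M) := by
  obtain rfl | ⟨x, rfl⟩ := x.eq_zero_or_succ
  · simp
  obtain rfl | ⟨x, rfl⟩ := x.eq_zero_or_succ
  · exact absurd Omega.xn_zero.symm h
  · simp [xzero]
@[simp] theorem den_xsucc_zero : xsucc.den (0 : Omega M) = (0 : Omega M) := by simp [xsucc]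
@[simp] theorem den_xsucc_xn : xsucc.den (xn n) = xn n.succ := by simp [xsucc, xn, den_cpair]
@[simp] theorem den_xsucc_xp : xsucc.den (xp a b) = (0 : Omega M) := by simp [xsucc, xp]
@[simp] theorem den_xterm_zero : xterm.den (0 : Omega M) = (0 : Omega M) := by simp [xterm]
@[simp] theorem den_xterm_succ : xterm.den a.succ = xn (0 : Omega M) := by
  simp [xterm, Omega.xn_zero]
@[simp] theorem den_xpair_zero_right : xpair.den (nn a 0) = (0 : Omega M) := by simp [xpair]
@[simp] theorem den_xpair_zero_left : xpair.den (nn 0 b) = (0 : Omega M) := by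
  obtain rfl | ⟨b, rfl⟩ := b.eq_zero_or_succ <;> simp [xpair]
@[simp] theorem den_xpair_succ : xpair.den (nn a.succ b.succ) = xp a b := by
  simp [xpair, xp, den_cpair]
@[simp] theorem den_xfst_zero : xfst.den (0 : Omega M) = (0 : Omega M) := by simp [xfst]
@[simp] theorem den_xfst_xn : xfst.den (xn n) = (0 : Omega M) := by simp [xfst, xn]
@[simp] theorem den_xfst_xp : xfst.den (xp a b) = a.succ := by simp [xfst, xp]
@[simp] theorem den_xsnd_zero : xsnd.den (0 : Omega M) = (0 : Omega M) := by simp [xsnd]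
@[simp] theorem den_xsnd_xn : xsnd.den (xn n) = (0 : Omega M) := by simp [xsnd, xn]
@[simp] theorem den_xsnd_xp : xsnd.den (xp a b) = b.succ := by simp [xsnd, xp]
@[simp] theorem den_xnum_zero : xnum.den (0 : Omega M) = (0 : Omega M) := by simp [xnum]
@[simp] theorem den_xnum_xn : xnum.den (xn n) = n := by simp [xnum, xn]
@[simp] theorem den_xguard_zero : xguard.den (nn a 0) = (0 : Omega M) := by simp [xguard]
@[simp] theorem den_xguard_xn : xguard.den (nn a (xn n)) = a := by simp [xguard, xn]
@[simp] theorem den_xguard_xp : xguard.den (nn n (xp a b)) = (0 : Omega M) := by simp [xguard, xp]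
@[simp] theorem den_xfst_xpn : xfst.den (xpn a n) = a.succ := den_xfst_xp ..
@[simp] theorem den_xsnd_xpn : xsnd.den (xpn a n) = xn n := den_xsnd_xp ..

end PR

end
section

variable {M : Type w} [setLang.Structure M] [Nonempty M] [ZModel M]

open FramedPR.Omega (cd xn xp)

/-! ## The translation of codes of PRX into codes of PR -/

/-- The clauses of `Transl`. -/
def TranslOp (R : Omega M × Omega M → Prop) (t : Omega M × Omega M) : Prop :=
  (t.1 = cd 0 0 0 ∧ t.2 = PRX.zero.toPR.cd) ∨
  (t.1 = cd 1 0 0 ∧ t.2 = PRX.succ.toPR.cd) ∨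
  (t.1 = cd 2 0 0 ∧ t.2 = PRX.id.toPR.cd) ∨
  (t.1 = cd 3 0 0 ∧ t.2 = PRX.term.toPR.cd) ∨
  (t.1 = cd 4 0 0 ∧ t.2 = PRX.diag.toPR.cd) ∨
  (t.1 = cd 5 0 0 ∧ t.2 = PRX.fst.toPR.cd) ∨
  (t.1 = cd 6 0 0 ∧ t.2 = PRX.snd.toPR.cd) ∨
  (∃ u v p q, t.1 = cd 7 v u ∧ t.2 = cd 3 q p ∧ R (u, p) ∧ R (v, q)) ∨
  (∃ u v p q, t.1 = cd 8 u v ∧ t.2 = cd 3 PR.xpair.cd (cd 7 p q) ∧ R (u, p) ∧ R (v, q)) ∨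
  (∃ u v p q, t.1 = cd 9 u v ∧
    t.2 = cd 3 PR.xpair.cd (cd 7 (cd 3 p PR.xfst.cd) (cd 3 q PR.xsnd.cd)) ∧ R (u, p) ∧ R (v, q)) ∨
  (∃ u p, t.1 = cd 10 u 0 ∧
    t.2 = cd 3 PR.xguard.cd (cd 7 (cd 3 (cd 8 p 0) PR.xprep.cd) PR.xsnd.cd) ∧ R (u, p))

/-- The code `u` of PRX denotes the map of PR with code `p`. -/
def Transl (u p : Omega M) : Prop := lfp M TranslOp (u, p)

theorem translOp_dfn : DfnOp M (TranslOp (M := M)) := by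
  unfold DfnOp TranslOp
  exact Dfn.auto

theorem transl_dfn : Dfn M fun t : Omega M × Omega M => Transl t.1 t.2 := lfp_dfn translOp_dfn

theorem translOp_mono (R R' : Omega M × Omega M → Prop) (h : ∀ t, R t → R' t) (t)
    (ht : TranslOp R t) : TranslOp R' t := by
  unfold TranslOp at ht ⊢
  refine ht.imp id (Or.imp id (Or.imp id (Or.imp id (Or.imp id (Or.imp id (Or.imp id
    (Or.imp ?_ (Or.imp ?_ (Or.imp ?_ ?_)))))))))
  · exact fun ⟨u, v, p, q, h1, h2, h3, h4⟩ => ⟨u, v, p, q, h1, h2, h _ h3, h _ h4⟩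
  · exact fun ⟨u, v, p, q, h1, h2, h3, h4⟩ => ⟨u, v, p, q, h1, h2, h _ h3, h _ h4⟩
  · exact fun ⟨u, v, p, q, h1, h2, h3, h4⟩ => ⟨u, v, p, q, h1, h2, h _ h3, h _ h4⟩
  · exact fun ⟨u, p, h1, h2, h3⟩ => ⟨u, p, h1, h2, h _ h3⟩

theorem transl_iff (u p : Omega M) : Transl u p ↔ TranslOp (fun t => Transl t.1 t.2) (u, p) :=
  lfp_iff translOp_dfn translOp_mono _

namespace Transl

variable {p : Omega M} (u v : Omega M)

theorem zero_iff : Transl (cd 0 0 0) p ↔ p = PRX.zero.toPR.cd := by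
  rw [transl_iff]; simp [TranslOp]

theorem succ_iff : Transl (cd 1 0 0) p ↔ p = PRX.succ.toPR.cd := by
  rw [transl_iff]; simp [TranslOp]

theorem id_iff : Transl (cd 2 0 0) p ↔ p = PRX.id.toPR.cd := by
  rw [transl_iff]; simp [TranslOp]

theorem term_iff : Transl (cd 3 0 0) p ↔ p = PRX.term.toPR.cd := by
  rw [transl_iff]; simp [TranslOp]

theorem diag_iff : Transl (cd 4 0 0) p ↔ p = PRX.diag.toPR.cd := by
  rw [transl_iff]; simp [TranslOp]

theorem fst_iff : Transl (cd 5 0 0) p ↔ p = PRX.fst.toPR.cd := by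
  rw [transl_iff]; simp [TranslOp]

theorem snd_iff : Transl (cd 6 0 0) p ↔ p = PRX.snd.toPR.cd := by
  rw [transl_iff]; simp [TranslOp]

theorem comp_iff : Transl (cd 7 v u) p ↔
    ∃ r q, Transl u r ∧ Transl v q ∧ p = cd 3 q r := by
  rw [transl_iff]; simp [TranslOp]; grind

theorem ind_iff : Transl (cd 8 u v) p ↔
    ∃ r q, Transl u r ∧ Transl v q ∧ p = cd 3 PR.xpair.cd (cd 7 r q) := by
  rw [transl_iff]; simp [TranslOp]; grind

theorem prod_iff : Transl (cd 9 u v) p ↔ ∃ r q, Transl u r ∧ Transl v q ∧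
    p = cd 3 PR.xpair.cd (cd 7 (cd 3 r PR.xfst.cd) (cd 3 q PR.xsnd.cd)) := by
  rw [transl_iff]; simp [TranslOp]; grind

theorem iter_iff : Transl (cd 10 u 0) p ↔ ∃ r, Transl u r ∧
    p = cd 3 PR.xguard.cd (cd 7 (cd 3 (cd 8 r 0) PR.xprep.cd) PR.xsnd.cd) := by
  rw [transl_iff]; simp [TranslOp]; grind

end Transl

/-- Only this inclusion is needed, because `EqPRX` already provides the translations of both codes.
-/
theorem ToPR.transl {u p : M} (h : ToPR u p) : Lift2 Transl u p := by
  refine least2_induction transl_dfn ?_ h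
  constructor
  case zero => exact .of (code_coe 0 0 0) (PR.quote_coe _) (Transl.zero_iff.2 rfl)
  case succ => exact .of (code_coe 1 0 0) (PR.quote_coe _) (Transl.succ_iff.2 rfl)
  case id => exact .of (code_coe 2 0 0) (PR.quote_coe _) (Transl.id_iff.2 rfl)
  case term => exact .of (code_coe 3 0 0) (PR.quote_coe _) (Transl.term_iff.2 rfl)
  case diag => exact .of (code_coe 4 0 0) (PR.quote_coe _) (Transl.diag_iff.2 rfl)
  case fst => exact .of (code_coe 5 0 0) (PR.quote_coe _) (Transl.fst_iff.2 rfl)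
  case snd => exact .of (code_coe 6 0 0) (PR.quote_coe _) (Transl.snd_iff.2 rfl)
  case comp =>
    rintro u v p q ⟨hu, hp, h⟩ ⟨hv, hq, h'⟩
    exact .of (code_coe 7 hv.toOmega hu.toOmega) (code_coe 3 hq.toOmega hp.toOmega)
      ((Transl.comp_iff _ _).2 ⟨_, _, h, h', rfl⟩)
  case ind =>
    rintro u v p q ⟨hu, hp, h⟩ ⟨hv, hq, h'⟩
    exact .of (code_coe 8 hu.toOmega hv.toOmega)
      ((congrArg₂ pComp (PR.quote_coe _) (code_coe 7 hp.toOmega hq.toOmega)).trans (code_coe 3 _ _))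
      ((Transl.ind_iff _ _).2 ⟨_, _, h, h', rfl⟩)
  case prod =>
    rintro u v p q ⟨hu, hp, h⟩ ⟨hv, hq, h'⟩
    refine .of (code_coe 9 hu.toOmega hv.toOmega)
      ((congrArg₂ pComp (PR.quote_coe _) ?_).trans (code_coe 3 _ _))
      ((Transl.prod_iff _ _).2 ⟨_, _, h, h', rfl⟩)
    exact (congrArg₂ pPair ((congrArg (pComp p) (PR.quote_coe _)).trans (code_coe 3 hp.toOmega _))
      ((congrArg (pComp q) (PR.quote_coe _)).trans (code_coe 3 hq.toOmega _))).trans (code_coe 7 _ _)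
  case iter =>
    rintro u p ⟨hu, hp, h⟩
    refine .of (code_coe 10 hu.toOmega 0)
      ((congrArg₂ pComp (PR.quote_coe _) ?_).trans (code_coe 3 _ _))
      ((Transl.iter_iff _).2 ⟨_, h, rfl⟩)
    exact (congrArg₂ pPair ((congrArg₂ pComp (code_coe 8 hp.toOmega 0) (PR.quote_coe _)).trans
      (code_coe 3 _ _)) (PR.quote_coe _)).trans (code_coe 7 _ _)

theorem Transl.induction {R : Omega M → Omega M → Prop}
    (hR : Dfn M fun t : Omega M × Omega M => R t.1 t.2)
    (zero : R (cd 0 0 0) PRX.zero.toPR.cd)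
    (succ : R (cd 1 0 0) PRX.succ.toPR.cd)
    (id : R (cd 2 0 0) PRX.id.toPR.cd)
    (term : R (cd 3 0 0) PRX.term.toPR.cd)
    (diag : R (cd 4 0 0) PRX.diag.toPR.cd)
    (fst : R (cd 5 0 0) PRX.fst.toPR.cd)
    (snd : R (cd 6 0 0) PRX.snd.toPR.cd)
    (comp : ∀ u v p q, R u p → R v q → R (cd 7 v u) (cd 3 q p))
    (ind : ∀ u v p q, R u p → R v q → R (cd 8 u v) (cd 3 PR.xpair.cd (cd 7 p q)))
    (prod : ∀ u v p q, R u p → R v q →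
      R (cd 9 u v) (cd 3 PR.xpair.cd (cd 7 (cd 3 p PR.xfst.cd) (cd 3 q PR.xsnd.cd))))
    (iter : ∀ u p, R u p →
      R (cd 10 u 0) (cd 3 PR.xguard.cd (cd 7 (cd 3 (cd 8 p 0) PR.xprep.cd) PR.xsnd.cd)))
    {u p : Omega M} (h : Transl u p) : R u p := by
  refine lfp_induction (R := fun t : Omega M × Omega M => R t.1 t.2) hR ?_ h
  rintro ⟨u, p⟩ h
  simp only [TranslOp] at h
  obtain ⟨rfl, rfl⟩ | ⟨rfl, rfl⟩ | ⟨rfl, rfl⟩ | ⟨rfl, rfl⟩ | ⟨rfl, rfl⟩ | ⟨rfl, rfl⟩ | ⟨rfl, rfl⟩ |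
    ⟨u, v, p, q, rfl, rfl, h, h'⟩ | ⟨u, v, p, q, rfl, rfl, h, h'⟩ | ⟨u, v, p, q, rfl, rfl, h, h'⟩ |
    ⟨u, p, rfl, rfl, h⟩ := h
  exacts [zero, succ, id, term, diag, fst, snd, comp _ _ _ _ h h', ind _ _ _ _ h h',
    prod _ _ _ _ h h', iter _ _ h]

theorem Transl.typed {u p : Omega M} (h : Transl u p) : Typed p (cd 1 0 0) (cd 1 0 0) := by
  have tp : Typed (PR.xpair.cd : Omega M) (cd 2 (cd 1 0 0) (cd 1 0 0)) (cd 1 0 0) := typed_cd PR.xpair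
  have tf : Typed (PR.xfst.cd : Omega M) (cd 1 0 0) (cd 1 0 0) := typed_cd PR.xfst
  have ts : Typed (PR.xsnd.cd : Omega M) (cd 1 0 0) (cd 1 0 0) := typed_cd PR.xsnd
  refine Transl.induction (R := fun _ p => Typed p (cd 1 0 0) (cd 1 0 0)) ?_ (typed_cd _)
    (typed_cd _) (typed_cd _) (typed_cd _) (typed_cd _) (typed_cd _) (typed_cd _)
    (fun _ _ _ _ h h' => h.comp h') (fun _ _ _ _ h h' => (h.pair h').comp tp)
    (fun _ _ _ _ h h' => ((tf.comp h).pair (ts.comp h')).comp tp)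
    (fun _ _ h => (((typed_cd PR.xprep).comp h.iter).pair ts).comp (typed_cd PR.xguard)) h
  have hR₃ := typed_dfn (M := M)
  exact Dfn.auto

theorem in1_dfn (S : M) : Dfn M fun a : Omega M => In1 S a :=
  Dfn.congr (P := fun a : Omega M => (Enc.enc a : M) ∈ₘ S) Dfn.auto fun a => ⟨fun h => h.2, fun h => ⟨a.2, h⟩⟩

/-- `In3` for natural numbers of `M`. -/
def Omega.In3 (S : M) (a b c : Omega M) : Prop := FramedPR.In3 S (a : M) b c

theorem in3_dfn (S : M) :
    Dfn M fun t : Omega M × Omega M × Omega M => Omega.In3 S t.1 t.2.1 t.2.2 :=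
  Dfn.congr (P := fun t : Omega M × Omega M × Omega M =>
    (Enc.enc (Omega.pair t.1 (.pair t.2.1 t.2.2)) : M) ∈ₘ S) Dfn.auto fun t => by
      rw [Omega.In3, In3, tri, cp_coe, cp_coe]
      exact ⟨fun h => h.2.2.2, fun h => ⟨t.1.2, t.2.1.2, t.2.2.2, h⟩⟩

theorem Transl.isPRX {u p : Omega M} (h : Transl u p) : IsPRX (u : M) := by
  refine ⟨u.2, fun S hS => ?_⟩
  have c (t : ℕ) (a b : Omega M) := (code_coe t a b).symm
  refine Transl.induction (R := fun u _ => In1 S (u : M)) ?_ (c 0 0 0 ▸ hS.zero) (c 1 0 0 ▸ hS.succ)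
    (c 2 0 0 ▸ hS.id) (c 3 0 0 ▸ hS.term) (c 4 0 0 ▸ hS.diag) (c 5 0 0 ▸ hS.fst) (c 6 0 0 ▸ hS.snd)
    (fun u v _ _ h h' => c 7 v u ▸ hS.comp _ _ h h') (fun u v _ _ h h' => c 8 u v ▸ hS.ind _ _ h h')
    (fun u v _ _ h h' => c 9 u v ▸ hS.prod _ _ h h') (fun u _ h => c 10 u 0 ▸ hS.iter _ h) h
  have hR₁ := in1_dfn S
  exact Dfn.auto

/-- The quote of an actual term has a known shape, so inverting `Transl` along the term leaves a
single candidate. -/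
theorem PRX.quote_coe (f : PRX) : ∃ u : Omega M, (f.quote : M) = u ∧
    ∀ p, Transl u p → p = f.toPR.cd := by
  induction f with
  | zero => exact ⟨_, code_coe 0 0 0, fun p => Transl.zero_iff.1⟩
  | succ => exact ⟨_, code_coe 1 0 0, fun p => Transl.succ_iff.1⟩
  | id => exact ⟨_, code_coe 2 0 0, fun p => Transl.id_iff.1⟩
  | term => exact ⟨_, code_coe 3 0 0, fun p => Transl.term_iff.1⟩
  | diag => exact ⟨_, code_coe 4 0 0, fun p => Transl.diag_iff.1⟩
  | fst => exact ⟨_, code_coe 5 0 0, fun p => Transl.fst_iff.1⟩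
  | snd => exact ⟨_, code_coe 6 0 0, fun p => Transl.snd_iff.1⟩
  | comp g f hg hf =>
    obtain ⟨v, hv, hg⟩ := hg
    obtain ⟨u, hu, hf⟩ := hf
    refine ⟨_, (congrArg₂ xComp hv hu).trans (code_coe 7 v u), fun p hp => ?_⟩
    obtain ⟨r, q, h, h', rfl⟩ := (Transl.comp_iff _ _).1 hp
    rw [hg _ h', hf _ h]
    rfl
  | ind f g hf hg =>
    obtain ⟨u, hu, hf⟩ := hf
    obtain ⟨v, hv, hg⟩ := hg
    refine ⟨_, (congrArg₂ xInd hu hv).trans (code_coe 8 u v), fun p hp => ?_⟩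
    obtain ⟨r, q, h, h', rfl⟩ := (Transl.ind_iff _ _).1 hp
    rw [hg _ h', hf _ h]
    rfl
  | prod f g hf hg =>
    obtain ⟨u, hu, hf⟩ := hf
    obtain ⟨v, hv, hg⟩ := hg
    refine ⟨_, (congrArg₂ xProd hu hv).trans (code_coe 9 u v), fun p hp => ?_⟩
    obtain ⟨r, q, h, h', rfl⟩ := (Transl.prod_iff _ _).1 hp
    rw [hg _ h', hf _ h]
    rfl
  | iter f hf =>
    obtain ⟨u, hu, hf⟩ := hf
    refine ⟨_, (congrArg xIter hu).trans (code_coe 10 u 0), fun p hp => ?_⟩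
    obtain ⟨r, h, rfl⟩ := (Transl.iter_iff _).1 hp
    rw [hf _ h]
    rfl

theorem ToPR.eq_of_quote {f : PRX} {p : M} (h : ToPR f.quote p) : p = f.toPR.quote := by
  obtain ⟨u, hu, H⟩ := PRX.quote_coe (M := M) f
  rw [hu] at h
  obtain ⟨_, hp, h⟩ := h.transl
  rw [PR.quote_coe, ← H _ h]
  rfl

end
section

variable {M : Type w} [setLang.Structure M] [Nonempty M] [ZModel M]

open FramedPR.Omega (cd xn xp xpn)

/-! ## Evaluation of codes of PRX agrees with evaluation of their translations -/

theorem nu_coe (n : Omega M) : nu (n : M) = xn n := congrArg suc (cp_coe 0 n)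

theorem inX_iff {x : M} : InX x ↔ ∃ a : Omega M, x = a.succ := by
  constructor
  · rintro ⟨h, h'⟩
    obtain ⟨x, rfl⟩ := h.exists_coe
    obtain rfl | ⟨a, rfl⟩ := x.eq_zero_or_succ
    exacts [absurd rfl h', ⟨a, rfl⟩]
  · rintro ⟨a, rfl⟩
    exact ⟨a.succ.2, fun h => suc_ne_empty _ h⟩

theorem isXPair_iff {x y z : M} :
    IsXPair x y z ↔ ∃ a b : Omega M, x = a.succ ∧ y = b.succ ∧ z = xp a b := by
  constructor
  · rintro ⟨hx, -, n, hn, rfl, rfl⟩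
    obtain ⟨a, rfl⟩ := inX_iff.1 hx
    obtain ⟨b, rfl⟩ := hn.exists_coe
    exact ⟨a, b, rfl, rfl, congrArg suc (cp_coe a.succ b)⟩
  · rintro ⟨a, b, rfl, rfl, rfl⟩
    exact ⟨inX_iff.2 ⟨a, rfl⟩, inX_iff.2 ⟨b, rfl⟩, b, b.2, rfl, (congrArg suc (cp_coe a.succ b)).symm⟩

theorem isXPair_xp (a b : Omega M) : IsXPair (a.succ : M) b.succ (xp a b) :=
  isXPair_iff.2 ⟨a, b, rfl, rfl, rfl⟩

theorem exists_isXPair_iff {z : Omega M} : (∃ x y : M, IsXPair x y z) ↔ ∃ a b, z = xp a b := by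
  simp only [isXPair_iff]
  exact ⟨fun ⟨_, _, a, b, _, _, h⟩ => ⟨a, b, Subtype.ext h⟩,
    fun ⟨a, b, h⟩ => ⟨_, _, a, b, rfl, rfl, congrArg _ h⟩⟩

theorem xPairVal_iff {x y : Omega M} {z : M} :
    XPairVal (x : M) y z ↔ z = (PR.xpair.den (PR.nn x y) : Omega M) := by
  rw [XPairVal, isXPair_iff]
  have h0 (x : Omega M) : (x : M) = bot ↔ x = 0 := ⟨fun h => Subtype.ext h, fun h => congrArg _ h⟩
  rw [h0, h0]
  obtain rfl | ⟨a, rfl⟩ := x.eq_zero_or_succ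
  · simp only [true_or, true_and, PR.den_xpair_zero_left]
    refine ⟨?_, Or.inr⟩
    rintro (⟨a, _, h, -⟩ | h)
    exacts [absurd (Subtype.ext h) (Omega.zero_ne_succ a), h]
  obtain rfl | ⟨b, rfl⟩ := y.eq_zero_or_succ
  · simp only [or_true, true_and, PR.den_xpair_zero_right]
    refine ⟨?_, Or.inr⟩
    rintro (⟨_, b, -, h, -⟩ | h)
    exacts [absurd (Subtype.ext h) (Omega.zero_ne_succ b), h]
  · simp only [Omega.succ_ne_zero, or_self, false_and, or_false, PR.den_xpair_succ]
    constructor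
    · rintro ⟨a', b', h1, h2, rfl⟩
      rw [Omega.succ_inj.1 (Subtype.ext h1), Omega.succ_inj.1 (Subtype.ext h2)]
    · rintro rfl
      exact ⟨a, b, rfl, rfl, rfl⟩

section

variable {p q : Omega M}

theorem evPR_xInd (x w : Omega M) : EvPR (cd 3 PR.xpair.cd (cd 7 p q)) x w ↔
    ∃ c d, EvPR p x c ∧ EvPR q x d ∧ w = PR.xpair.den (PR.nn c d) := by
  simp only [evPR_comp, evPR_pair]
  constructor
  · rintro ⟨_, ⟨c, d, rfl, h, h'⟩, hw⟩
    exact ⟨c, d, h, h', (evPR_cd_nn ..).1 hw⟩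
  · rintro ⟨c, d, h, h', hw⟩
    exact ⟨_, ⟨c, d, rfl, h, h'⟩, (evPR_cd_nn ..).2 hw⟩

theorem evPR_xProd (x w : Omega M) :
    EvPR (cd 3 PR.xpair.cd (cd 7 (cd 3 p PR.xfst.cd) (cd 3 q PR.xsnd.cd))) x w ↔
      ∃ c d, EvPR p (PR.xfst.den x) c ∧ EvPR q (PR.xsnd.den x) d ∧
        w = PR.xpair.den (PR.nn c d) :=
  (evPR_xInd ..).trans (by simp only [evPR_comp, evPR_cd_nat, exists_eq_left])

theorem evPR_xIter (x w : Omega M) :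
    EvPR (cd 3 PR.xguard.cd (cd 7 (cd 3 (cd 8 p 0) PR.xprep.cd) PR.xsnd.cd)) x w ↔
      ∃ c, EvPR (cd 8 p 0) (.pair (PR.xfst.den x) (PR.xnum.den (PR.xsnd.den x))) c ∧
        w = PR.xguard.den (PR.nn c (PR.xsnd.den x)) := by
  have hp (y : Omega M) : EvPR PR.xprep.cd x y ↔
      y = .pair (PR.xfst.den x) (PR.xnum.den (PR.xsnd.den x)) :=
    evPR_cd (A := Ob.nat) PR.xprep x y
  simp only [evPR_comp, evPR_pair, hp, exists_eq_left]
  constructor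
  · rintro ⟨_, ⟨c, d, rfl, h, h'⟩, hw⟩
    rw [evPR_cd_nat] at h'
    exact ⟨c, h, by rw [← h']; exact (evPR_cd_nn ..).1 hw⟩
  · rintro ⟨c, h, hw⟩
    exact ⟨_, ⟨c, _, rfl, h, (evPR_cd_nat ..).2 rfl⟩, (evPR_cd_nn ..).2 hw⟩

end

/-- Waste propagates. At an argument that is not a pair, the translated product applies both factors
to waste, and strictness makes the result agree with the trash clause of `Ev`. -/
theorem Transl.strict {u p : Omega M} (h : Transl u p) : EvPR p 0 0 := by
  refine Transl.induction (R := fun _ p => EvPR p 0 0) ?_ ?_ ?_ ?_ ?_ ?_ ?_ ?_ ?_ ?_ ?_ ?_ h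
  · have hR₃ := evPR_dfn (M := M)
    exact Dfn.auto
  all_goals try (rw [evPR_cd_nat]; simp [PRX.toPR])
  · exact fun _ _ _ _ h h' => (evPR_comp ..).2 ⟨_, h, h'⟩
  · exact fun _ _ _ _ h h' => (evPR_xInd ..).2 ⟨_, _, h, h', by simp⟩
  · exact fun _ _ _ _ h h' => (evPR_xProd ..).2 ⟨0, 0, by simpa using h, by simpa using h', by simp⟩
  · exact fun u p h => (evPR_xIter ..).2
      ⟨0, by simpa using (evPR_iter_zero ..).2 ⟨rfl, _, h⟩, by simp⟩

theorem isXPair_nu_iff {x z : M} {n : Omega M} :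
    IsXPair x (nu (n : M)) z ↔ ∃ a : Omega M, x = a.succ ∧ z = xpn a n := by
  rw [isXPair_iff, nu_coe]
  constructor
  · rintro ⟨a, b, rfl, h, rfl⟩
    rw [← Omega.succ_inj.1 (Subtype.ext h)]
    exact ⟨a, rfl, rfl⟩
  · rintro ⟨a, rfl, rfl⟩
    exact ⟨a, _, rfl, rfl, rfl⟩

theorem isXPair_xpn (a n : Omega M) : IsXPair (a.succ : M) (nu (n : M)) (xpn a n) :=
  isXPair_nu_iff.2 ⟨a, rfl, rfl⟩

theorem exists_iter_value {u p : Omega M} (h : Transl u p) (x n : Omega M) :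
    ∃ c, EvPR (cd 8 p 0) (.pair x n) c :=
  let ⟨c, _, hc⟩ := h.typed.iter_total (el_nat x) n
  ⟨c, (hc c).2 rfl⟩

/-- The translated iteration runs on trash arguments too and produces some `c`; the guard discards
it, as the second component of `z` is not a numeral. -/
theorem guard_of_trash {z : Omega M} (h : ∀ a n, z ≠ xpn a n) (c : Omega M) :
    PR.xguard.den (PR.nn c (PR.xsnd.den z)) = (0 : Omega M) := by
  obtain rfl | ⟨n, rfl⟩ | ⟨a, b, rfl⟩ := z.zero_or_xn_or_xp
  · simp
  · simp
  obtain ⟨k, n, rfl⟩ := b.exists_pair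
  obtain rfl | ⟨k, rfl⟩ := k.eq_zero_or_succ
  · exact absurd rfl (h a n)
  -- Here the second component `b + 1` has a positive first Cantor coordinate and is itself the pair
  -- `xp k n`.
  · rw [PR.den_xsnd_xp]
    exact PR.den_xguard_xp k n c

theorem fst_snd_of_trash {z : Omega M} (h : ∀ a b, z ≠ xp a b) :
    PR.xfst.den z = (0 : Omega M) ∧ PR.xsnd.den z = (0 : Omega M) := by
  obtain rfl | ⟨n, rfl⟩ | ⟨a, b, rfl⟩ := z.zero_or_xn_or_xp
  · simp
  · simp
  · exact absurd rfl (h a b)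

/-- One inclusion, by induction on `Ev`. Quantifying over all translations `p` avoids proving that
codes have translations, and inversion of `Transl` passes from the translation of a compound code to
those of its parts. -/
theorem Ev.evPR {u x y : M} (h : Ev u x y) :
    Lift3 (fun u x y => ∀ p, Transl u p → EvPR p x y) u x y := by
  refine least3_induction (R := fun u x y => ∀ p, Transl u p → EvPR p x y) ?_ ?_ h
  · have hR₂ := transl_dfn (M := M)
    have hR₃ := evPR_dfn (M := M)
    exact Dfn.auto
  have trash {z : Omega M} (h : ∀ x y : M, ¬ IsXPair x y z) :
      PR.xfst.den z = (0 : Omega M) ∧ PR.xsnd.den z = (0 : Omega M) :=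
    fst_snd_of_trash fun a b e => h _ _ (e ▸ isXPair_xp a b)
  constructor
  case zero =>
    refine .of (code_coe 0 0 0) (nu_coe 0) (nu_coe 0) fun p hp => ?_
    rw [Transl.zero_iff.1 hp, evPR_cd_nat]
    simp [PRX.toPR]
  case zeroTrash =>
    intro x hx h
    refine .of (a := cd 0 0 0) (b := hx.toOmega) (c := 0) (code_coe 0 0 0) rfl rfl fun p hp => ?_
    rw [Transl.zero_iff.1 hp, evPR_cd_nat]
    exact (PR.den_xzero_of_ne _ fun e => h ((congrArg Subtype.val e).trans (nu_coe 0).symm)).symm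
  case succ =>
    intro n hn
    refine .of (code_coe 1 0 0) (nu_coe hn.toOmega) (nu_coe hn.toOmega.succ) fun p hp => ?_
    rw [Transl.succ_iff.1 hp, evPR_cd_nat]
    simp [PRX.toPR]
  case succTrash =>
    intro x hx h
    refine .of (a := cd 1 0 0) (b := hx.toOmega) (c := 0) (code_coe 1 0 0) rfl rfl fun p hp => ?_
    rw [Transl.succ_iff.1 hp, evPR_cd_nat]
    obtain e | ⟨n, e⟩ | ⟨a, b, e⟩ := hx.toOmega.zero_or_xn_or_xp
    · simp [e, PRX.toPR]
    · exact absurd ((congrArg Subtype.val e).trans (nu_coe n).symm) (h n n.2)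
    · simp [e, PRX.toPR]
  case id =>
    intro x hx
    refine .of (a := cd 2 0 0) (b := hx.toOmega) (c := hx.toOmega) (code_coe 2 0 0) rfl rfl
      fun p hp => ?_
    rw [Transl.id_iff.1 hp, evPR_cd_nat]
    rfl
  case term =>
    intro x hx
    obtain ⟨a, rfl⟩ := inX_iff.1 hx
    refine .of (code_coe 3 0 0) rfl (nu_coe 0) fun p hp => ?_
    rw [Transl.term_iff.1 hp, evPR_cd_nat]
    simp [PRX.toPR]
  case termTrash =>
    refine .of (b := 0) (c := 0) (code_coe 3 0 0) rfl rfl fun p hp => ?_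
    rw [Transl.term_iff.1 hp, evPR_cd_nat]
    simp [PRX.toPR]
  case diag =>
    intro x z hx h
    refine .of (b := hx.toOmega) (code_coe 4 0 0) rfl ((xPairVal_iff (x := hx.toOmega) (y := hx.toOmega)).1 h)
      fun p hp => ?_
    rw [Transl.diag_iff.1 hp, evPR_cd_nat]
    rfl
  case fst =>
    intro x y z h
    obtain ⟨a, b, rfl, rfl, rfl⟩ := isXPair_iff.1 h
    refine .of (code_coe 5 0 0) rfl rfl fun p hp => ?_
    rw [Transl.fst_iff.1 hp, evPR_cd_nat]
    simp [PRX.toPR]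
  case fstTrash =>
    intro z hz h
    refine .of (b := hz.toOmega) (c := 0) (code_coe 5 0 0) rfl rfl fun p hp => ?_
    rw [Transl.fst_iff.1 hp, evPR_cd_nat]
    exact (trash (z := hz.toOmega) h).1.symm
  case snd =>
    intro x y z h
    obtain ⟨a, b, rfl, rfl, rfl⟩ := isXPair_iff.1 h
    refine .of (code_coe 6 0 0) rfl rfl fun p hp => ?_
    rw [Transl.snd_iff.1 hp, evPR_cd_nat]
    simp [PRX.toPR]
  case sndTrash =>
    intro z hz h
    refine .of (b := hz.toOmega) (c := 0) (code_coe 6 0 0) rfl rfl fun p hp => ?_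
    rw [Transl.snd_iff.1 hp, evPR_cd_nat]
    exact (trash (z := hz.toOmega) h).2.symm
  case comp =>
    rintro u v x y z ⟨hu, hx, hy, h⟩ ⟨hv, _, hz, h'⟩
    refine .of (code_coe 7 hv.toOmega hu.toOmega) (b := hx.toOmega) (c := hz.toOmega) rfl rfl
      fun p hp => ?_
    obtain ⟨r, q, hr, hq, rfl⟩ := (Transl.comp_iff ..).1 hp
    exact (evPR_comp ..).2 ⟨_, h r hr, h' q hq⟩
  case ind =>
    rintro u v x y z w ⟨hu, hx, hy, h⟩ ⟨hv, _, hz, h'⟩ hw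
    refine .of (code_coe 8 hu.toOmega hv.toOmega) (b := hx.toOmega) rfl
      ((xPairVal_iff (x := hy.toOmega) (y := hz.toOmega)).1 hw) fun p hp => ?_
    obtain ⟨r, q, hr, hq, rfl⟩ := (Transl.ind_iff ..).1 hp
    exact (evPR_xInd ..).2 ⟨_, _, h r hr, h' q hq, rfl⟩
  case prod =>
    rintro u v x y z x' y' w hz ⟨hu, hx, hx', h⟩ ⟨hv, hy, hy', h'⟩ hw
    obtain ⟨a, b, rfl, rfl, rfl⟩ := isXPair_iff.1 hz
    refine .of (code_coe 9 hu.toOmega hv.toOmega) rfl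
      ((xPairVal_iff (x := hx'.toOmega) (y := hy'.toOmega)).1 hw) fun p hp => ?_
    obtain ⟨r, q, hr, hq, rfl⟩ := (Transl.prod_iff ..).1 hp
    refine (evPR_xProd ..).2 ⟨_, _, ?_, ?_, rfl⟩
    · rw [PR.den_xfst_xp]; exact h r hr
    · rw [PR.den_xsnd_xp]; exact h' q hq
  case prodTrash =>
    rintro u v z hu hv hz h
    obtain ⟨h1, h2⟩ := trash (z := hz.toOmega) h
    refine .of (code_coe 9 hu.1.toOmega hv.1.toOmega) (b := hz.toOmega) (c := 0) rfl rfl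
      fun p hp => ?_
    obtain ⟨r, q, hr, hq, rfl⟩ := (Transl.prod_iff ..).1 hp
    exact (evPR_xProd ..).2 ⟨0, 0, h1 ▸ hr.strict, h2 ▸ hq.strict, by simp⟩
  case iterZero =>
    rintro u x z hu hz
    obtain ⟨a, rfl, rfl⟩ := (isXPair_nu_iff (n := 0)).1 hz
    refine .of (code_coe 10 hu.1.toOmega 0) rfl rfl fun p hp => ?_
    obtain ⟨r, hr, rfl⟩ := (Transl.iter_iff ..).1 hp
    refine (evPR_xIter ..).2 ⟨a.succ, ?_, by simp⟩
    simpa using (evPR_iter_zero ..).2 ⟨rfl, hr.typed.exists_value (el_nat _)⟩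
  case iterSucc =>
    rintro u x n z z' y w hn hz hz' ⟨hi, hz₁, hy, h⟩ ⟨hu, _, hw, h'⟩
    obtain ⟨a, rfl, rfl⟩ := (isXPair_nu_iff (n := hn.toOmega)).1 hz
    obtain ⟨a', ha, rfl⟩ := (isXPair_nu_iff (n := hn.toOmega.succ)).1 hz'
    obtain rfl := Omega.succ_inj.1 (Subtype.ext ha)
    have e : hi.toOmega = cd 10 hu.toOmega 0 := Subtype.ext (code_coe 10 hu.toOmega 0)
    rw [e] at h
    refine .of (code_coe 10 hu.toOmega 0) rfl (c := hw.toOmega) rfl fun p hp => ?_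
    have hi := h p hp
    obtain ⟨r, hr, rfl⟩ := (Transl.iter_iff ..).1 hp
    obtain ⟨c, hc, hc'⟩ := (evPR_xIter ..).1 hi
    have e' : hz₁.toOmega = xpn a hn.toOmega := rfl
    rw [e'] at hc hc'
    simp only [PR.den_xfst_xpn, PR.den_xsnd_xpn, PR.den_xnum_xn, PR.den_xguard_xn] at hc hc'
    refine (evPR_xIter ..).2 ⟨hw.toOmega, ?_, by simp⟩
    simp only [PR.den_xfst_xpn, PR.den_xsnd_xpn, PR.den_xnum_xn]
    exact (evPR_iter_succ ..).2 ⟨c, hc, hc' ▸ h' r hr⟩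
  case iterTrash =>
    rintro u z hu hz h
    refine .of (code_coe 10 hu.1.toOmega 0) (b := hz.toOmega) (c := 0) rfl rfl fun p hp => ?_
    obtain ⟨r, hr, rfl⟩ := (Transl.iter_iff ..).1 hp
    obtain ⟨c, hc⟩ := exists_iter_value hr (PR.xfst.den hz.toOmega)
      (PR.xnum.den (PR.xsnd.den hz.toOmega))
    refine (evPR_xIter ..).2 ⟨c, hc, (guard_of_trash (fun a n e => ?_) c).symm⟩
    exact h _ n n.2 (((congrArg Subtype.val e : z = _) ▸ isXPair_xpn a n))

end
-- The converse inclusion, evaluation soundness, and concrete maps.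
section

variable {M : Type w} [setLang.Structure M] [Nonempty M] [ZModel M]

open FramedPR.Omega (cd xn xp xpn)

/-- The inner half of the double recursion: induction on the counter, while `ih` comes from the
outer induction on the code. -/
theorem in3_iter {S : M} (hS : EvClosed (In3 S)) {u p : Omega M} (hu : Transl u p)
    (ih : ∀ x y, EvPR p x y → Omega.In3 S u x y) (a n : Omega M) :
    ∀ c, EvPR (cd 8 p 0) (.pair a.succ n) c → Omega.In3 S (cd 10 u 0) (xpn a n) c := by
  have e : xIter (u : M) = (cd 10 u 0 : Omega M) := code_coe 10 u 0
  induction n using Omega.induction with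
  | hP =>
    have h₁ := evPR_dfn (M := M)
    have h₂ := in3_dfn S
    refine .all (.imp (Dfn.comp₃ h₁ (.const _) (.pairing (.const _) .fstProj) .sndProj)
      (Dfn.comp₃ h₂ (.const _) ?_ .sndProj))
    exact .succ (.pairing (.const _) (.pairing (.const _) .fstProj))
  | zero =>
    intro c hc
    obtain ⟨rfl, -⟩ := (evPR_iter_zero ..).1 hc
    have := hS.iterZero u _ _ hu.isPRX (isXPair_xpn a 0)
    rwa [e] at this
  | succ n hn =>
    intro c hc
    obtain ⟨d, hd, hc⟩ := (evPR_iter_succ ..).1 hc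
    have := hS.iterSucc u _ n _ _ d c n.2 (isXPair_xpn a n) (isXPair_xpn a n.succ)
      (by rw [e]; exact hn d hd) (ih _ _ hc)
    rwa [e] at this

/-- `Ev` is the intersection of all closed relations, so each of them has to contain the graph of
the translation. `Transl u p` is carried along in the conclusion because the trash and iteration
clauses need code membership, typing and strictness of the parts. -/
theorem Transl.in3 {S : M} (hS : EvClosed (In3 S)) {u p : Omega M} (h : Transl u p) :
    Transl u p ∧ ∀ x y, EvPR p x y → Omega.In3 S u x y := by
  have c (t : ℕ) (a b : Omega M) := code_coe t a b
  have trash {z : Omega M} (h : ∀ a b, z ≠ xp a b) (x y : M) : ¬ IsXPair x y z := fun e => by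
    obtain ⟨a, b, e⟩ := exists_isXPair_iff.1 ⟨x, y, e⟩
    exact h a b e
  refine Transl.induction (R := fun u p => Transl u p ∧ ∀ x y, EvPR p x y → Omega.In3 S u x y)
    ?_ ?_ ?_ ?_ ?_ ?_ ?_ ?_ ?_ ?_ ?_ ?_ h
  · have h₀ := transl_dfn (M := M)
    have h₁ := evPR_dfn (M := M)
    have h₂ := in3_dfn S
    exact .and h₀ (.all (.all (.imp (Dfn.comp₃ h₁ (.snd (.fst .fstProj)) (.snd .fstProj) .sndProj)
      (Dfn.comp₃ h₂ (.fst (.fst .fstProj)) (.snd .fstProj) .sndProj))))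
  · refine ⟨Transl.zero_iff.2 rfl, fun x y hy => ?_⟩
    obtain rfl := (evPR_cd_nat ..).1 hy
    unfold Omega.In3
    rw [← c]
    by_cases hx : x = xn 0
    · subst hx
      have := hS.zero
      rw [show nu (empty : M) = xn (0 : Omega M) from nu_coe 0] at this
      rwa [PRX.toPR, PR.den_xzero_xn_zero]
    · rw [PRX.toPR, PR.den_xzero_of_ne _ hx]
      exact hS.zeroTrash x x.2 fun e => hx (Subtype.ext (e.trans (nu_coe 0)))
  · refine ⟨Transl.succ_iff.2 rfl, fun x y hy => ?_⟩
    obtain rfl := (evPR_cd_nat ..).1 hy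
    unfold Omega.In3
    rw [← c, PRX.toPR]
    have succTrash {x : Omega M} (h : ∀ n, x ≠ xn n) := hS.succTrash x x.2 fun n hn e =>
      h hn.toOmega (Subtype.ext (e.trans (nu_coe hn.toOmega)))
    obtain rfl | ⟨n, rfl⟩ | ⟨a, b, rfl⟩ := x.zero_or_xn_or_xp
    · rw [PR.den_xsucc_zero]
      exact succTrash fun n => (Omega.xn_ne_zero n).symm
    · rw [PR.den_xsucc_xn, ← nu_coe, ← nu_coe]
      exact hS.succ n n.2
    · rw [PR.den_xsucc_xp]
      exact succTrash fun n => Omega.xp_ne_xn a b n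
  · refine ⟨Transl.id_iff.2 rfl, fun x y hy => ?_⟩
    obtain rfl := (evPR_cd_nat ..).1 hy
    unfold Omega.In3
    rw [← c]
    exact hS.id y y.2
  · refine ⟨Transl.term_iff.2 rfl, fun x y hy => ?_⟩
    obtain rfl := (evPR_cd_nat ..).1 hy
    unfold Omega.In3
    rw [← c, PRX.toPR]
    obtain rfl | ⟨a, rfl⟩ := x.eq_zero_or_succ
    · rw [PR.den_xterm_zero]
      exact hS.termTrash
    · rw [PR.den_xterm_succ, ← nu_coe]
      exact hS.term _ (inX_iff.2 ⟨a, rfl⟩)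
  · refine ⟨Transl.diag_iff.2 rfl, fun x y hy => ?_⟩
    obtain rfl := (evPR_cd_nat ..).1 hy
    unfold Omega.In3
    rw [← c]
    exact hS.diag x _ x.2 (xPairVal_iff.2 rfl)
  · refine ⟨Transl.fst_iff.2 rfl, fun x y hy => ?_⟩
    obtain rfl := (evPR_cd_nat ..).1 hy
    unfold Omega.In3
    rw [← c, PRX.toPR]
    by_cases hx : ∃ a b, x = xp a b
    · obtain ⟨a, b, rfl⟩ := hx
      rw [PR.den_xfst_xp]
      exact hS.fst _ _ _ (isXPair_xp a b)
    · push Not at hx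
      rw [(fst_snd_of_trash hx).1]
      exact hS.fstTrash x x.2 (trash hx)
  · refine ⟨Transl.snd_iff.2 rfl, fun x y hy => ?_⟩
    obtain rfl := (evPR_cd_nat ..).1 hy
    unfold Omega.In3
    rw [← c, PRX.toPR]
    by_cases hx : ∃ a b, x = xp a b
    · obtain ⟨a, b, rfl⟩ := hx
      rw [PR.den_xsnd_xp]
      exact hS.snd _ _ _ (isXPair_xp a b)
    · push Not at hx
      rw [(fst_snd_of_trash hx).2]
      exact hS.sndTrash x x.2 (trash hx)
  · rintro u v p q ⟨hu, h⟩ ⟨hv, h'⟩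
    refine ⟨(Transl.comp_iff ..).2 ⟨_, _, hu, hv, rfl⟩, fun x y hy => ?_⟩
    obtain ⟨d, h1, h2⟩ := (evPR_comp ..).1 hy
    unfold Omega.In3
    rw [← c]
    exact hS.comp u v x d y (h _ _ h1) (h' _ _ h2)
  · rintro u v p q ⟨hu, h⟩ ⟨hv, h'⟩
    refine ⟨(Transl.ind_iff ..).2 ⟨_, _, hu, hv, rfl⟩, fun x y hy => ?_⟩
    obtain ⟨a, b, h1, h2, rfl⟩ := (evPR_xInd ..).1 hy
    unfold Omega.In3
    rw [← c]
    exact hS.ind u v x a b _ (h _ _ h1) (h' _ _ h2) (xPairVal_iff.2 rfl)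
  · rintro u v p q ⟨hu, h⟩ ⟨hv, h'⟩
    refine ⟨(Transl.prod_iff ..).2 ⟨_, _, hu, hv, rfl⟩, fun x y hy => ?_⟩
    obtain ⟨a, b, h1, h2, rfl⟩ := (evPR_xProd ..).1 hy
    unfold Omega.In3
    rw [← c]
    by_cases hx : ∃ a b, x = xp a b
    · obtain ⟨m, n, rfl⟩ := hx
      rw [PR.den_xfst_xp] at h1
      rw [PR.den_xsnd_xp] at h2
      exact hS.prod u v _ _ _ a b _ (isXPair_xp m n) (h _ _ h1) (h' _ _ h2) (xPairVal_iff.2 rfl)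
    · push Not at hx
      rw [(fst_snd_of_trash hx).1] at h1
      -- Strictness makes the first component waste, and one waste component is enough to make the
      -- pair waste.
      rw [hu.typed.unique h1 hu.strict, PR.den_xpair_zero_left]
      exact hS.prodTrash u v x hu.isPRX hv.isPRX x.2 (trash hx)
  · rintro u p ⟨hu, h⟩
    refine ⟨(Transl.iter_iff ..).2 ⟨_, hu, rfl⟩, fun x y hy => ?_⟩
    obtain ⟨a, h1, rfl⟩ := (evPR_xIter ..).1 hy
    by_cases hx : ∃ m n, x = xpn m n
    · obtain ⟨m, n, rfl⟩ := hx
      simp only [PR.den_xfst_xpn, PR.den_xsnd_xpn, PR.den_xnum_xn, PR.den_xguard_xn] at h1 ⊢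
      exact in3_iter hS hu h m n a h1
    · push Not at hx
      rw [guard_of_trash hx]
      unfold Omega.In3
      rw [← c]
      refine hS.iterTrash u x hu.isPRX x.2 fun y n hn e => ?_
      obtain ⟨m, -, e⟩ := (isXPair_nu_iff (n := hn.toOmega)).1 e
      exact hx m _ (Subtype.ext e)

theorem Transl.ev {u p x y : Omega M} (h : Transl u p) (hy : EvPR p x y) : Ev (u : M) x y :=
  ⟨u.2, x.2, y.2, fun _ hS => (h.in3 hS).2 x y hy⟩

theorem Transl.ev_iff {u p x : Omega M} (h : Transl u p) {y : M} :
    Ev (u : M) x y ↔ ∃ b, EvPR p x b ∧ y = b := by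
  constructor
  · intro hy
    obtain ⟨_, _, hy, h'⟩ := hy.evPR
    exact ⟨hy.toOmega, h' p h, rfl⟩
  · rintro ⟨b, hb, rfl⟩
    exact h.ev hb

/-- Evaluation soundness. -/
theorem EqPRX.sameValue_ev {k u v x : M} (h : EqPRX k u v) (hx : IsNat x) :
    SameValue (Ev u x) (Ev v x) := by
  obtain ⟨p, q, hp, hq, h⟩ := h
  obtain ⟨hu, hp', hp⟩ := hp.transl
  obtain ⟨hv, hq', hq⟩ := hq.transl
  obtain ⟨_, _, _, h⟩ := lift2_sameEv h
  obtain ⟨b, -, hb⟩ := hp.typed.total hx.toOmega (el_nat _)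
  have hb' (c : Omega M) : EvPR hq'.toOmega hx.toOmega c ↔ c = b := (h _ _).symm.trans (hb c)
  refine ⟨b, fun z => (hp.ev_iff (x := hx.toOmega)).trans ?_,
    fun z => (hq.ev_iff (x := hx.toOmega)).trans ?_⟩
  · simp [hb]
  · simp [hb']

/-! ## Concrete maps -/

/-- For iteration, `Val` asks for membership in every set closed under the steps. The graph of the
denoted iterates is such a set, which leaves at most the expected value; induction on the counter
puts this graph into every such set. -/
theorem PR.val_enc {A B : Ob} (f : PR A B) (a : A.Sem M) (y : M) :
    f.Val (Enc.enc a) y ↔ y = Enc.enc (f.den a) := by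
  induction f generalizing y with
  | zero => exact Iff.rfl
  | succ => exact Iff.rfl
  | id A => exact Iff.rfl
  | comp g f hg hf =>
    constructor
    · rintro ⟨c, h, h'⟩
      obtain rfl := (hf ..).1 h
      exact (hg ..).1 h'
    · rintro rfl
      exact ⟨_, (hf ..).2 rfl, (hg ..).2 rfl⟩
  | term A => exact Iff.rfl
  | fst A B =>
    exact ⟨fun ⟨c, h⟩ => (kpair_inj.1 h).1.symm, fun h => ⟨Enc.enc (Ob.right a), h ▸ rfl⟩⟩
  | snd A B =>
    exact ⟨fun ⟨c, h⟩ => (kpair_inj.1 h).2.symm, fun h => ⟨Enc.enc (Ob.left a), h ▸ rfl⟩⟩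
  | pair f g hf hg =>
    constructor
    · rintro ⟨c, d, h, h', rfl⟩
      rw [(hf ..).1 h, (hg ..).1 h']
      rfl
    · rintro rfl
      exact ⟨_, _, (hf ..).2 rfl, (hg ..).2 rfl, rfl⟩
  | @iter A f hf =>
    obtain ⟨x, n, rfl⟩ : ∃ (x : A.Sem M) (n : Omega M), a = Ob.mk (B := Ob.nat) x n :=
      ⟨a.1, a.2, rfl⟩
    constructor
    · rintro ⟨x', n', hn, h, H⟩
      obtain ⟨rfl, rfl⟩ := kpair_inj.1 h
      obtain ⟨S, hS⟩ := exists_set_of_dfn (M := M)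
        (P := fun q : Omega M × A.Sem M => q.2 = (PR.iter f).den (M := M) (Ob.mk (B := Ob.nat) x q.1))
        Dfn.auto
      obtain ⟨⟨m, z⟩, h, h'⟩ := (hS _).1 (H S ((hS _).2 ⟨(0, x), rfl, (den_iter_zero f x).symm⟩)
        fun m y z hm hy hz => by
          obtain ⟨⟨m, y⟩, h, hy : y = (PR.iter f).den (M := M) (Ob.mk (B := Ob.nat) x m)⟩ := (hS _).1 hy
          subst hy
          obtain ⟨rfl, rfl⟩ := kpair_inj.1 h
          obtain rfl := (hf ..).1 hz
          exact (hS _).2 ⟨(m.succ, _), rfl, (den_iter_succ f x m).symm⟩)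
      obtain ⟨h1, rfl⟩ := kpair_inj.1 h
      obtain rfl : m = n := Enc.inj h1
      exact congrArg _ h'
    · rintro rfl
      refine ⟨_, _, n.2, rfl, fun S h0 hs => ?_⟩
      have key : ∀ n : Omega M,
          (Enc.enc (n, (PR.iter f).den (M := M) (Ob.mk (B := Ob.nat) x n)) : M) ∈ₘ S := fun n => by
        induction n using Omega.induction with
        | hP => exact Dfn.auto
        | zero => rw [den_iter_zero]; exact h0
        | succ n ih => rw [den_iter_succ]; exact hs _ _ _ n.2 ih ((hf ..).2 rfl)
      exact key n

theorem PRX.val_iff (f : PRX) (a : Omega M) (y : M) :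
    f.Val (a : M) y ↔ y = (f.toPR.den a : Omega M) :=
  f.toPR.val_enc (A := Ob.nat) (B := Ob.nat) a y

/-- Equality of maps `ℕ → ℕ` of PR is sound. -/
theorem den_eq_of_prded {k : M} {f g : PR Ob.nat Ob.nat} (h : PRDed k f.quote g.quote)
    (a : Omega M) : f.den a = g.den a := by
  obtain ⟨_, hf, hg, h⟩ := lift2_sameEv h
  have e : hf.toOmega = f.cd := Subtype.ext f.quote_coe
  have e' : hg.toOmega = g.cd := Subtype.ext g.quote_coe
  rw [e, e'] at h
  exact (evPR_cd_nat ..).1 ((h a _).1 ((evPR_cd_nat ..).2 rfl))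

theorem EqPRX.den_eq {k : M} {f g : PRX} (h : EqPRX k f.quote g.quote) (a : Omega M) :
    f.toPR.den a = g.toPR.den a := by
  obtain ⟨p, q, hp, hq, h⟩ := h
  rw [hp.eq_of_quote, hq.eq_of_quote] at h
  exact den_eq_of_prded h a

theorem sameValue_val {f g : PRX} {a : Omega M} (h : f.toPR.den a = g.toPR.den a) :
    SameValue (f.Val (a : M)) (g.Val (a : M)) :=
  ⟨(f.toPR.den a : Omega M), fun z => f.val_iff a z, fun z => h ▸ g.val_iff a z⟩

theorem nu_num_one : (nu (num 1) : M) = (xn (0 : Omega M).succ : Omega M) := nu_coe (0 : Omega M).succ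

theorem PRX.den_true (a : Omega M) : PRX.true.toPR.den a.succ = xn (0 : Omega M).succ := by
  simp [PRX.true, PRX.toPR]

theorem PRX.holds_iff (χ : PRX) (a : Omega M) :
    χ.Holds (a : M) ↔ χ.toPR.den a = xn (0 : Omega M).succ := by
  unfold PRX.Holds
  simp only [PRX.val_iff, nu_num_one]
  exact ⟨fun h => Subtype.ext ((h _).1 rfl), fun h z => by rw [h]⟩

/-- At `a` the premise has the value 1, and `imp` returns its second argument when the first is
positive. -/
theorem den_eq_of_impEq {χ f g : PRX} {a : Omega M}
    (h : (PRX.impEq χ f g).den a = (0 : Omega M).succ)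
    (ha : χ.toPR.den a = PRX.true.toPR.den a) : f.toPR.den a = g.toPR.den a := by
  have h1 := (PR.den_eqNat_eq_one_iff _ _).2 ha
  change PR.imp.den (PR.nn (PR.eqNat.den (PR.nn _ _)) (PR.eqNat.den (PR.nn _ _))) = _ at h
  rwa [h1, PR.den_imp_succ, PR.den_eqNat_eq_one_iff] at h

end

/-! ### Assembly of the soundness statements. -/

theorem zModel_of_models {T : setLang.Theory} (hT : ∀ σ ∈ zermelo, T ⊨ᵇ σ) {M : Type w}
    [setLang.Structure M] [Nonempty M] (hM : M ⊨ T) : ZModel M :=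
  zModel_of_realize fun σ hσ => (hT σ hσ).realize_sentence M

end FramedPR

theorem mainTheorem8 (T : setLang.Theory) (hT : ∀ σ ∈ zermelo, T ⊨ᵇ σ) :
    -- evaluation soundness
    (Derives.{w} T fun M _ _ => ∀ k u v x : M, IsNat k → IsPRX u → IsPRX v → IsNat x →
      EqPRX k u v → SameValue (Ev u x) (Ev v x)) ∧
    -- objective soundness, for internal equality of PR
    (∀ (A B : PRXaObj) (f g : PRXaMap A B), Derives.{w} T fun M _ _ =>
      (∃ k : M, EqPRX k f.f.quote g.f.quote) →
        ∀ a : M, InX a → A.χ.Holds a → SameValue (f.f.Val a) (g.f.Val a)) ∧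
    -- objective soundness, for internal equality on the domain `A`
    (∀ (A B : PRXaObj) (f g : PRXaMap A B), Derives.{w} T fun M _ _ =>
      (∃ k : M, PRDed k (PRX.impEq A.χ f.f g.f).quote (PR.oneAt Ob.nat).quote) →
        ∀ a : M, InX a → A.χ.Holds a → SameValue (f.f.Val a) (g.f.Val a)) ∧
    -- logical soundness
    (∀ χ : PRX, χ.IsPredicate → Derives.{w} T fun M _ _ =>
      (∃ k : M, Pro k χ.quote) → ∀ x : M, InX x → χ.Holds x) := by
  refine ⟨fun M _ _ hM k u v x _ _ _ hx h => ?_, fun A B f g M _ _ hM ⟨k, h⟩ a ha _ => ?_,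
    fun A B f g M _ _ hM ⟨k, h⟩ a ha hχ => ?_, fun χ _ M _ _ hM ⟨k, h⟩ x hx => ?_⟩ <;>
    have := zModel_of_models hT hM
  · exact h.sameValue_ev hx
  · obtain ⟨a, rfl⟩ := inX_iff.1 ha
    exact sameValue_val (h.den_eq _)
  · obtain ⟨a, rfl⟩ := inX_iff.1 ha
    refine sameValue_val (den_eq_of_impEq (den_eq_of_prded h _) ?_)
    -- `Holds` gives `χ(a) = ν 1`, which is the value of `true` at `a` because `a` lies in `X` and
    -- is not `⊥`.
    rw [(PRX.holds_iff _ _).1 hχ, PRX.den_true]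
  · obtain ⟨a, rfl⟩ := inX_iff.1 hx
    rw [PRX.holds_iff, EqPRX.den_eq h, PRX.den_true]
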